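/- Let $n$ be a positive integer, $1<p<n$ (so $n\ge 2$), $p^*:=\frac{np}{n-p}$ and $q\ge p^*-1$. Let $\mathbb{M}^n$ be a Cartan-Hadamard model manifold: $\mathbb{M}^n=\mathbb{R}^n$ with a pole $o=0$ and, in polar coordinates $(r,\theta)\in(0,\infty)\times\mathbb{S}^{n-1}$ about $o$, the metric $g=dr^2+\psi(r)^2\,g_{\mathbb{S}^{n-1}}$, where $\psi:[0,\infty)\to[0,\infty)$ is convex, of class $C^1$ on $[0,\infty)$ and $C^2$ on $(0,\infty)$, with $\psi(0)=0$ and $\psi'(0)=1$. Put $$\Theta(r):=\frac{\int_0^r\psi^{n-1}\,ds}{\psi^{n-1}(r)},\qquad r>0.$$ By a radial solution we mean a function $u\in W^{1,p}_{\mathrm{loc}}(\mathbb{M}^n)\cap L^\infty_{\mathrm{loc}}(\mathbb{M}^n)$ with $u>0$ almost everywhere which depends (almost everywhere) only on the distance $r$ from $o$ and is a weak solution of $-\Delta_p u=u^q$, where $\Delta_p u=\mathrm{div}(|\nabla u|^{p-2}\nabla u)$, that is $$\int_{\mathbb{M}^n}|\nabla u|^{p-2}\,g(\nabla u,\nabla\varphi)\,dV=\int_{\mathbb{M}^n}u^q\varphi\,dV\qquad\text{for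 all }\varphi\in C_c^\infty(\mathbb{M}^n).$$ Then there exist infinitely many radial solutions (pairwise different modulo equality almost everywhere), and: (i) if $\Theta^{1/(p-1)}\notin L^1(0,\infty)$, then every radial solution agrees almost everywhere with a function $f(r)$ with $f$ continuous and strictly decreasing on $[0,\infty)$, and $f(r)\to 0$ as $r\to\infty$; (ii) if $\Theta^{1/(p-1)}\in L^1(0,\infty)$, then every radial solution agrees almost everywhere with a function $f(r)$ with $f$ continuous and strictly decreasing on $[0,\infty)$, and $f(r)$ tends to a positive constant as $r\to\infty$. -/

import Mathlib

open Set Filter Topology MeasureTheory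
open scoped ENNReal ContDiff

noncomputable section

/-- Model functions `ψ : [0, ∞) → [0, ∞)` of Cartan-Hadamard type: `ψ (0) = 0`, `ψ' (0) = 1`,
`ψ` convex (so `ψ r ≥ r`).  Of the smoothness of `ψ` only `C¹([0, ∞)) ∩ C²((0, ∞))` is asked;
the values of `ψ` on negative numbers are irrelevant. -/
structure IsCartanHadamardModel (ψ : ℝ → ℝ) : Prop where
  contDiffOn_Ici : ContDiffOn ℝ 1 ψ (Ici 0)
  contDiffOn_Ioi : ContDiffOn ℝ 2 ψ (Ioi 0)
  map_zero : ψ 0 = 0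
  hasDerivWithinAt_zero : HasDerivWithinAt ψ 1 (Ici 0) 0
  convexOn : ConvexOn ℝ (Ici 0) ψ

/-- The model manifold is `ℝⁿ` (geodesic normal coordinates about the pole `o = 0`) with the
metric `g = dr² + ψ(r)² g_{𝕊ⁿ⁻¹}`, where `r = ‖x‖`.  Here `dr v = ⟪x, v⟫ / ‖x‖`, and
`r² g_{𝕊ⁿ⁻¹} (v, w) = ⟪v, w⟫ - dr v * dr w`.  At the pole `g` is the Euclidean inner product. -/
def modelMetric (n : ℕ) (ψ : ℝ → ℝ) (x v w : EuclideanSpace ℝ (Fin n)) : ℝ :=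
  if x = 0 then inner ℝ v w
  else
    (inner ℝ x v / ‖x‖) * (inner ℝ x w / ‖x‖) +
      (ψ ‖x‖ / ‖x‖) ^ 2 *
        (inner ℝ v w - (inner ℝ x v / ‖x‖) * (inner ℝ x w / ‖x‖))

/-- The length `|v|_g` of a tangent vector `v` at `x`. -/
def modelNorm (n : ℕ) (ψ : ℝ → ℝ) (x v : EuclideanSpace ℝ (Fin n)) : ℝ :=
  Real.sqrt (modelMetric n ψ x v v)

/-- The Riemannian volume density `√(det (g_ij))` in the coordinates of `ℝⁿ`. -/
def modelDensity (n : ℕ) (ψ : ℝ → ℝ) (x : EuclideanSpace ℝ (Fin n)) : ℝ :=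
  Real.sqrt (Matrix.det (Matrix.of fun i j : Fin n =>
    modelMetric n ψ x (EuclideanSpace.single i 1) (EuclideanSpace.single j 1)))

/-- The Riemannian volume measure `dV = √(det (g_ij)) dx`. -/
def modelVolume (n : ℕ) (ψ : ℝ → ℝ) : Measure (EuclideanSpace ℝ (Fin n)) :=
  volume.withDensity fun x => ENNReal.ofReal (modelDensity n ψ x)

/-- The vector field `X` is the weak Riemannian gradient of `u`: the weak (distributional)
differential of `u` is the covector field `g (X, ·)`. -/
def IsWeakGradient (n : ℕ) (ψ : ℝ → ℝ) (u : EuclideanSpace ℝ (Fin n) → ℝ)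
    (X : EuclideanSpace ℝ (Fin n) → EuclideanSpace ℝ (Fin n)) : Prop :=
  ∀ φ : EuclideanSpace ℝ (Fin n) → ℝ, ContDiff ℝ ∞ φ → HasCompactSupport φ →
    ∀ v : EuclideanSpace ℝ (Fin n),
      ∫ x, u x * fderiv ℝ φ x v = - ∫ x, modelMetric n ψ x (X x) v * φ x

/-- `u ∈ W^{1,p}_loc(M) ∩ L^∞_loc(M)`, with weak gradient `X`. -/
structure IsLocSobolevBounded (n : ℕ) (ψ : ℝ → ℝ) (p : ℝ) (u : EuclideanSpace ℝ (Fin n) → ℝ)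
    (X : EuclideanSpace ℝ (Fin n) → EuclideanSpace ℝ (Fin n)) : Prop where
  memLp : ∀ K : Set (EuclideanSpace ℝ (Fin n)), IsCompact K →
    MemLp u (ENNReal.ofReal p) ((modelVolume n ψ).restrict K)
  memLp_top : ∀ K : Set (EuclideanSpace ℝ (Fin n)), IsCompact K →
    MemLp u ∞ ((modelVolume n ψ).restrict K)
  isWeakGradient : IsWeakGradient n ψ u X
  aestronglyMeasurable_grad : AEStronglyMeasurable X (modelVolume n ψ)
  memLp_grad : ∀ K : Set (EuclideanSpace ℝ (Fin n)), IsCompact K →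
    MemLp (fun x => modelNorm n ψ x (X x)) (ENNReal.ofReal p) ((modelVolume n ψ).restrict K)

/-- `u` is a weak solution of `-Δ_p u = u ^ q`, `u > 0` on `M`, in the class
`W^{1,p}_loc(M) ∩ L^∞_loc(M)`: with `X = ∇u`, for every test function `φ`,
`∫ |∇u|^{p-2} g (∇u, ∇φ) dV = ∫ u ^ q φ dV`.  Note that `g (∇u, ∇φ) = dφ (∇u)`. -/
def IsWeakSolution (n : ℕ) (ψ : ℝ → ℝ) (p q : ℝ) (u : EuclideanSpace ℝ (Fin n) → ℝ) : Prop :=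
  (∀ᵐ x ∂(modelVolume n ψ), 0 < u x) ∧
  ∃ X : EuclideanSpace ℝ (Fin n) → EuclideanSpace ℝ (Fin n),
    IsLocSobolevBounded n ψ p u X ∧
    ∀ φ : EuclideanSpace ℝ (Fin n) → ℝ, ContDiff ℝ ∞ φ → HasCompactSupport φ →
      ∫ x, modelNorm n ψ x (X x) ^ (p - 2) * fderiv ℝ φ x (X x) ∂(modelVolume n ψ) =
        ∫ x, u x ^ q * φ x ∂(modelVolume n ψ)

/-- `f` is a radial profile of `u`: `u = f (r)` almost everywhere, `r = ‖x‖` being the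
distance of `x` from the pole. -/
def HasRadialProfile (n : ℕ) (ψ : ℝ → ℝ) (u : EuclideanSpace ℝ (Fin n) → ℝ) (f : ℝ → ℝ) : Prop :=
  ∀ᵐ x ∂(modelVolume n ψ), u x = f ‖x‖

/-- Radial (positive, weak) solutions of `-Δ_p u = u ^ q` on the model manifold. -/
def IsRadialSolution (n : ℕ) (ψ : ℝ → ℝ) (p q : ℝ) (u : EuclideanSpace ℝ (Fin n) → ℝ) : Prop :=
  IsWeakSolution n ψ p q u ∧ ∃ f : ℝ → ℝ, HasRadialProfile n ψ u f

/-- The volume-surface ratio `Θ (r) = (∫₀ʳ ψ^{n-1} ds) / ψ (r)^{n-1}`. -/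
def modelTheta (n : ℕ) (ψ : ℝ → ℝ) (r : ℝ) : ℝ :=
  (∫ s in (0 : ℝ)..r, ψ s ^ (n - 1)) / ψ r ^ (n - 1)

end

/-! Write `a = ψ^(n-1)`, `V(r) = ∫₀ʳ a` and `Θ = V / a`. A radial solution with profile `f`
satisfies `(a |f'|^(p-2) f')' = -a f^q` with zero flux at the pole. With `y = (1/a) ∫₀ʳ a f^q`
(`radialFlux`) this is the integral equation `f' = -y^(1/(p-1))`, with the height `α = f(0)` as
parameter; constant data give `Θ = radialFlux a 1`.

Everything rests on comparing `|f'|` with `Θ^(1/(p-1))`. Convexity of `ψ` gives `V a' ≥ (1 - 1/n)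
a²`, and `q + 1 ≥ p*` is the same as `(p-1)/p + 1/(q+1) ≤ 1 - 1/n`. Together they make the Pohozaev
functional nonincreasing, hence nonpositive, so `V |f'| ≤ p/((p-1)(q+1)) a f` (`pohozaev`). Because
`p < q + 1`, this upgrades to `y ≤ C Θ f^(p-1)` (`flux_le`), that is `|f'| ≤ κ Θ^(1/(p-1)) f`, and
Grönwall's argument gives `f(r) ≥ α exp(-κ ∫₀ʳ Θ^(1/(p-1)))` (`initial_mul_exp_le`). Hence a profile
never reaches zero, which yields a global one for every `α > 0` and so infinitely many solutions;
and its limit is positive when `Θ^(1/(p-1))` is integrable. Conversely, if `f ≥ l > 0` then `y ≥ l^q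
Θ`, and `∫₀ʳ y^(1/(p-1)) = α - f(r) < α` forces `Θ^(1/(p-1))` to be integrable; so without
integrability the limit is zero.

It remains to match weak solutions with profiles. A profile gives a weak solution by computing the
divergence of an explicit radial field (`isRadialSolution_of_isPositiveProfile`). For the converse
(`IsRadialSolution.exists_isPositiveProfile`), mollification by radial kernels shows that the weak
gradient of a radial function is radial; radial test functions then reduce the equation to one
dimension, where it determines the gradient; integrating the gradient recovers `u` up to a constant,
which is `α`. -/

/-- A weight `a` on the half line, extended by zero to `(-∞, 0]`, which is increasing and whose
primitive `V` satisfies `V a' ≥ (1 - 1 / m) a²`. -/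
structure IsRadialWeight (m : ℝ) (a a' : ℝ → ℝ) : Prop where
  continuous : Continuous a
  eq_zero : ∀ r ≤ 0, a r = 0
  pos : ∀ r, 0 < r → 0 < a r
  monotone : Monotone a
  hasDerivAt : ∀ r, 0 < r → HasDerivAt a (a' r) r
  growth : ∀ r, 0 < r → (1 - 1 / m) * a r ^ 2 ≤ (∫ s in (0 : ℝ)..r, a s) * a' r

/-- The weighted mean `(∫₀ʳ a b) / a (r)`. -/
noncomputable def radialFlux (a b : ℝ → ℝ) (r : ℝ) : ℝ :=
  (∫ t in (0 : ℝ)..r, a t * b t) / a r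

namespace IsRadialWeight

variable {m : ℝ} {a a' : ℝ → ℝ}

lemma nonneg (w : IsRadialWeight m a a') (r : ℝ) : 0 ≤ a r := by
  rcases le_or_gt r 0 with h | h
  · rw [w.eq_zero r h]
  · exact (w.pos r h).le

lemma radialFlux_of_nonpos (w : IsRadialWeight m a a') (b : ℝ → ℝ) {r : ℝ} (hr : r ≤ 0) :
    radialFlux a b r = 0 := by
  simp [radialFlux, w.eq_zero r hr]

lemma mul_radialFlux (w : IsRadialWeight m a a') (b : ℝ → ℝ) {r : ℝ} (hr : 0 < r) :
    a r * radialFlux a b r = ∫ t in (0 : ℝ)..r, a t * b t := by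
  rw [radialFlux, mul_div_cancel₀ _ (w.pos r hr).ne']

lemma integral_pos (w : IsRadialWeight m a a') {b : ℝ → ℝ} (hb : Continuous b) {r : ℝ}
    (hr : 0 < r) (hpos : ∀ t ∈ Ioc 0 r, 0 < b t) : 0 < ∫ t in (0 : ℝ)..r, a t * b t :=
  intervalIntegral.intervalIntegral_pos_of_pos_on
    ((w.continuous.mul hb).intervalIntegrable _ _)
    (fun t ht => mul_pos (w.pos t ht.1) (hpos t ⟨ht.1, ht.2.le⟩)) hr

lemma radialFlux_pos (w : IsRadialWeight m a a') {b : ℝ → ℝ} (hb : Continuous b) {r : ℝ}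
    (hr : 0 < r) (hpos : ∀ t ∈ Ioc 0 r, 0 < b t) : 0 < radialFlux a b r :=
  div_pos (w.integral_pos hb hr hpos) (w.pos r hr)

lemma radialFlux_mono_of_le (w : IsRadialWeight m a a') {b c : ℝ → ℝ} {r : ℝ}
    (hb : IntervalIntegrable (fun t => a t * b t) volume 0 r)
    (hc : IntervalIntegrable (fun t => a t * c t) volume 0 r) (hr : 0 ≤ r)
    (h : ∀ t ∈ Icc 0 r, b t ≤ c t) : radialFlux a b r ≤ radialFlux a c r := by
  refine div_le_div_of_nonneg_right ?_ (w.nonneg r)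
  exact intervalIntegral.integral_mono_on hr hb hc
    fun t ht => mul_le_mul_of_nonneg_left (h t ht) (w.nonneg t)

lemma radialFlux_const (c r : ℝ) :
    radialFlux a (fun _ => c) r = c * radialFlux a (fun _ => 1) r := by
  simp only [radialFlux, intervalIntegral.integral_mul_const]
  ring

lemma radialFlux_one_nonneg (w : IsRadialWeight m a a') (r : ℝ) :
    0 ≤ radialFlux a (fun _ => 1) r := by
  rcases le_or_gt r 0 with h | h
  · rw [w.radialFlux_of_nonpos _ h]
  · exact (w.radialFlux_pos continuous_const h fun _ _ => one_pos).le

/-- An increasing weight has mean at most its endpoint value, so `Θ(r) ≤ r`. This controls the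
quotient `0 / 0` at the pole. -/
lemma radialFlux_one_le (w : IsRadialWeight m a a') {r : ℝ} (hr : 0 ≤ r) :
    radialFlux a (fun _ => 1) r ≤ r := by
  rcases hr.eq_or_lt with rfl | hr
  · rw [w.radialFlux_of_nonpos _ le_rfl]
  rw [radialFlux, div_le_iff₀ (w.pos r hr)]
  calc ∫ t in (0 : ℝ)..r, a t * 1 ≤ ∫ _ in (0 : ℝ)..r, a r :=
        intervalIntegral.integral_mono_on hr.le
          ((w.continuous.mul continuous_const).intervalIntegrable _ _)
          (continuous_const.intervalIntegrable _ _)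
          fun t ht => by simpa using w.monotone ht.2
    _ = r * a r := by simp

lemma abs_radialFlux_le (w : IsRadialWeight m a a') {b : ℝ → ℝ} {r M : ℝ} (hr : 0 ≤ r)
    (h : ∀ᵐ t, t ∈ Ioc 0 r → |b t| ≤ M) :
    |radialFlux a b r| ≤ M * radialFlux a (fun _ => 1) r := by
  rw [← radialFlux_const, radialFlux, radialFlux, abs_div, abs_of_nonneg (w.nonneg r)]
  refine div_le_div_of_nonneg_right ?_ (w.nonneg r)
  rw [← Real.norm_eq_abs]
  refine intervalIntegral.norm_integral_le_of_norm_le hr (h.mono fun t h ht => ?_)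
    ((w.continuous.mul continuous_const).intervalIntegrable _ _)
  rw [norm_mul, Real.norm_eq_abs, Real.norm_eq_abs, abs_of_nonneg (w.nonneg t)]
  exact mul_le_mul_of_nonneg_left (h ht) (w.nonneg t)

/-- Only the pole needs care, where `|radialFlux a b r| ≤ M Θ(r) ≤ M r`. Continuity of `b` is not
asked for, because the flux is also taken of pointwise limits of iterates and of the merely
measurable profile of a weak solution. -/
lemma continuous_radialFlux_of_bounded (w : IsRadialWeight m a a') {b : ℝ → ℝ}
    (hb : ∀ x y, IntervalIntegrable b volume x y) {M : ℝ} (hM0 : 0 ≤ M)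
    (hM : ∀ᵐ t, t ∈ Ioc (0 : ℝ) 1 → |b t| ≤ M) :
    Continuous (radialFlux a b) := by
  have hint : ∀ x y, IntervalIntegrable (fun t => a t * b t) volume x y := fun x y =>
    IntervalIntegrable.continuousOn_mul (hb x y) w.continuous.continuousOn
  have hI : Continuous fun r => ∫ t in (0 : ℝ)..r, a t * b t :=
    intervalIntegral.continuous_primitive hint 0
  rw [continuous_iff_continuousAt]
  intro r
  rcases lt_trichotomy r 0 with h | rfl | h
  · refine (continuousAt_const (y := (0 : ℝ))).congr ?_
    filter_upwards [Iio_mem_nhds h] with s hs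
    rw [w.radialFlux_of_nonpos _ (le_of_lt hs)]
  · rw [ContinuousAt, w.radialFlux_of_nonpos _ le_rfl]
    refine squeeze_zero_norm' (a := fun s => M * |s|) ?_ ?_
    · filter_upwards [Iio_mem_nhds (zero_lt_one' ℝ)] with s hs
      rcases le_or_gt s 0 with h | h
      · rw [w.radialFlux_of_nonpos _ h]; simpa using by positivity
      · rw [abs_of_pos h, Real.norm_eq_abs]
        refine (w.abs_radialFlux_le h.le (hM.mono fun t hM ht =>
          hM ⟨ht.1, ht.2.trans (le_of_lt hs)⟩)).trans ?_
        exact mul_le_mul_of_nonneg_left (w.radialFlux_one_le h.le) hM0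
    · have : Continuous fun s : ℝ => M * |s| := by fun_prop
      simpa using this.tendsto 0
  · exact hI.continuousAt.div w.continuous.continuousAt (w.pos r h).ne'

lemma continuous_radialFlux (w : IsRadialWeight m a a') {b : ℝ → ℝ} (hb : Continuous b) :
    Continuous (radialFlux a b) := by
  obtain ⟨M, hM⟩ := (isCompact_Icc (a := (0 : ℝ)) (b := 1)).exists_bound_of_continuousOn
    hb.continuousOn
  exact w.continuous_radialFlux_of_bounded (fun x y => hb.intervalIntegrable x y)
    ((norm_nonneg _).trans (hM 0 ⟨le_rfl, zero_le_one⟩))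
    (ae_of_all _ fun t ht => hM t ⟨ht.1.le, ht.2⟩)

lemma continuous_radialFlux_one_rpow (w : IsRadialWeight m a a') {γ : ℝ} (hγ : 0 ≤ γ) :
    Continuous fun r => radialFlux a (fun _ => 1) r ^ γ :=
  (Real.continuous_rpow_const hγ).comp (w.continuous_radialFlux continuous_const)

end IsRadialWeight

/-- `f` solves `(a |f'|^{p-2} f')' + a f ^ q = 0`, `f (0) = α` on `[0, R]` and is positive there. -/
structure IsPositiveProfile (a : ℝ → ℝ) (p q α R : ℝ) (f : ℝ → ℝ) : Prop where
  continuous : Continuous f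
  pos : ∀ r ∈ Icc 0 R, 0 < f r
  eq : ∀ r ∈ Icc 0 R, f r = α - ∫ s in (0 : ℝ)..r, radialFlux a (fun t => f t ^ q) s ^ (1 / (p - 1))

/-! ### Pohozaev inequality for profiles. -/

namespace IsPositiveProfile

variable {m : ℝ} {a a' : ℝ → ℝ} {p q α R : ℝ} {f : ℝ → ℝ}

lemma continuous_rpow (h : IsPositiveProfile a p q α R f) (hq : 0 < q) :
    Continuous fun t => f t ^ q :=
  (Real.continuous_rpow_const hq.le).comp h.continuous

lemma continuous_flux (h : IsPositiveProfile a p q α R f) (w : IsRadialWeight m a a')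
    (hq : 0 < q) : Continuous (radialFlux a fun t => f t ^ q) :=
  w.continuous_radialFlux (h.continuous_rpow hq)

lemma flux_pos (h : IsPositiveProfile a p q α R f) (w : IsRadialWeight m a a')
    (hq : 0 < q) {r : ℝ} (hr : r ∈ Ioc 0 R) : 0 < radialFlux a (fun t => f t ^ q) r :=
  w.radialFlux_pos (h.continuous_rpow hq) hr.1
    fun t ht => Real.rpow_pos_of_pos (h.pos t ⟨ht.1.le, ht.2.trans hr.2⟩) _

lemma hasDerivAt (h : IsPositiveProfile a p q α R f) (w : IsRadialWeight m a a') (hp : 1 < p)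
    (hq : 0 < q) {r : ℝ} (hr : r ∈ Ioo 0 R) :
    HasDerivAt f (-radialFlux a (fun t => f t ^ q) r ^ (1 / (p - 1))) r := by
  have hγ : 0 ≤ 1 / (p - 1) := by have := sub_pos.2 hp; positivity
  have hc : Continuous fun s => radialFlux a (fun t => f t ^ q) s ^ (1 / (p - 1)) :=
    (Real.continuous_rpow_const hγ).comp (h.continuous_flux w hq)
  have h1 := ((hc.integral_hasStrictDerivAt 0 r).hasDerivAt).const_sub α
  refine h1.congr_of_eventuallyEq ?_
  filter_upwards [Ioo_mem_nhds hr.1 hr.2] with s hs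
  exact h.eq s ⟨hs.1.le, hs.2.le⟩

/-- The Pohozaev inequality `V |f'| ≤ p / ((p - 1) (q + 1)) a f`. -/
lemma pohozaev (h : IsPositiveProfile a p q α R f) (w : IsRadialWeight m a a') (hp : 1 < p)
    (hq : 0 < q) (hpq : (p - 1) / p + 1 / (q + 1) ≤ 1 - 1 / m) {r : ℝ} (hr : r ∈ Ioc 0 R) :
    (∫ t in (0 : ℝ)..r, a t) * radialFlux a (fun t => f t ^ q) r ^ (1 / (p - 1)) ≤
      p / ((p - 1) * (q + 1)) * (a r * f r) := by
  have hp1 : 0 < p - 1 := sub_pos.2 hp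
  have hp0 : 0 < p := by linarith
  have hq1 : 0 < q + 1 := by linarith
  set γ := 1 / (p - 1) with hγ
  have hγ0 : 0 < γ := by positivity
  set y := radialFlux a fun t => f t ^ q with hy
  set F : ℝ → ℝ := fun r => ∫ t in (0 : ℝ)..r, a t * f t ^ q with hF
  set V : ℝ → ℝ := fun r => ∫ t in (0 : ℝ)..r, a t with hV
  have hyc : Continuous y := h.continuous_flux w hq
  have hFd : ∀ s, HasDerivAt F (a s * f s ^ q) s := fun s =>
    ((w.continuous.mul (h.continuous_rpow hq)).integral_hasStrictDerivAt 0 s).hasDerivAt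
  have hVd : ∀ s, HasDerivAt V (a s) s := fun s =>
    (w.continuous.integral_hasStrictDerivAt 0 s).hasDerivAt
  have hFc : Continuous F := continuous_iff_continuousAt.2 fun s => (hFd s).continuousAt
  have hVc : Continuous V := continuous_iff_continuousAt.2 fun s => (hVd s).continuousAt
  -- Here `y^(γ+1) = |f'|^p`, so this is `V` times the energy density, minus `F f / (q+1)`. The last
  -- term is chosen so that in the derivative all terms in `f^(q+1)` and `V f^q f'` cancel, leaving
  -- a multiple of `|f'|^p`.
  set P : ℝ → ℝ := fun r => V r * ((p - 1) / p * y r ^ (γ + 1) + f r ^ (q + 1) / (q + 1)) -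
    F r * f r / (q + 1) with hP
  have hPc : Continuous P := by
    have h1 : Continuous fun r => y r ^ (γ + 1) :=
      (Real.continuous_rpow_const (by positivity)).comp hyc
    have h2 : Continuous fun r => f r ^ (q + 1) :=
      (Real.continuous_rpow_const (by positivity)).comp h.continuous
    exact (hVc.mul ((continuous_const.mul h1).add (h2.div_const _))).sub
      ((hFc.mul h.continuous).div_const _)
  have hPd : ∀ s ∈ Ioo 0 R, HasDerivAt P
      (y s ^ (γ + 1) * (a s * ((p - 1) / p + 1 / (q + 1)) - V s * a' s / a s)) s := by
    intro s hs
    have has := w.pos s hs.1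
    have hfs : 0 < f s := h.pos s ⟨hs.1.le, hs.2.le⟩
    have hys : 0 < y s := h.flux_pos w hq ⟨hs.1, hs.2.le⟩
    have hfd := h.hasDerivAt w hp hq hs
    have hyd : HasDerivAt y ((a s * f s ^ q * a s - F s * a' s) / a s ^ 2) s :=
      (hFd s).div (w.hasDerivAt s hs.1) has.ne'
    have hFy : F s = a s * y s := (w.mul_radialFlux _ hs.1).symm
    have hyp : y s ^ (γ + 1) = y s ^ γ * y s := by rw [Real.rpow_add hys, Real.rpow_one]
    have hfp : f s ^ (q + 1) = f s ^ q * f s := by rw [Real.rpow_add hfs, Real.rpow_one]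
    have h1 := ((hyd.rpow_const (p := γ + 1) (Or.inl hys.ne')).const_mul ((p - 1) / p))
    have h2 := (hfd.rpow_const (p := q + 1) (Or.inl hfs.ne')).div_const (q + 1)
    have h3 := ((hVd s).mul (h1.add h2)).sub (((hFd s).mul hfd).div_const (q + 1))
    refine h3.congr_deriv ?_
    simp only [Pi.add_apply, add_sub_cancel_right]
    rw [hyp, hfp, hFy]
    have hγp : γ + 1 = p / (p - 1) := by rw [hγ]; field_simp; ring
    rw [hγp]
    field_simp
    ring
  have hanti : AntitoneOn P (Icc 0 R) := by
    refine antitoneOn_of_deriv_nonpos (convex_Icc _ _) hPc.continuousOn ?_ ?_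
    · rw [interior_Icc]
      exact fun s hs => (hPd s hs).differentiableAt.differentiableWithinAt
    · rw [interior_Icc]
      intro s hs
      rw [(hPd s hs).deriv]
      have has := w.pos s hs.1
      have hys : 0 < y s := h.flux_pos w hq ⟨hs.1, hs.2.le⟩
      refine mul_nonpos_of_nonneg_of_nonpos (by positivity) ?_
      -- The sign is the meeting point of the two hypotheses: `(p-1)/p + 1/(q+1) ≤ 1 - 1/m` and `(1
      -- - 1/m) a² ≤ V a'`.
      rw [sub_nonpos, le_div_iff₀ has]
      have := w.growth s hs.1
      nlinarith [mul_le_mul_of_nonneg_left hpq (sq_nonneg (a s))]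
  have hP0 : P 0 = 0 := by simp [hP, hV, hF]
  have hPr : P r ≤ 0 := hP0 ▸ hanti ⟨le_rfl, hr.1.le.trans hr.2⟩ ⟨hr.1.le, hr.2⟩ hr.1.le
  have hyr : 0 < y r := h.flux_pos w hq hr
  have hfr : 0 < f r := h.pos r ⟨hr.1.le, hr.2⟩
  have hVr : 0 ≤ V r := intervalIntegral.integral_nonneg hr.1.le fun t _ => w.nonneg t
  have hFy : F r = a r * y r := (w.mul_radialFlux _ hr.1).symm
  have hyp : y r ^ (γ + 1) = y r ^ γ * y r := by rw [Real.rpow_add hyr, Real.rpow_one]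
  -- From `P r ≤ 0`, discarding the nonnegative term `V f^(q+1) / (q+1)`. A factor `y` is cancelled
  -- next.
  have h4 : V r * ((p - 1) / p * (y r ^ γ * y r)) ≤ a r * y r * f r / (q + 1) := by
    have h5 : 0 ≤ V r * (f r ^ (q + 1) / (q + 1)) := by positivity
    simp only [hP, hFy, hyp] at hPr
    linarith
  have h6 : (V r * y r ^ γ) * ((p - 1) / p) ≤ a r * f r / (q + 1) := by
    refine le_of_mul_le_mul_right ?_ hyr
    calc _ = V r * ((p - 1) / p * (y r ^ γ * y r)) := by ring
      _ ≤ _ := h4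
      _ = _ := by ring
  rw [← le_div_iff₀ (by positivity)] at h6
  refine h6.trans_eq ?_
  field_simp

lemma antitoneOn (h : IsPositiveProfile a p q α R f) (w : IsRadialWeight m a a') (hp : 1 < p)
    (hq : 0 < q) : AntitoneOn f (Icc 0 R) := by
  refine antitoneOn_of_deriv_nonpos (convex_Icc _ _) h.continuous.continuousOn ?_ ?_
  · rw [interior_Icc]
    exact fun s hs => (h.hasDerivAt w hp hq hs).differentiableAt.differentiableWithinAt
  · rw [interior_Icc]
    intro s hs
    rw [(h.hasDerivAt w hp hq hs).deriv]
    exact neg_nonpos.2 (Real.rpow_nonneg (h.flux_pos w hq ⟨hs.1, hs.2.le⟩).le _)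

lemma eq_initial (h : IsPositiveProfile a p q α R f) (hR : 0 ≤ R) : f 0 = α := by
  simpa using h.eq 0 ⟨le_rfl, hR⟩

lemma le_initial (h : IsPositiveProfile a p q α R f) (w : IsRadialWeight m a a') (hp : 1 < p)
    (hq : 0 < q) {r : ℝ} (hr : r ∈ Icc 0 R) : f r ≤ α := by
  have hR := hr.1.trans hr.2
  rw [← h.eq_initial hR]
  exact h.antitoneOn w hp hq ⟨le_rfl, hR⟩ hr hr.1

end IsPositiveProfile

/-! ### Exponential lower bound for profiles. -/

/-- The constant in the logarithmic derivative bound `|f'| ≤ c Θ^{1/(p-1)} f`. -/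
noncomputable def decayConst (p q α : ℝ) : ℝ :=
  (α ^ (q - p + 1) / (1 - p / (q + 1))) ^ (1 / (p - 1))

namespace IsPositiveProfile

variable {m : ℝ} {a a' : ℝ → ℝ} {p q α R : ℝ} {f : ℝ → ℝ}

/-- The difference `D = C V f^(p-1) - F` starts at zero and is nondecreasing: the Pohozaev
inequality absorbs the negative term `(p-1) V f^(p-2) |f'|` into the fraction `p/(q+1) < 1` of `a
f^(p-1)`, and what remains dominates `a f^q` since `f^(q-p+1) ≤ α^(q-p+1) = C (1 - p/(q+1))`. -/
lemma flux_le (h : IsPositiveProfile a p q α R f) (w : IsRadialWeight m a a') (hp : 1 < p)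
    (hq : p < q + 1) (hpq : (p - 1) / p + 1 / (q + 1) ≤ 1 - 1 / m) {r : ℝ} (hr : r ∈ Ioc 0 R) :
    radialFlux a (fun t => f t ^ q) r ≤
      α ^ (q - p + 1) / (1 - p / (q + 1)) * (radialFlux a (fun _ => 1) r * f r ^ (p - 1)) := by
  have hp1 : 0 < p - 1 := sub_pos.2 hp
  have hq0 : 0 < q := by linarith
  have hq1 : 0 < q + 1 := by linarith
  have hc : 0 < 1 - p / (q + 1) := by rw [sub_pos, div_lt_one hq1]; exact hq
  set C := α ^ (q - p + 1) / (1 - p / (q + 1)) with hC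
  set F : ℝ → ℝ := fun r => ∫ t in (0 : ℝ)..r, a t * f t ^ q with hF
  set V : ℝ → ℝ := fun r => ∫ t in (0 : ℝ)..r, a t with hV
  have hFd : ∀ s, HasDerivAt F (a s * f s ^ q) s := fun s =>
    ((w.continuous.mul (h.continuous_rpow hq0)).integral_hasStrictDerivAt 0 s).hasDerivAt
  have hVd : ∀ s, HasDerivAt V (a s) s := fun s =>
    (w.continuous.integral_hasStrictDerivAt 0 s).hasDerivAt
  have hFc : Continuous F := continuous_iff_continuousAt.2 fun s => (hFd s).continuousAt
  have hVc : Continuous V := continuous_iff_continuousAt.2 fun s => (hVd s).continuousAt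
  set D : ℝ → ℝ := fun r => C * (V r * f r ^ (p - 1)) - F r with hD
  have hDc : Continuous D := (continuous_const.mul (hVc.mul
    ((Real.continuous_rpow_const hp1.le).comp h.continuous))).sub hFc
  have hDd : ∀ s ∈ Ioo 0 R, ∃ d, HasDerivAt D d s ∧ 0 ≤ d := by
    intro s hs
    have hfs : 0 < f s := h.pos s ⟨hs.1.le, hs.2.le⟩
    have hfd := h.hasDerivAt w hp hq0 hs
    refine ⟨_, (((hVd s).mul (hfd.rpow_const (p := p - 1) (Or.inl hfs.ne'))).const_mul C).sub
      (hFd s), ?_⟩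
    have hpo := h.pohozaev w hp hq0 hpq ⟨hs.1, hs.2.le⟩
    have hα : 0 < α := hfs.trans_le (h.le_initial w hp hq0 ⟨hs.1.le, hs.2.le⟩)
    have e1 : f s ^ (p - 1) = f s ^ (p - 1 - 1) * f s := by
      rw [← Real.rpow_add_one hfs.ne']; ring_nf
    have e2 : f s ^ q = f s ^ (q - p + 1) * f s ^ (p - 1) := by
      rw [← Real.rpow_add hfs]; ring_nf
    have h1 : f s ^ (q - p + 1) ≤ α ^ (q - p + 1) :=
      Real.rpow_le_rpow hfs.le (h.le_initial w hp hq0 ⟨hs.1.le, hs.2.le⟩) (by linarith)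
    have h2 : V s * radialFlux a (fun t => f t ^ q) s ^ (1 / (p - 1)) * ((p - 1) *
        f s ^ (p - 1 - 1)) ≤ p / (q + 1) * (a s * f s ^ (p - 1)) := by
      refine (mul_le_mul_of_nonneg_right hpo (by positivity)).trans_eq ?_
      rw [e1]; field_simp
    have h3 : a s * f s ^ q ≤ C * ((1 - p / (q + 1)) * (a s * f s ^ (p - 1))) := by
      have : C * (1 - p / (q + 1)) = α ^ (q - p + 1) := by rw [hC, div_mul_cancel₀ _ hc.ne']
      rw [← mul_assoc, this, e2]
      have : 0 ≤ a s * f s ^ (p - 1) := mul_nonneg (w.nonneg s) (by positivity)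
      nlinarith
    have hC0 : 0 ≤ C := by positivity
    have h4 := mul_le_mul_of_nonneg_left h2 hC0
    rw [sub_nonneg]
    refine h3.trans ?_
    linarith
  have hmono : MonotoneOn D (Icc 0 R) := by
    refine monotoneOn_of_deriv_nonneg (convex_Icc _ _) hDc.continuousOn ?_ ?_
    · rw [interior_Icc]
      intro s hs
      obtain ⟨d, hd, -⟩ := hDd s hs
      exact hd.differentiableAt.differentiableWithinAt
    · rw [interior_Icc]
      intro s hs
      obtain ⟨d, hd, hd0⟩ := hDd s hs
      rwa [hd.deriv]
  have hD0 : D 0 = 0 := by simp [hD, hV, hF]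
  have hDr : 0 ≤ D r := hD0 ▸ hmono ⟨le_rfl, hr.1.le.trans hr.2⟩ ⟨hr.1.le, hr.2⟩ hr.1.le
  simp only [hD, sub_nonneg] at hDr
  have har := w.pos r hr.1
  rw [radialFlux, radialFlux, div_le_iff₀ har]
  refine hDr.trans_eq ?_
  simp only [mul_one]
  simp only [hV]
  field_simp

/-- Lower bound for positive solutions in terms of the volume-surface ratio. -/
lemma initial_mul_exp_le (h : IsPositiveProfile a p q α R f) (w : IsRadialWeight m a a')
    (hp : 1 < p) (hq : p < q + 1) (hpq : (p - 1) / p + 1 / (q + 1) ≤ 1 - 1 / m) {r : ℝ}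
    (hr : r ∈ Icc 0 R) :
    α * Real.exp (-(decayConst p q α *
      ∫ s in (0 : ℝ)..r, radialFlux a (fun _ => 1) s ^ (1 / (p - 1)))) ≤ f r := by
  have hp1 : 0 < p - 1 := sub_pos.2 hp
  have hγ0 : 0 < 1 / (p - 1) := by positivity
  have hq0 : 0 < q := by linarith
  have hq1 : 0 < q + 1 := by linarith
  have hc : 0 < 1 - p / (q + 1) := by rw [sub_pos, div_lt_one hq1]; exact hq
  have hR := hr.1.trans hr.2
  have hα : 0 < α := h.eq_initial hR ▸ h.pos 0 ⟨le_rfl, hR⟩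
  set G : ℝ → ℝ := fun r => ∫ s in (0 : ℝ)..r, radialFlux a (fun _ => 1) s ^ (1 / (p - 1)) with hG
  have hGd : ∀ s, HasDerivAt G (radialFlux a (fun _ => 1) s ^ (1 / (p - 1))) s := fun s =>
    ((w.continuous_radialFlux_one_rpow hγ0.le).integral_hasStrictDerivAt 0 s).hasDerivAt
  have hGc : Continuous G := continuous_iff_continuousAt.2 fun s => (hGd s).continuousAt
  -- Grönwall's argument: `|f'| ≤ κ θ f` with `θ = Θ^(1/(p-1)) = G'` makes `f exp(κ G)`
  -- nondecreasing.
  have hd : ∀ s ∈ Ioo 0 R, ∃ d, HasDerivAt (fun r => f r * Real.exp (decayConst p q α * G r)) d s ∧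
      0 ≤ d := by
    intro s hs
    refine ⟨_, (h.hasDerivAt w hp hq0 hs).mul ((hGd s).const_mul (decayConst p q α)).exp, ?_⟩
    have hfs : 0 < f s := h.pos s ⟨hs.1.le, hs.2.le⟩
    have hΘ := w.radialFlux_one_nonneg s
    have h1 : radialFlux a (fun t => f t ^ q) s ^ (1 / (p - 1)) ≤
        decayConst p q α * (radialFlux a (fun _ => 1) s ^ (1 / (p - 1)) * f s) := by
      refine (Real.rpow_le_rpow (h.flux_pos w hq0 ⟨hs.1, hs.2.le⟩).le
        (h.flux_le w hp hq hpq ⟨hs.1, hs.2.le⟩) hγ0.le).trans_eq ?_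
      rw [Real.mul_rpow (by positivity) (by positivity), Real.mul_rpow hΘ (by positivity),
        ← Real.rpow_mul hfs.le, mul_one_div_cancel hp1.ne', Real.rpow_one]
      rfl
    have h2 := Real.exp_pos (decayConst p q α * G s)
    nlinarith
  have hmono : MonotoneOn (fun r => f r * Real.exp (decayConst p q α * G r)) (Icc 0 R) := by
    refine monotoneOn_of_deriv_nonneg (convex_Icc _ _) 
      (h.continuous.mul (Real.continuous_exp.comp (continuous_const.mul hGc))).continuousOn ?_ ?_
    · rw [interior_Icc]
      intro s hs
      obtain ⟨d, hd, -⟩ := hd s hs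
      exact hd.differentiableAt.differentiableWithinAt
    · rw [interior_Icc]
      intro s hs
      obtain ⟨d, hd, hd0⟩ := hd s hs
      rwa [hd.deriv]
  have h0 := hmono ⟨le_rfl, hR⟩ hr hr.1
  have hG0 : G 0 = 0 := by simp [hG]
  simp only [hG0, mul_zero, Real.exp_zero, mul_one, h.eq_initial hR] at h0
  rw [Real.exp_neg, ← div_eq_mul_inv, div_le_iff₀ (Real.exp_pos _)]
  exact h0

end IsPositiveProfile

/-! ### Global profiles by Picard iteration with a cut-off nonlinearity. -/

/-- The interval must stay away from zero, since `x ^ s` is not Lipschitz at zero for `0 < s < 1`;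
both `q` and `1/(p-1)` may be such exponents. -/
lemma exists_abs_rpow_sub_rpow_le (s : ℝ) {x₀ x₁ : ℝ} (h0 : 0 < x₀) :
    ∃ K, 0 ≤ K ∧ ∀ x ∈ Icc x₀ x₁, ∀ y ∈ Icc x₀ x₁, |x ^ s - y ^ s| ≤ K * |x - y| := by
  have hc : ContinuousOn (fun x : ℝ => s * x ^ (s - 1)) (Icc x₀ x₁) := fun x hx =>
    (continuousAt_const.mul (Real.continuousAt_rpow_const _ _
      (Or.inl (h0.trans_le hx.1).ne'))).continuousWithinAt
  obtain ⟨K, hK⟩ := isCompact_Icc.exists_bound_of_continuousOn hc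
  refine ⟨max K 0, le_max_right _ _, fun x hx y hy => ?_⟩
  refine (convex_Icc x₀ x₁).norm_image_sub_le_of_norm_hasDerivWithin_le
    (f := fun x : ℝ => x ^ s) (f' := fun x => s * x ^ (s - 1)) (fun z hz => ?_)
    (fun z hz => (hK z hz).trans (le_max_left _ _)) hy hx
  exact (Real.hasDerivAt_rpow_const (Or.inl (h0.trans_le hz.1).ne')).hasDerivWithinAt

/-- The integral operator of the radial equation with the nonlinearity cut off outside of
`[ε, α]`. -/
noncomputable def cutoffStep (a ε : ℝ → ℝ) (p q α : ℝ) (f : ℝ → ℝ) (r : ℝ) : ℝ :=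
  α - ∫ s in (0 : ℝ)..r,
    radialFlux a (fun t => max (ε t) (min (f t) α) ^ q) s ^ (1 / (p - 1))

section Picard

variable {m : ℝ} {a a' ε : ℝ → ℝ} {p q α : ℝ}

lemma cutoff_mem (hεα : ∀ t, ε t ≤ α) (hε : ∀ t, 0 < ε t) (hq : 0 ≤ q) (t x : ℝ) :
    max (ε t) (min x α) ^ q ∈ Icc (ε t ^ q) (α ^ q) := by
  refine ⟨Real.rpow_le_rpow (hε t).le (le_max_left _ _) hq, Real.rpow_le_rpow ?_ ?_ hq⟩
  · exact (hε t).le.trans (le_max_left _ _)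
  · exact max_le (hεα t) (min_le_right _ _)

lemma continuous_cutoff_rpow (hεc : Continuous ε) (hq : 0 ≤ q) {f : ℝ → ℝ} (hf : Continuous f) :
    Continuous fun t => max (ε t) (min (f t) α) ^ q :=
  (Real.continuous_rpow_const hq).comp (hεc.max (hf.min continuous_const))

lemma IsRadialWeight.continuous_cutoffStep (w : IsRadialWeight m a a') (hεc : Continuous ε)
    (hεα : ∀ t, ε t ≤ α) (hε : ∀ t, 0 < ε t) (hp : 1 < p) (hq : 0 < q) {f : ℝ → ℝ}
    (hf : Measurable f) : Continuous (cutoffStep a ε p q α f) := by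
  have hγ : 0 ≤ 1 / (p - 1) := by have := sub_pos.2 hp; positivity
  have hb : ∀ t, |max (ε t) (min (f t) α) ^ q| ≤ α ^ q := fun t => by
    have := cutoff_mem hεα hε hq.le t (f t)
    rw [abs_of_nonneg ((Real.rpow_nonneg (hε t).le _).trans this.1)]
    exact this.2
  have hfl : Continuous (radialFlux a fun t => max (ε t) (min (f t) α) ^ q) := by
    refine w.continuous_radialFlux_of_bounded (fun x y => ?_)
      ((abs_nonneg _).trans (hb 0)) (ae_of_all _ fun t _ => hb t)
    rw [intervalIntegrable_iff]
    refine Measure.integrableOn_of_bounded (M := α ^ q) measure_Ioc_lt_top.ne ?_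
      (ae_of_all _ hb)
    exact ((hεc.measurable.max (hf.min measurable_const)).pow_const q).aestronglyMeasurable
  exact continuous_const.sub (intervalIntegral.continuous_primitive
    (fun x y => ((Real.continuous_rpow_const hγ).comp hfl).intervalIntegrable x y) 0)

/-- The flux tends to zero at the pole, where `x^(1/(p-1))` need not be Lipschitz. The remedy is to
factor out `Θ`: the cut-off keeps `flux / Θ` in `[ε(R)^q, α^q]`, where powers are Lipschitz, and the
factor `Θ^(1/(p-1))` stays in front. Monotonicity of `D` lets `D t` be replaced by `D s` inside the
mean over `t ≤ s`. -/
lemma IsRadialWeight.exists_cutoffStep_lipschitz (w : IsRadialWeight m a a')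
    (hεc : Continuous ε) (hεα : ∀ t, ε t ≤ α) (hε : ∀ t, 0 < ε t) (hεa : Antitone ε)
    (hp : 1 < p) (hq : 0 < q) (R : ℝ) :
    ∃ L, 0 ≤ L ∧ ∀ f g D : ℝ → ℝ, Continuous f → Continuous g → Continuous D →
      MonotoneOn D (Icc 0 R) → (∀ t ∈ Icc 0 R, |f t - g t| ≤ D t) → ∀ r ∈ Icc 0 R,
      |cutoffStep a ε p q α f r - cutoffStep a ε p q α g r| ≤
        ∫ s in (0 : ℝ)..r, L * (radialFlux a (fun _ => 1) s ^ (1 / (p - 1)) * D s) := by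
  have hγ : 0 ≤ 1 / (p - 1) := by have := sub_pos.2 hp; positivity
  have hεR := hε R
  obtain ⟨K₁, hK₁, hK₁'⟩ := exists_abs_rpow_sub_rpow_le (1 / (p - 1)) (x₁ := α ^ q)
    (Real.rpow_pos_of_pos hεR q)
  obtain ⟨K₂, hK₂, hK₂'⟩ := exists_abs_rpow_sub_rpow_le q (x₁ := α) hεR
  refine ⟨K₁ * K₂, by positivity, fun f g D hf hg hDc hDm hfg r hr => ?_⟩
  set b := fun t => max (ε t) (min (f t) α) ^ q with hb
  set c := fun t => max (ε t) (min (g t) α) ^ q with hc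
  have hbc : Continuous b := continuous_cutoff_rpow hεc hq.le hf
  have hcc : Continuous c := continuous_cutoff_rpow hεc hq.le hg
  have hint : ∀ b : ℝ → ℝ, Continuous b → ∀ x y,
      IntervalIntegrable (fun s => radialFlux a b s ^ (1 / (p - 1))) volume x y := fun b hb x y =>
    ((Real.continuous_rpow_const hγ).comp (w.continuous_radialFlux hb)).intervalIntegrable x y
  have hai : ∀ b : ℝ → ℝ, Continuous b → ∀ x y,
      IntervalIntegrable (fun s => a s * b s) volume x y := fun b hb x y =>
    (w.continuous.mul hb).intervalIntegrable x y
  have hmem : ∀ t ∈ Icc 0 R, ∀ x, max (ε t) (min x α) ∈ Icc (ε R) α := fun t ht x =>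
    ⟨(hεa ht.2).trans (le_max_left _ _), max_le (hεα t) (min_le_right _ _)⟩
  have key : ∀ s ∈ Icc 0 R, |radialFlux a c s ^ (1 / (p - 1)) - radialFlux a b s ^ (1 / (p - 1))| ≤
      K₁ * K₂ * (radialFlux a (fun _ => 1) s ^ (1 / (p - 1)) * D s) := by
    intro s hs
    have hDs : 0 ≤ D s := (abs_nonneg _).trans (hfg s hs)
    have hΘ0 := w.radialFlux_one_nonneg s
    rcases hs.1.eq_or_lt with rfl | hs0
    · rw [w.radialFlux_of_nonpos _ le_rfl, w.radialFlux_of_nonpos _ le_rfl, sub_self, abs_zero]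
      positivity
    have hΘ : 0 < radialFlux a (fun _ => 1) s :=
      w.radialFlux_pos continuous_const hs0 fun _ _ => one_pos
    set Θ := radialFlux a (fun _ => 1) s with hΘdef
    have hbd : ∀ h : ℝ → ℝ, Continuous h →
        radialFlux a (fun t => max (ε t) (min (h t) α) ^ q) s / Θ ∈ Icc (ε R ^ q) (α ^ q) := by
      intro h hh
      have hh' := continuous_cutoff_rpow (α := α) hεc hq.le hh
      constructor
      · rw [le_div_iff₀ hΘ, hΘdef, ← radialFlux_const]
        refine w.radialFlux_mono_of_le (hai _ continuous_const _ _) (hai _ hh' _ _) hs.1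
          fun t ht => ?_
        exact Real.rpow_le_rpow hεR.le (hmem t ⟨ht.1, ht.2.trans hs.2⟩ _).1 hq.le
      · rw [div_le_iff₀ hΘ, hΘdef, ← radialFlux_const]
        refine w.radialFlux_mono_of_le (hai _ hh' _ _) (hai _ continuous_const _ _) hs.1
          fun t ht => ?_
        have := hmem t ⟨ht.1, ht.2.trans hs.2⟩ (h t)
        exact Real.rpow_le_rpow (hεR.le.trans this.1) this.2 hq.le
    have h1 := hK₁' _ (hbd g hg) _ (hbd f hf)
    have hdiff : radialFlux a c s - radialFlux a b s = radialFlux a (fun t => c t - b t) s := by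
      simp only [radialFlux, mul_sub]
      rw [intervalIntegral.integral_sub (hai _ hcc _ _) (hai _ hbc _ _), sub_div]
    have h2 : |radialFlux a c s - radialFlux a b s| ≤ K₂ * D s * Θ := by
      rw [hdiff]
      refine w.abs_radialFlux_le hs.1 (ae_of_all _ fun t ht => ?_)
      have ht' : t ∈ Icc 0 R := ⟨ht.1.le, ht.2.trans hs.2⟩
      refine (hK₂' _ (hmem t ht' _) _ (hmem t ht' _)).trans ?_
      refine mul_le_mul_of_nonneg_left ?_ hK₂
      calc |max (ε t) (min (g t) α) - max (ε t) (min (f t) α)|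
          ≤ |min (g t) α - min (f t) α| := by
            have := abs_max_sub_max_le_abs (min (g t) α) (min (f t) α) (ε t)
            rwa [max_comm, max_comm (min (f t) α)] at this
        _ ≤ |g t - f t| := by
            have := abs_min_sub_min_le_max (g t) α (f t) α
            simpa using this
        _ ≤ D t := by rw [abs_sub_comm]; exact hfg t ht'
        _ ≤ D s := hDm ht' hs ht.2
    have hcn : 0 ≤ radialFlux a c s / Θ := (Real.rpow_nonneg hεR.le q).trans (hbd g hg).1
    have hbn : 0 ≤ radialFlux a b s / Θ := (Real.rpow_nonneg hεR.le q).trans (hbd f hf).1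
    have e : ∀ x, 0 ≤ x / Θ → x ^ (1 / (p - 1)) = Θ ^ (1 / (p - 1)) * (x / Θ) ^ (1 / (p - 1)) := by
      intro x hx
      rw [← Real.mul_rpow hΘ0 hx, mul_div_cancel₀ _ hΘ.ne']
    rw [e _ hcn, e _ hbn, ← mul_sub, abs_mul, abs_of_nonneg (Real.rpow_nonneg hΘ0 _)]
    rw [← sub_div, abs_div, abs_of_pos hΘ] at h1
    have h3 : |radialFlux a c s - radialFlux a b s| / Θ ≤ K₂ * D s := by
      rwa [div_le_iff₀ hΘ]
    calc _ ≤ Θ ^ (1 / (p - 1)) * (K₁ * (K₂ * D s)) :=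
          mul_le_mul_of_nonneg_left (h1.trans (mul_le_mul_of_nonneg_left h3 hK₁))
            (Real.rpow_nonneg hΘ0 _)
      _ = _ := by ring
  have e1 : cutoffStep a ε p q α f r - cutoffStep a ε p q α g r =
      ∫ s in (0 : ℝ)..r, (radialFlux a c s ^ (1 / (p - 1)) - radialFlux a b s ^ (1 / (p - 1))) := by
    rw [intervalIntegral.integral_sub (hint c hcc _ _) (hint b hbc _ _)]
    simp only [cutoffStep, hb, hc]
    ring
  rw [e1, ← Real.norm_eq_abs]
  refine intervalIntegral.norm_integral_le_of_norm_le hr.1 (ae_of_all _ fun s hs => ?_) ?_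
  · exact key s ⟨hs.1.le, hs.2.trans hr.2⟩
  · exact (continuous_const.mul
      ((w.continuous_radialFlux_one_rpow hγ).mul hDc)).intervalIntegrable _ _

/-- The Picard iterates. -/
noncomputable def cutoffIter (a ε : ℝ → ℝ) (p q α : ℝ) (k : ℕ) : ℝ → ℝ :=
  (cutoffStep a ε p q α)^[k] fun _ => α

lemma cutoffIter_succ (k : ℕ) :
    cutoffIter a ε p q α (k + 1) = cutoffStep a ε p q α (cutoffIter a ε p q α k) :=
  Function.iterate_succ_apply' _ _ _

lemma IsRadialWeight.continuous_cutoffIter (w : IsRadialWeight m a a') (hεc : Continuous ε)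
    (hεα : ∀ t, ε t ≤ α) (hε : ∀ t, 0 < ε t) (hp : 1 < p) (hq : 0 < q) (k : ℕ) :
    Continuous (cutoffIter a ε p q α k) := by
  induction k with
  | zero => exact continuous_const
  | succ k ih =>
    rw [cutoffIter_succ]
    exact w.continuous_cutoffStep hεc hεα hε hp hq ih.measurable

lemma IsRadialWeight.cutoffStep_of_nonpos (w : IsRadialWeight m a a') (hp : 1 < p) (f : ℝ → ℝ)
    {r : ℝ} (hr : r ≤ 0) : cutoffStep a ε p q α f r = α := by
  have hγ : 1 / (p - 1) ≠ 0 := by have := sub_pos.2 hp; positivity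
  rw [cutoffStep, sub_eq_self, intervalIntegral.integral_symm, neg_eq_zero]
  refine (intervalIntegral.integral_congr (g := fun _ => 0) fun s hs => ?_).trans (by simp)
  rw [uIcc_of_le hr] at hs
  simp only
  rw [w.radialFlux_of_nonpos _ hs.2, Real.zero_rpow hγ]

/-- Consecutive iterates differ on `[0, r]` by at most `B (L G)^k / k!`, where `G = ∫ Θ^(1/(p-1))`.
The series converges whatever `r` and `L` are, so no smallness of the interval is needed. -/
lemma IsRadialWeight.exists_tendsto_cutoffIter (w : IsRadialWeight m a a') (hεc : Continuous ε)
    (hεα : ∀ t, ε t ≤ α) (hε : ∀ t, 0 < ε t) (hεa : Antitone ε) (hp : 1 < p) (hq : 0 < q)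
    (r : ℝ) : ∃ y, Tendsto (fun k => cutoffIter a ε p q α k r) atTop (𝓝 y) := by
  have hγ : 0 ≤ 1 / (p - 1) := by have := sub_pos.2 hp; positivity
  rcases lt_or_ge r 0 with hr | hr
  · refine ⟨α, (tendsto_const_nhds (x := α)).congr fun k => ?_⟩
    cases k with
    | zero => rfl
    | succ k => rw [cutoffIter_succ, w.cutoffStep_of_nonpos hp _ hr.le]
  have hcont := w.continuous_cutoffIter hεc hεα hε hp hq
  obtain ⟨L, hL, hLip⟩ := w.exists_cutoffStep_lipschitz hεc hεα hε hεa hp hq r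
  obtain ⟨B, hB⟩ := (isCompact_Icc (a := (0 : ℝ)) (b := r)).exists_bound_of_continuousOn
    ((hcont 1).sub (hcont 0)).continuousOn
  have hB0 : 0 ≤ B := (norm_nonneg _).trans (hB 0 ⟨le_rfl, hr⟩)
  set θ : ℝ → ℝ := fun s => radialFlux a (fun _ => 1) s ^ (1 / (p - 1)) with hθ
  have hθc : Continuous θ := w.continuous_radialFlux_one_rpow hγ
  have hθ0 : ∀ s, 0 ≤ θ s := fun s => Real.rpow_nonneg (w.radialFlux_one_nonneg s) _
  set G : ℝ → ℝ := fun r => ∫ s in (0 : ℝ)..r, θ s with hG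
  have hGd : ∀ s, HasDerivAt G (θ s) s := fun s => (hθc.integral_hasStrictDerivAt 0 s).hasDerivAt
  have hGc : Continuous G := continuous_iff_continuousAt.2 fun s => (hGd s).continuousAt
  have hGm : Monotone G := monotone_of_hasDerivAt_nonneg hGd hθ0
  have hG00 : G 0 = 0 := by simp [hG]
  have hG0 : ∀ t, 0 ≤ t → 0 ≤ G t := fun t ht => hG00 ▸ hGm ht
  have bound : ∀ k : ℕ, ∀ t ∈ Icc 0 r, |cutoffIter a ε p q α (k + 1) t -
      cutoffIter a ε p q α k t| ≤ B * ((L * G t) ^ k / k.factorial) := by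
    intro k
    induction k with
    | zero => intro t ht; simpa using hB t ht
    | succ k ih =>
      intro t ht
      rw [cutoffIter_succ (k + 1), cutoffIter_succ k]
      rw [← cutoffIter_succ k]
      nth_rewrite 2 [cutoffIter_succ k]
      refine (hLip _ _ (fun t => B * ((L * G t) ^ k / k.factorial)) (hcont _) (hcont _)
        (by fun_prop) ?_ ih t ht).trans_eq ?_
      · intro x hx y hy hxy
        have := hGm hxy
        have := hG0 x hx.1
        simp only
        gcongr
      -- As `G' = θ`, the Lipschitz estimate integrates the `k`-th bound exactly to the `(k+1)`-st.
      · have hd : ∀ s ∈ uIcc 0 t, HasDerivAt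
            (fun t => B * ((L * G t) ^ (k + 1) / (k + 1).factorial))
            (L * (θ s * (B * ((L * G s) ^ k / k.factorial)))) s := by
          intro s _
          refine (((((hGd s).const_mul L).pow (k + 1)).div_const _).const_mul B).congr_deriv ?_
          rw [Nat.factorial_succ]
          push_cast
          have : ((k.factorial : ℝ)) ≠ 0 := by positivity
          have : ((k : ℝ) + 1) ≠ 0 := by positivity
          field_simp
        rw [intervalIntegral.integral_eq_sub_of_hasDerivAt hd]
        · simp [hG00]
        · exact Continuous.intervalIntegrable (by fun_prop) _ _
  have hsum : Summable fun k : ℕ => B * ((L * G r) ^ k / k.factorial) :=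
    (Real.summable_pow_div_factorial (L * G r)).mul_left B
  refine cauchySeq_tendsto_of_complete (cauchySeq_of_dist_le_of_summable _ (fun k => ?_) hsum)
  rw [dist_comm, Real.dist_eq]
  exact bound k r ⟨hr, le_rfl⟩

/-- Pointwise convergence is enough: the cut-off bounds all integrands, so dominated convergence
passes to the limit first in the flux and then in the outer integral. The limit, a priori only
measurable, is continuous because it is an image of `cutoffStep`. -/
lemma IsRadialWeight.exists_cutoffStep_eq_self (w : IsRadialWeight m a a') (hεc : Continuous ε)
    (hεα : ∀ t, ε t ≤ α) (hε : ∀ t, 0 < ε t) (hεa : Antitone ε) (hp : 1 < p) (hq : 0 < q) :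
    ∃ f, Continuous f ∧ cutoffStep a ε p q α f = f := by
  have hγ : 0 ≤ 1 / (p - 1) := by have := sub_pos.2 hp; positivity
  choose f hf using w.exists_tendsto_cutoffIter hεc hεα hε hεa hp hq
  have hcont := w.continuous_cutoffIter hεc hεα hε hp hq
  have hfm : Measurable f :=
    measurable_of_tendsto_metrizable (fun k => (hcont k).measurable) (tendsto_pi_nhds.2 hf)
  have hα : 0 < α := (hε 0).trans_le (hεα 0)
  have hcut : ∀ k, Continuous fun t => max (ε t) (min (cutoffIter a ε p q α k t) α) ^ q :=
    fun k => continuous_cutoff_rpow hεc hq.le (hcont k)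
  have hcutb : ∀ k t, |max (ε t) (min (cutoffIter a ε p q α k t) α) ^ q| ≤ α ^ q := by
    intro k t
    have := cutoff_mem hεα hε hq.le t (cutoffIter a ε p q α k t)
    rw [abs_of_nonneg ((Real.rpow_nonneg (hε t).le _).trans this.1)]
    exact this.2
  have hflux : ∀ s, Tendsto (fun k => radialFlux a
      (fun t => max (ε t) (min (cutoffIter a ε p q α k t) α) ^ q) s) atTop
      (𝓝 (radialFlux a (fun t => max (ε t) (min (f t) α) ^ q) s)) := by
    intro s
    refine Tendsto.div_const ?_ _
    refine intervalIntegral.tendsto_integral_filter_of_dominated_convergence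
      (fun t => a t * α ^ q) (Eventually.of_forall fun k => ?_) (Eventually.of_forall fun k => ?_)
      ((w.continuous.mul continuous_const).intervalIntegrable _ _) (ae_of_all _ fun t _ => ?_)
    · exact (w.continuous.mul (hcut k)).aestronglyMeasurable
    · refine ae_of_all _ fun t _ => ?_
      rw [norm_mul, Real.norm_eq_abs, abs_of_nonneg (w.nonneg t)]
      exact mul_le_mul_of_nonneg_left (hcutb k t) (w.nonneg t)
    · exact (((tendsto_const_nhds.max ((hf t).min tendsto_const_nhds)).rpow_const
        (Or.inr hq.le))).const_mul _
  have hfix : cutoffStep a ε p q α f = f := by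
    funext r
    rcases le_or_gt r 0 with hr | hr
    · have : ∀ k, cutoffIter a ε p q α (k + 1) r = α := fun k => by
        rw [cutoffIter_succ, w.cutoffStep_of_nonpos hp _ hr]
      have h1 := (hf r).comp (tendsto_add_atTop_nat 1)
      rw [w.cutoffStep_of_nonpos hp _ hr]
      refine tendsto_nhds_unique (tendsto_const_nhds.congr fun k => ?_) h1
      exact (this k).symm
    have h1 := (hf r).comp (tendsto_add_atTop_nat 1)
    refine tendsto_nhds_unique ?_ h1
    have h2 : Tendsto (fun k => cutoffStep a ε p q α (cutoffIter a ε p q α k) r) atTop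
        (𝓝 (cutoffStep a ε p q α f r)) := by
      refine Tendsto.const_sub _ ?_
      refine intervalIntegral.tendsto_integral_filter_of_dominated_convergence
        (fun s => (α ^ q * radialFlux a (fun _ => 1) s) ^ (1 / (p - 1)))
        (Eventually.of_forall fun k => ?_) (Eventually.of_forall fun k => ?_)
        (((Real.continuous_rpow_const hγ).comp (continuous_const.mul
          (w.continuous_radialFlux continuous_const))).intervalIntegrable _ _)
        (ae_of_all _ fun t _ => (hflux t).rpow_const (Or.inr hγ))
      · exact ((Real.continuous_rpow_const hγ).comp
          (w.continuous_radialFlux (hcut k))).aestronglyMeasurable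
      · refine ae_of_all _ fun s hs => ?_
        rw [uIoc_of_le hr.le] at hs
        refine (Real.abs_rpow_le_abs_rpow _ _).trans ?_
        exact Real.rpow_le_rpow (abs_nonneg _) 
          (w.abs_radialFlux_le hs.1.le (ae_of_all _ fun t _ => hcutb k t)) hγ
    refine h2.congr fun k => ?_
    rw [Function.comp_apply, cutoffIter_succ]
  exact ⟨f, hfix ▸ w.continuous_cutoffStep hεc hεα hε hp hq hfm, hfix⟩

/-- Global positive solutions with prescribed value at the pole. -/
theorem IsRadialWeight.exists_isPositiveProfile (w : IsRadialWeight m a a') (hp : 1 < p)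
    (hq : p < q + 1) (hpq : (p - 1) / p + 1 / (q + 1) ≤ 1 - 1 / m) (hα : 0 < α) :
    ∃ f, ∀ R, IsPositiveProfile a p q α R f := by
  have hp1 : 0 < p - 1 := sub_pos.2 hp
  have hγ : 0 ≤ 1 / (p - 1) := by positivity
  have hq0 : 0 < q := by linarith
  have hq1 : 0 < q + 1 := by linarith
  have hc : 0 < 1 - p / (q + 1) := by rw [sub_pos, div_lt_one hq1]; exact hq
  set κ := decayConst p q α with hκ
  have hκ0 : 0 ≤ κ := by rw [hκ, decayConst]; positivity
  set θ : ℝ → ℝ := fun s => radialFlux a (fun _ => 1) s ^ (1 / (p - 1)) with hθ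
  have hθc : Continuous θ := w.continuous_radialFlux_one_rpow hγ
  have hθ0 : ∀ s, 0 ≤ θ s := fun s => Real.rpow_nonneg (w.radialFlux_one_nonneg s) _
  set G : ℝ → ℝ := fun r => ∫ s in (0 : ℝ)..r, θ s with hG
  have hGd : ∀ s, HasDerivAt G (θ s) s := fun s => (hθc.integral_hasStrictDerivAt 0 s).hasDerivAt
  have hGc : Continuous G := continuous_iff_continuousAt.2 fun s => (hGd s).continuousAt
  have hGm : Monotone G := monotone_of_hasDerivAt_nonneg hGd hθ0
  have hG0 : ∀ t, 0 ≤ G t := by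
    intro t
    rcases le_or_gt 0 t with ht | ht
    · exact intervalIntegral.integral_nonneg ht fun s _ => hθ0 s
    · have : G t = 0 := by
        have h1 : EqOn θ (fun _ => 0) (uIcc 0 t) := fun s hs => by
          rw [uIcc_of_ge ht.le] at hs
          simp only [hθ]
          rw [w.radialFlux_of_nonpos _ hs.2, Real.zero_rpow (by positivity)]
        simp only [hG]
        rw [intervalIntegral.integral_congr h1]
        simp
      exact this.ge
  -- Half of the a priori lower bound: as long as the cut-off is inactive, the solution lies above
  -- `2 ε`.
  set ε : ℝ → ℝ := fun t => α / 2 * Real.exp (-(κ * G t)) with hεd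
  have hεc : Continuous ε := by fun_prop
  have hε : ∀ t, 0 < ε t := fun t => by positivity
  have hεα : ∀ t, ε t ≤ α := fun t => by
    have h1 : Real.exp (-(κ * G t)) ≤ 1 := Real.exp_le_one_iff.2
      (neg_nonpos.2 (mul_nonneg hκ0 (hG0 t)))
    simp only [hεd]
    nlinarith
  have hεa : Antitone ε := fun x y hxy => by
    have := mul_le_mul_of_nonneg_left (hGm hxy) hκ0
    simp only [hεd]
    gcongr
  obtain ⟨f, hfc, hff⟩ := w.exists_cutoffStep_eq_self hεc hεα hε hεa hp hq0
  have hfα : ∀ r, 0 ≤ r → f r ≤ α := by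
    intro r hr
    rw [← hff, cutoffStep, sub_le_self_iff]
    refine intervalIntegral.integral_nonneg hr fun s hs => Real.rpow_nonneg ?_ _
    exact div_nonneg (intervalIntegral.integral_nonneg hs.1 fun t _ =>
      mul_nonneg (w.nonneg t) (Real.rpow_nonneg ((hε t).le.trans (le_max_left _ _)) _)) (w.nonneg s)
  have hprof : ∀ R, (∀ t ∈ Ico 0 R, ε t ≤ f t) → IsPositiveProfile a p q α R f := by
    intro R hR
    have hR' : ∀ t ∈ Icc 0 R, ε t ≤ f t := by
      intro t ht
      rcases ht.2.eq_or_lt with rfl | hlt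
      · rcases ht.1.eq_or_lt with rfl | h0
        · rw [← hff, w.cutoffStep_of_nonpos hp _ le_rfl]; exact hεα 0
        · have hcl : IsClosed {s | ε s ≤ f s} := isClosed_le hεc hfc
          have : closure (Ico 0 t) ⊆ {s | ε s ≤ f s} := hcl.closure_subset_iff.2 hR
          rw [closure_Ico h0.ne] at this
          exact this ⟨h0.le, le_rfl⟩
      · exact hR t ⟨ht.1, hlt⟩
    refine ⟨hfc, fun r hr => (hε r).trans_le (hR' r hr), fun r hr => ?_⟩
    conv_lhs => rw [← hff]
    rw [cutoffStep, sub_right_inj]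
    refine intervalIntegral.integral_congr fun s hs => ?_
    rw [uIcc_of_le hr.1] at hs
    simp only [radialFlux]
    congr 2
    refine intervalIntegral.integral_congr fun t ht => ?_
    rw [uIcc_of_le hs.1] at ht
    rw [min_eq_left (hfα t ht.1), max_eq_right (hR' t ⟨ht.1, ht.2.trans (hs.2.trans hr.2)⟩)]
  refine ⟨f, fun R => hprof R ?_⟩
  by_contra! hcon
  obtain ⟨r, hr, hlt⟩ := hcon
  have hcomp : IsCompact (Icc 0 r ∩ {t | f t ≤ ε t}) :=
    isCompact_Icc.inter_right (isClosed_le hfc hεc)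
  -- Continuity argument: at the first contact point `S` of `f` with `ε`, the cut-off has been
  -- inactive on `[0, S]`, so `f` is a genuine profile there and `f S ≥ 2 ε S`, contradicting `f S ≤
  -- ε S`.
  obtain ⟨S, ⟨hS, hSε⟩, hSmin⟩ := hcomp.exists_isLeast ⟨r, ⟨hr.1, le_rfl⟩, hlt.le⟩
  have hS' : ∀ t ∈ Ico 0 S, ε t ≤ f t := by
    intro t ht
    by_contra! h
    exact absurd (hSmin ⟨⟨ht.1, ht.2.le.trans hS.2⟩, h.le⟩) (not_le.2 ht.2)
  have h1 := (hprof S hS').initial_mul_exp_le w hp hq hpq ⟨hS.1, le_rfl⟩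
  have h2 : 2 * ε S ≤ f S := by
    refine le_trans (le_of_eq ?_) h1
    simp only [hεd, hG, hθ]
    ring
  have h3 := hε S
  have h4 : f S ≤ ε S := hSε
  linarith

end Picard

/-! ### Behaviour of profiles at infinity. -/

section Limits

variable {m : ℝ} {a a' : ℝ → ℝ} {p q α : ℝ} {f : ℝ → ℝ}

lemma strictAntiOn_of_isPositiveProfile (w : IsRadialWeight m a a') (hp : 1 < p) (hq : 0 < q)
    (h : ∀ R, IsPositiveProfile a p q α R f) : StrictAntiOn f (Ici 0) := by
  refine strictAntiOn_of_deriv_neg (convex_Ici _) (h 0).continuous.continuousOn fun s hs => ?_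
  rw [interior_Ici] at hs
  have hs' : s ∈ Ioo 0 (s + 1) := ⟨hs, lt_add_one s⟩
  rw [((h (s + 1)).hasDerivAt w hp hq hs').deriv]
  exact neg_neg_of_pos (Real.rpow_pos_of_pos ((h (s + 1)).flux_pos w hq ⟨hs'.1, hs'.2.le⟩) _)

lemma exists_tendsto_of_isPositiveProfile (w : IsRadialWeight m a a') (hp : 1 < p) (hq : 0 < q)
    (h : ∀ R, IsPositiveProfile a p q α R f) :
    ∃ l, Tendsto f atTop (𝓝 l) ∧ ∀ r, 0 ≤ r → l ≤ f r := by
  have hanti := (strictAntiOn_of_isPositiveProfile w hp hq h).antitoneOn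
  have hm : Antitone fun r => f (max r 0) := fun x y hxy =>
    hanti (mem_Ici.2 (le_max_right x 0)) (mem_Ici.2 (le_max_right y 0)) (max_le_max_right 0 hxy)
  have hb : BddBelow (range fun r => f (max r 0)) := by
    refine ⟨0, ?_⟩
    rintro _ ⟨r, rfl⟩
    exact ((h _).pos _ ⟨le_max_right r 0, le_rfl⟩).le
  refine ⟨_, (tendsto_atTop_ciInf hm hb).congr' ?_, fun r hr => ?_⟩
  · filter_upwards [eventually_ge_atTop 0] with r hr
    rw [max_eq_left hr]
  · simpa [max_eq_left hr] using ciInf_le hb r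

/-- Solutions vanish at infinity if `Θ^{1/(p-1)}` is not integrable. -/
theorem tendsto_zero_of_not_integrableOn (w : IsRadialWeight m a a') (hp : 1 < p) (hq : 0 < q)
    (h : ∀ R, IsPositiveProfile a p q α R f)
    (hint : ¬ IntegrableOn (fun r => radialFlux a (fun _ => 1) r ^ (1 / (p - 1))) (Ioi 0)) :
    Tendsto f atTop (𝓝 0) := by
  have hγ : 0 < 1 / (p - 1) := by have := sub_pos.2 hp; positivity
  obtain ⟨l, hl, hle⟩ := exists_tendsto_of_isPositiveProfile w hp hq h
  have hl0 : 0 ≤ l := ge_of_tendsto hl <| by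
    filter_upwards [eventually_ge_atTop 0] with r hr using ((h r).pos r ⟨hr, le_rfl⟩).le
  rcases hl0.eq_or_lt with rfl | hlpos
  · exact hl
  refine absurd ?_ hint
  have hθc := w.continuous_radialFlux_one_rpow hγ.le
  have hc : 0 < (l ^ q) ^ (1 / (p - 1)) := by positivity
  -- If the limit `l` were positive, then `f ≥ l` gives `l^q Θ ≤ y`, and `∫₀ʳ y^(1/(p-1)) = α - f r
  -- < α` bounds the integrals of `Θ^(1/(p-1))` uniformly in `r`.
  refine integrableOn_Ioi_of_intervalIntegral_norm_bounded (b := fun r : ℝ => r) (l := atTop)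
    (α / (l ^ q) ^ (1 / (p - 1))) 0 (fun i => hθc.integrableOn_Ioc) tendsto_id ?_
  filter_upwards [eventually_ge_atTop 0] with r hr
  rw [le_div_iff₀' hc, ← intervalIntegral.integral_const_mul]
  have hfr := (h r).pos r ⟨hr, le_rfl⟩
  rw [(h r).eq r ⟨hr, le_rfl⟩, sub_pos] at hfr
  refine le_trans (intervalIntegral.integral_mono_on hr
    (Continuous.intervalIntegrable (by fun_prop) _ _)
    (((Real.continuous_rpow_const hγ.le).comp ((h r).continuous_flux w hq)).intervalIntegrable _ _)
    fun s hs => ?_) hfr.le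
  have hΘ := w.radialFlux_one_nonneg s
  rw [Real.norm_of_nonneg (Real.rpow_nonneg hΘ _), ← Real.mul_rpow (by positivity) hΘ,
    ← IsRadialWeight.radialFlux_const]
  refine Real.rpow_le_rpow ?_ ?_ hγ.le
  · rw [IsRadialWeight.radialFlux_const]; positivity
  · refine w.radialFlux_mono_of_le ((w.continuous.mul continuous_const).intervalIntegrable _ _)
      ((w.continuous.mul ((h r).continuous_rpow hq)).intervalIntegrable _ _) hs.1 fun t ht => ?_
    exact Real.rpow_le_rpow hl0 (hle t ht.1) hq.le

/-- Solutions have a positive limit if `Θ^{1/(p-1)}` is integrable. -/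
theorem exists_pos_tendsto_of_integrableOn (w : IsRadialWeight m a a') (hp : 1 < p)
    (hq : p < q + 1) (hpq : (p - 1) / p + 1 / (q + 1) ≤ 1 - 1 / m)
    (h : ∀ R, IsPositiveProfile a p q α R f)
    (hint : IntegrableOn (fun r => radialFlux a (fun _ => 1) r ^ (1 / (p - 1))) (Ioi 0)) :
    ∃ l, 0 < l ∧ Tendsto f atTop (𝓝 l) := by
  have hp1 : 0 < p - 1 := sub_pos.2 hp
  have hq0 : 0 < q := by linarith
  have hq1 : 0 < q + 1 := by linarith
  have hc : 0 < 1 - p / (q + 1) := by rw [sub_pos, div_lt_one hq1]; exact hq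
  have hα : 0 < α := (h 0).eq_initial le_rfl ▸ (h 0).pos 0 ⟨le_rfl, le_rfl⟩
  have hκ0 : 0 ≤ decayConst p q α := by rw [decayConst]; positivity
  obtain ⟨l, hl, -⟩ := exists_tendsto_of_isPositiveProfile w hp hq0 h
  refine ⟨l, ?_, hl⟩
  set I := ∫ r in Ioi (0 : ℝ), radialFlux a (fun _ => 1) r ^ (1 / (p - 1)) with hI
  have hlow : 0 < α * Real.exp (-(decayConst p q α * I)) := by positivity
  refine hlow.trans_le (ge_of_tendsto hl ?_)
  filter_upwards [eventually_ge_atTop 0] with r hr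
  refine le_trans ?_ ((h r).initial_mul_exp_le w hp hq hpq ⟨hr, le_rfl⟩)
  have : ∫ s in (0 : ℝ)..r, radialFlux a (fun _ => 1) s ^ (1 / (p - 1)) ≤ I := by
    rw [intervalIntegral.integral_of_le hr]
    exact setIntegral_mono_set hint
      (ae_of_all _ fun s => Real.rpow_nonneg (w.radialFlux_one_nonneg s) _)
      (ae_of_all _ fun s hs => hs.1)
  gcongr

end Limits

/-! ### The model function and its surface density as a weight. -/

namespace IsCartanHadamardModel

variable {ψ : ℝ → ℝ}

lemma continuousOn (h : IsCartanHadamardModel ψ) : ContinuousOn ψ (Ici 0) :=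
  h.contDiffOn_Ici.continuousOn

lemma hasDerivAt (h : IsCartanHadamardModel ψ) {r : ℝ} (hr : 0 < r) :
    HasDerivAt ψ (deriv ψ r) r :=
  ((h.contDiffOn_Ioi.differentiableOn (by norm_num)).differentiableAt
    (Ioi_mem_nhds hr)).hasDerivAt

lemma self_le (h : IsCartanHadamardModel ψ) {r : ℝ} (hr : 0 ≤ r) : r ≤ ψ r := by
  rcases hr.eq_or_lt with rfl | hr0
  · exact h.map_zero.ge
  have h1 := h.convexOn.le_slope_of_hasDerivWithinAt (x := 0) (y := r) (mem_Ici.2 le_rfl)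
    (mem_Ici.2 hr) hr0 h.hasDerivWithinAt_zero
  rw [slope_def_field, h.map_zero, sub_zero, sub_zero, le_div_iff₀ hr0] at h1
  linarith

lemma pos (h : IsCartanHadamardModel ψ) {r : ℝ} (hr : 0 < r) : 0 < ψ r :=
  hr.trans_le (h.self_le hr.le)

lemma nonneg (h : IsCartanHadamardModel ψ) {r : ℝ} (hr : 0 ≤ r) : 0 ≤ ψ r :=
  hr.trans (h.self_le hr)

lemma deriv_mono (h : IsCartanHadamardModel ψ) {r s : ℝ} (hr : 0 < r) (hrs : r ≤ s) :
    deriv ψ r ≤ deriv ψ s := by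
  rcases hrs.eq_or_lt with rfl | hlt
  · rfl
  exact (h.convexOn.le_slope_of_hasDerivAt hr.le (hr.trans hlt).le hlt (h.hasDerivAt hr)).trans
    (h.convexOn.slope_le_of_hasDerivAt hr.le (hr.trans hlt).le hlt (h.hasDerivAt (hr.trans hlt)))

lemma monotoneOn (h : IsCartanHadamardModel ψ) : MonotoneOn ψ (Ici 0) := by
  intro r hr s hs hrs
  rcases (mem_Ici.1 hr).eq_or_lt with rfl | h0
  · rw [h.map_zero]; exact h.nonneg hs
  rcases hrs.eq_or_lt with rfl | hlt
  · rfl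
  have h1 := h.convexOn.secant_mono (a := 0) (x := r) (y := s) (mem_Ici.2 le_rfl) hr hs h0.ne'
    (h0.trans hlt).ne' hrs
  rw [h.map_zero, sub_zero, sub_zero, sub_zero, sub_zero] at h1
  have h2 := h.pos h0
  rw [div_le_div_iff₀ h0 (h0.trans hlt)] at h1
  nlinarith

end IsCartanHadamardModel

/-- The surface density `ψ ^ (n - 1)`, extended by zero. -/
noncomputable def modelWeight (n : ℕ) (ψ : ℝ → ℝ) (r : ℝ) : ℝ := ψ (max r 0) ^ (n - 1)

section Weight

variable {n : ℕ} {ψ : ℝ → ℝ}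

lemma modelWeight_of_nonneg {r : ℝ} (hr : 0 ≤ r) : modelWeight n ψ r = ψ r ^ (n - 1) := by
  rw [modelWeight, max_eq_left hr]

lemma IsCartanHadamardModel.continuous_max (h : IsCartanHadamardModel ψ) :
    Continuous fun r => ψ (max r 0) :=
  h.continuousOn.comp_continuous (by fun_prop) fun r => mem_Ici.2 (le_max_right r 0)

lemma IsCartanHadamardModel.isRadialWeight (h : IsCartanHadamardModel ψ) (hn : 2 ≤ n) :
    IsRadialWeight n (modelWeight n ψ)
      (fun r => ((n : ℝ) - 1) * ψ r ^ (n - 2) * deriv ψ r) where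
  continuous := h.continuous_max.pow _
  eq_zero r hr := by
    rw [modelWeight, max_eq_right hr, h.map_zero, zero_pow (by omega)]
  pos r hr := by
    rw [modelWeight_of_nonneg hr.le]
    exact pow_pos (h.pos hr) _
  monotone r s hrs :=
    pow_le_pow_left₀ (h.nonneg (le_max_right r 0))
      (h.monotoneOn (mem_Ici.2 (le_max_right r 0)) (mem_Ici.2 (le_max_right s 0))
        (max_le_max_right 0 hrs)) _
  hasDerivAt r hr := by
    refine (((h.hasDerivAt hr).pow (n - 1)).congr_of_eventuallyEq ?_).congr_deriv ?_
    · filter_upwards [Ioi_mem_nhds hr] with s hs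
      exact modelWeight_of_nonneg (le_of_lt hs)
    · rw [Nat.cast_sub (by omega : 1 ≤ n), show n - 1 - 1 = n - 2 by omega]
      simp
  growth r hr := by
    have hc : Continuous (modelWeight n ψ) := h.continuous_max.pow _
    have hψr := h.pos hr
    set V : ℝ → ℝ := fun r => ∫ s in (0 : ℝ)..r, modelWeight n ψ s with hV
    have hVd : ∀ s, HasDerivAt V (modelWeight n ψ s) s := fun s =>
      (hc.integral_hasStrictDerivAt 0 s).hasDerivAt
    -- With `r` fixed, the derivative in `s` is `n ψ(s)^(n-1) (ψ'(r) - ψ'(s))`, nonnegative by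
    -- convexity. Comparing `s = 0` with `s = r` gives `ψ(r)^n ≤ n V(r) ψ'(r)`, which is the growth
    -- condition up to a factor `ψ^(n-2)`.
    have hmono : MonotoneOn (fun s => n * V s * deriv ψ r - ψ s ^ n) (Icc 0 r) := by
      have hd : ∀ s ∈ Ioo 0 r, HasDerivAt (fun s => n * V s * deriv ψ r - ψ s ^ n)
          (n * modelWeight n ψ s * deriv ψ r - n * ψ s ^ (n - 1) * deriv ψ s) s := fun s hs =>
        (((hVd s).const_mul _).mul_const _).sub ((h.hasDerivAt hs.1).pow n)
      refine monotoneOn_of_deriv_nonneg (convex_Icc _ _) ?_ ?_ ?_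
      · have hVc : Continuous V := continuous_iff_continuousAt.2 fun s => (hVd s).continuousAt
        exact ((continuous_const.mul hVc).mul continuous_const).continuousOn.sub
          ((h.continuousOn.mono Icc_subset_Ici_self).pow n)
      · rw [interior_Icc]
        exact fun s hs => (hd s hs).differentiableAt.differentiableWithinAt
      · rw [interior_Icc]
        intro s hs
        rw [(hd s hs).deriv, modelWeight_of_nonneg hs.1.le, ← mul_sub]
        have := h.nonneg hs.1.le
        exact mul_nonneg (by positivity) (sub_nonneg.2 (h.deriv_mono hs.1 hs.2.le))
    have h1 := hmono ⟨le_rfl, hr.le⟩ ⟨hr.le, le_rfl⟩ hr.le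
    simp only [hV, intervalIntegral.integral_same, h.map_zero, mul_zero, zero_mul,
      zero_pow (by omega : n ≠ 0), sub_zero] at h1
    rw [modelWeight_of_nonneg hr.le]
    have hn0 : (0 : ℝ) < n := by exact_mod_cast (by omega : 0 < n)
    have hn1 : (0 : ℝ) ≤ (n : ℝ) - 1 := by
      have : (1 : ℝ) ≤ n := by exact_mod_cast (by omega : 1 ≤ n)
      linarith
    have e : (ψ r ^ (n - 1)) ^ 2 = ψ r ^ (n - 2) * ψ r ^ n := by
      rw [← pow_mul, ← pow_add]; congr 1; omega
    have h2 : ψ r ^ n / n ≤ V r * deriv ψ r := by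
      rw [div_le_iff₀ hn0]; simp only [hV]; linarith
    calc (1 - 1 / (n : ℝ)) * (ψ r ^ (n - 1)) ^ 2
        = ((n : ℝ) - 1) * ψ r ^ (n - 2) * (ψ r ^ n / n) := by rw [e]; field_simp
      _ ≤ ((n : ℝ) - 1) * ψ r ^ (n - 2) * (V r * deriv ψ r) := by gcongr
      _ = _ := by ring

lemma modelTheta_eq {r : ℝ} (hr : 0 < r) :
    modelTheta n ψ r = radialFlux (modelWeight n ψ) (fun _ => 1) r := by
  rw [modelTheta, radialFlux, modelWeight_of_nonneg hr.le]
  congr 1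
  refine intervalIntegral.integral_congr fun s hs => ?_
  rw [uIcc_of_le hr.le] at hs
  simp [modelWeight_of_nonneg hs.1]

end Weight

/-! ### Volume density of the model metric. -/

section Metric

variable {n : ℕ} {ψ : ℝ → ℝ}

lemma modelMetric_of_ne {x : EuclideanSpace ℝ (Fin n)} (hx : x ≠ 0)
    (v w : EuclideanSpace ℝ (Fin n)) : modelMetric n ψ x v w =
    (inner ℝ x v / ‖x‖) * (inner ℝ x w / ‖x‖) +
      (ψ ‖x‖ / ‖x‖) ^ 2 *
        (inner ℝ v w - (inner ℝ x v / ‖x‖) * (inner ℝ x w / ‖x‖)) := by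
  rw [modelMetric, if_neg hx]

/-- With `c = ψ(r)/r`, the Gram matrix is `c²` times a rank-one perturbation of the identity in the
direction `x / r`. The matrix determinant lemma gives `c^(2n) c^(-2)`: one radial direction has
length one and `n - 1` tangential ones are stretched by `c`. -/
lemma modelDensity_of_ne (hn : 0 < n) (hψ : IsCartanHadamardModel ψ)
    {x : EuclideanSpace ℝ (Fin n)} (hx : x ≠ 0) :
    modelDensity n ψ x = (ψ ‖x‖ / ‖x‖) ^ (n - 1) := by
  have hr : 0 < ‖x‖ := norm_pos_iff.2 hx
  have hψr : 0 < ψ ‖x‖ := hψ.pos hr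
  set c := ψ ‖x‖ / ‖x‖ with hc
  have hc0 : 0 < c := by positivity
  have hsum : ∑ i, (x i / ‖x‖) * (x i / ‖x‖) = 1 := by
    have : ∑ i, x i * x i = ‖x‖ ^ 2 := by
      rw [EuclideanSpace.norm_sq_eq]
      simp [pow_two]
    simp_rw [div_mul_div_comm]
    rw [← Finset.sum_div, this, ← pow_two, div_self (by positivity)]
  have hM : (Matrix.of fun i j : Fin n => modelMetric n ψ x (EuclideanSpace.single i 1)
      (EuclideanSpace.single j 1)) = c ^ 2 • ((1 : Matrix (Fin n) (Fin n) ℝ) +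
      Matrix.replicateCol Unit (fun i => (c ^ (-2 : ℤ) - 1) * (x i / ‖x‖)) *
      Matrix.replicateRow Unit (fun i => x i / ‖x‖)) := by
    ext i j
    rw [Matrix.of_apply, modelMetric_of_ne hx, Matrix.smul_apply, Matrix.add_apply,
      Matrix.mul_apply, Matrix.one_apply]
    simp only [EuclideanSpace.inner_single_right, PiLp.single_apply, Matrix.replicateCol,
      Matrix.replicateRow, Matrix.of_apply]
    simp only [← hc, Finset.univ_unique, Finset.sum_const, Finset.card_singleton, one_smul,
      smul_eq_mul, one_mul, conj_trivial]
    rw [show c ^ (-2 : ℤ) = (c ^ 2)⁻¹ by norm_cast]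
    have : (if j = i then (1 : ℝ) else 0) = if i = j then 1 else 0 := by simp [eq_comm]
    rw [this]
    field_simp
    ring
  rw [modelDensity, hM, Matrix.det_smul, Matrix.det_one_add_mul_comm, Fintype.card_fin]
  have : (1 + Matrix.replicateRow Unit (fun i => x i / ‖x‖) *
      Matrix.replicateCol Unit (fun i => (c ^ (-2 : ℤ) - 1) * (x i / ‖x‖))).det =
      c ^ (-2 : ℤ) := by
    rw [Matrix.det_unique, Matrix.add_apply, Matrix.mul_apply, Matrix.one_apply]
    simp only [Matrix.replicateCol, Matrix.replicateRow, Matrix.of_apply, if_true]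
    rw [show ∑ j, x j / ‖x‖ * ((c ^ (-2 : ℤ) - 1) * (x j / ‖x‖)) =
      (c ^ (-2 : ℤ) - 1) * ∑ j, (x j / ‖x‖) * (x j / ‖x‖) by
        rw [Finset.mul_sum]; exact Finset.sum_congr rfl fun j _ => by ring]
    rw [hsum]; ring
  rw [this, show c ^ (-2 : ℤ) = (c ^ 2)⁻¹ by norm_cast]
  obtain ⟨k, rfl⟩ : ∃ k, n = k + 1 := ⟨n - 1, by omega⟩
  rw [pow_succ, mul_assoc, mul_inv_cancel₀ (by positivity), mul_one, ← pow_mul, mul_comm 2 k,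
    pow_mul, Real.sqrt_sq (by positivity)]
  rfl

end Metric

/-! ### Comparison of the Riemannian and Lebesgue measures. -/

section Volume

variable {n : ℕ} {ψ : ℝ → ℝ}

/-- The volume density of the model in polar form, `(ψ (r) / r) ^ (n - 1)`. -/
noncomputable def radialDensity (n : ℕ) (ψ : ℝ → ℝ) (r : ℝ) : ℝ :=
  modelWeight n ψ r / r ^ (n - 1)

lemma radialDensity_nonneg (hψ : IsCartanHadamardModel ψ) {r : ℝ} (hr : 0 ≤ r) :
    0 ≤ radialDensity n ψ r := by
  rw [radialDensity, modelWeight_of_nonneg hr]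
  have := hψ.nonneg hr
  positivity

lemma one_le_radialDensity (hψ : IsCartanHadamardModel ψ) {r : ℝ} (hr : 0 < r) :
    1 ≤ radialDensity n ψ r := by
  rw [radialDensity, modelWeight_of_nonneg hr.le, ← div_pow]
  exact one_le_pow₀ ((one_le_div hr).2 (hψ.self_le hr.le))

lemma IsCartanHadamardModel.div_le_div (hψ : IsCartanHadamardModel ψ) {r R : ℝ} (hr : 0 < r)
    (hrR : r ≤ R) : ψ r / r ≤ ψ R / R := by
  have hR := hr.trans_le hrR
  have h1 := hψ.convexOn.secant_mono (a := 0) (x := r) (y := R) (mem_Ici.2 le_rfl) hr.le hR.le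
    hr.ne' hR.ne' hrR
  simpa [hψ.map_zero] using h1

lemma radialDensity_le (hψ : IsCartanHadamardModel ψ) {r R : ℝ} (hr : 0 < r) (hrR : r ≤ R) :
    radialDensity n ψ r ≤ (ψ R / R) ^ (n - 1) := by
  rw [radialDensity, modelWeight_of_nonneg hr.le, ← div_pow]
  exact pow_le_pow_left₀ (div_nonneg (hψ.nonneg hr.le) hr.le) (hψ.div_le_div hr hrR) _

lemma measurable_radialDensity (hψ : IsCartanHadamardModel ψ) :
    Measurable (radialDensity n ψ) :=
  (hψ.continuous_max.measurable.pow_const _).div (measurable_id.pow_const _)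

lemma measurable_radialDensity_norm (hψ : IsCartanHadamardModel ψ) :
    Measurable fun x : EuclideanSpace ℝ (Fin n) => radialDensity n ψ ‖x‖ :=
  (measurable_radialDensity hψ).comp measurable_norm

/-- `(ψ (r) / r) ^ (n - 1) → 1` at the pole. -/
lemma tendsto_radialDensity (hψ : IsCartanHadamardModel ψ) :
    Tendsto (radialDensity n ψ) (𝓝[>] 0) (𝓝 1) := by
  have h1 : Tendsto (fun r => ψ r / r) (𝓝[>] 0) (𝓝 1) := by
    have := (hasDerivWithinAt_iff_tendsto_slope' (self_notMem_Ioi)).1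
      (hψ.hasDerivWithinAt_zero.mono Ioi_subset_Ici_self)
    refine this.congr fun r => ?_
    rw [slope_def_field, hψ.map_zero, sub_zero, sub_zero]
  have h2 := h1.pow (n - 1)
  rw [one_pow] at h2
  refine h2.congr' ?_
  filter_upwards [self_mem_nhdsWithin] with r hr
  rw [radialDensity, modelWeight_of_nonneg (le_of_lt hr), div_pow]

variable [NeZero n]

lemma modelVolume_eq (hψ : IsCartanHadamardModel ψ) :
    modelVolume n ψ = volume.withDensity fun x => ENNReal.ofReal (radialDensity n ψ ‖x‖) := by
  have : Nontrivial (EuclideanSpace ℝ (Fin n)) := inferInstance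
  refine withDensity_congr_ae ?_
  have h0 : ∀ᵐ x : EuclideanSpace ℝ (Fin n), x ≠ 0 := Measure.ae_ne volume 0
  filter_upwards [h0] with x hx
  rw [modelDensity_of_ne (NeZero.pos n) hψ hx, radialDensity,
    modelWeight_of_nonneg (norm_nonneg x), div_pow]

/-- The density is at least one off the pole because `ψ(r) ≥ r`, so no Lebesgue-positive set becomes
null. -/
lemma ae_modelVolume (hψ : IsCartanHadamardModel ψ) :
    ae (modelVolume n ψ) = ae (volume : Measure (EuclideanSpace ℝ (Fin n))) := by
  refine le_antisymm ?_ ?_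
  · exact Measure.ae_le_iff_absolutelyContinuous.2 (withDensity_absolutelyContinuous _ _)
  · rw [modelVolume_eq hψ]
    refine Measure.ae_le_iff_absolutelyContinuous.2 (withDensity_absolutelyContinuous'
      (measurable_radialDensity_norm hψ).ennreal_ofReal.aemeasurable ?_)
    filter_upwards [Measure.ae_ne volume (0 : EuclideanSpace ℝ (Fin n))] with x hx
    rw [Ne, ENNReal.ofReal_eq_zero, not_le]
    exact one_pos.trans_le (one_le_radialDensity hψ (norm_pos_iff.2 hx))

lemma integral_modelVolume (hψ : IsCartanHadamardModel ψ) (g : EuclideanSpace ℝ (Fin n) → ℝ) :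
    ∫ x, g x ∂(modelVolume n ψ) = ∫ x, radialDensity n ψ ‖x‖ * g x := by
  rw [modelVolume_eq hψ, integral_withDensity_eq_integral_toReal_smul
    (measurable_radialDensity_norm hψ).ennreal_ofReal (ae_of_all _ fun _ => ENNReal.ofReal_lt_top)]
  refine integral_congr_ae (ae_of_all _ fun x => ?_)
  simp only [smul_eq_mul]
  rw [ENNReal.toReal_ofReal (radialDensity_nonneg hψ (norm_nonneg x))]

/-- Since the density is at least one, local integrability for `dV` passes to Lebesgue measure. -/
lemma volume_restrict_le (hψ : IsCartanHadamardModel ψ) (K : Set (EuclideanSpace ℝ (Fin n))) :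
    (volume.restrict K) ≤ (modelVolume n ψ).restrict K := by
  refine Measure.restrict_mono le_rfl ?_
  have : (volume : Measure (EuclideanSpace ℝ (Fin n))) = volume.withDensity 1 := by
    rw [withDensity_one]
  rw [modelVolume_eq hψ]
  conv_lhs => rw [this]
  refine withDensity_mono ?_
  filter_upwards [Measure.ae_ne volume (0 : EuclideanSpace ℝ (Fin n))] with x hx
  rw [Pi.one_apply, ← ENNReal.ofReal_one]
  exact ENNReal.ofReal_le_ofReal (one_le_radialDensity hψ (norm_pos_iff.2 hx))

lemma modelVolume_lt_top (hψ : IsCartanHadamardModel ψ) {K : Set (EuclideanSpace ℝ (Fin n))}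
    (hK : IsCompact K) : modelVolume n ψ K < ⊤ := by
  obtain ⟨R, hR, hKR⟩ := hK.isBounded.subset_closedBall_lt 0 (0 : EuclideanSpace ℝ (Fin n))
  refine (measure_mono hKR).trans_lt ?_
  rw [modelVolume_eq hψ, withDensity_apply _ measurableSet_closedBall]
  refine (setLIntegral_mono_ae (g := fun _ => ENNReal.ofReal ((ψ R / R) ^ (n - 1)))
    measurable_const.aemeasurable ?_).trans_lt ?_
  · filter_upwards [Measure.ae_ne volume (0 : EuclideanSpace ℝ (Fin n))] with x hx hxK
    exact ENNReal.ofReal_le_ofReal (radialDensity_le hψ (norm_pos_iff.2 hx)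
      (mem_closedBall_zero_iff.1 hxK))
  · rw [setLIntegral_const]
    exact ENNReal.mul_lt_top ENNReal.ofReal_lt_top (isCompact_closedBall _ _).measure_lt_top

lemma memLp_modelVolume_of_continuous (hψ : IsCartanHadamardModel ψ) {r : ℝ≥0∞}
    {u : EuclideanSpace ℝ (Fin n) → ℝ} (hu : Continuous u)
    {K : Set (EuclideanSpace ℝ (Fin n))} (hK : IsCompact K) :
    MemLp u r ((modelVolume n ψ).restrict K) := by
  obtain ⟨C, hC⟩ := hK.exists_bound_of_continuousOn hu.continuousOn
  have : IsFiniteMeasure ((modelVolume n ψ).restrict K) :=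
    ⟨by rw [Measure.restrict_apply_univ]; exact modelVolume_lt_top hψ hK⟩
  exact MemLp.of_bound hu.aestronglyMeasurable C (ae_restrict_of_forall_mem hK.measurableSet hC)

end Volume

/-! ### Radial fields and Euclidean calculus of radial functions. -/

section RadialMetric

variable {n : ℕ} {ψ : ℝ → ℝ}

/-- Only the `dr²` part of the metric sees a radial vector, so `ψ` drops out: radial functions have
the same gradient as in Euclidean space. -/
lemma modelMetric_smul_self (x v : EuclideanSpace ℝ (Fin n)) (c : ℝ) :
    modelMetric n ψ x (c • x) v = c * inner ℝ x v := by
  rcases eq_or_ne x 0 with rfl | hx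
  · simp [modelMetric]
  have hr : ‖x‖ ≠ 0 := norm_ne_zero_iff.2 hx
  rw [modelMetric_of_ne hx, real_inner_smul_right, real_inner_self_eq_norm_sq,
    real_inner_smul_left]
  field_simp
  ring

lemma modelNorm_smul_self (x : EuclideanSpace ℝ (Fin n)) (c : ℝ) :
    modelNorm n ψ x (c • x) = |c| * ‖x‖ := by
  rw [modelNorm, modelMetric_smul_self, real_inner_smul_right, real_inner_self_eq_norm_sq,
    show c * (c * ‖x‖ ^ 2) = (|c| * ‖x‖) ^ 2 by rw [mul_pow, sq_abs]; ring,
    Real.sqrt_sq (by positivity)]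

end RadialMetric

section RadialCalculus

variable {E : Type*} [NormedAddCommGroup E] [InnerProductSpace ℝ E]

lemma hasFDerivAt_norm_of_ne {x : E} (hx : x ≠ 0) :
    HasFDerivAt (fun y : E => ‖y‖) (‖x‖⁻¹ • innerSL ℝ x) x := by
  have hr : 0 < ‖x‖ := norm_pos_iff.2 hx
  have h1 := (hasStrictFDerivAt_norm_sq x).hasFDerivAt.sqrt (by positivity)
  have h2 : (fun y : E => √(‖y‖ ^ 2)) = fun y => ‖y‖ := by
    funext y; exact Real.sqrt_sq (norm_nonneg y)
  rw [h2, Real.sqrt_sq hr.le] at h1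
  refine h1.congr_fderiv ?_
  ext v
  simp
  field_simp

lemma HasDerivAt.hasFDerivAt_comp_norm {f : ℝ → ℝ} {k : ℝ} {x : E} (hx : x ≠ 0)
    (hf : HasDerivAt f k ‖x‖) :
    HasFDerivAt (fun y : E => f ‖y‖) ((k / ‖x‖) • innerSL ℝ x) x := by
  refine (hf.comp_hasFDerivAt x (hasFDerivAt_norm_of_ne hx)).congr_fderiv ?_
  rw [smul_smul, div_eq_mul_inv]

lemma HasDerivAt.hasFDerivAt_comp_norm_zero {f : ℝ → ℝ} (hf : HasDerivAt f 0 0) :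
    HasFDerivAt (fun y : E => f ‖y‖) (0 : E →L[ℝ] ℝ) 0 := by
  have h1 := hasDerivAt_iff_isLittleO.1 hf
  have h2 : Tendsto (fun y : E => ‖y‖) (𝓝 0) (𝓝 0) := by simpa using continuous_norm.tendsto (0 : E)
  have h3 := h1.comp_tendsto h2
  rw [hasFDerivAt_iff_isLittleO]
  refine Asymptotics.IsLittleO.trans_isBigO (g := fun y : E => ‖y‖) ?_
    (by simpa using (Asymptotics.isBigO_refl (fun y : E => y) (𝓝 0)).norm_left)
  simpa [Function.comp_def] using h3

/-- The radial vector field `m (r) x` along a coordinate. -/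
lemma hasFDerivAt_comp_norm_mul_inner {f : ℝ → ℝ} {k : ℝ} {x : E} (hx : x ≠ 0)
    (hf : HasDerivAt f k ‖x‖) (v : E) :
    HasFDerivAt (fun y : E => f ‖y‖ * inner ℝ v y)
      (f ‖x‖ • innerSL ℝ v + inner ℝ v x • (k / ‖x‖) • innerSL ℝ x) x :=
  (hf.hasFDerivAt_comp_norm hx).mul (innerSL ℝ v).hasFDerivAt

/-- The linear factor vanishes at the origin, so mere continuity of `c` suffices. This makes the
flux field differentiable at the pole as well. -/
lemma hasFDerivAt_mul_inner_zero {c : E → ℝ} (hc : ContinuousAt c 0) (v : E) :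
    HasFDerivAt (fun y : E => c y * inner ℝ v y) (c 0 • innerSL ℝ v) 0 := by
  rw [hasFDerivAt_iff_isLittleO]
  have h1 : (fun y => c y - c 0) =o[𝓝 (0 : E)] fun _ => (1 : ℝ) := by
    rw [Asymptotics.isLittleO_one_iff]
    simpa using hc.sub_const (c 0)
  have h2 : (fun y : E => inner ℝ v y) =O[𝓝 (0 : E)] fun y : E => y := (innerSL ℝ v).isBigO_id _
  have h3 := h1.mul_isBigO h2.norm_right
  simp only [one_mul] at h3
  simp only [sub_zero]
  refine (Asymptotics.isLittleO_norm_right.1 h3).congr_left fun y => ?_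
  simp
  ring

end RadialCalculus

/-! ### Profiles define weak solutions. -/

section Existence

variable {n : ℕ} {ψ : ℝ → ℝ}

lemma sum_inner_single_mul (x : EuclideanSpace ℝ (Fin n))
    (ℓ : EuclideanSpace ℝ (Fin n) →L[ℝ] ℝ) :
    ∑ i, inner ℝ (EuclideanSpace.single i (1 : ℝ)) x * ℓ (EuclideanSpace.single i 1) = ℓ x := by
  have h := (EuclideanSpace.basisFun (Fin n) ℝ).sum_repr' x
  conv_rhs => rw [← h, map_sum]
  refine Finset.sum_congr rfl fun i _ => ?_
  rw [map_smul, smul_eq_mul, EuclideanSpace.basisFun_apply]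

lemma sum_inner_single_sq (x : EuclideanSpace ℝ (Fin n)) :
    ∑ i, inner ℝ (EuclideanSpace.single i (1 : ℝ)) x *
      inner ℝ x (EuclideanSpace.single i (1 : ℝ)) = ‖x‖ ^ 2 := by
  have := sum_inner_single_mul x (innerSL ℝ x)
  simpa using this

/-- Divergence of the radial field `M (r) x`. -/
lemma sum_fderiv_comp_norm_mul_inner {M : ℝ → ℝ} {k : ℝ} {x : EuclideanSpace ℝ (Fin n)}
    (hx : x ≠ 0) (hM : HasDerivAt M k ‖x‖) :
    ∑ i, fderiv ℝ (fun y => M ‖y‖ * inner ℝ (EuclideanSpace.single i (1 : ℝ)) y) x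
      (EuclideanSpace.single i 1) = n * M ‖x‖ + k * ‖x‖ := by
  have hr : ‖x‖ ≠ 0 := norm_ne_zero_iff.2 hx
  have h1 : ∀ i : Fin n, fderiv ℝ (fun y => M ‖y‖ * inner ℝ (EuclideanSpace.single i (1 : ℝ)) y) x
      (EuclideanSpace.single i 1) = M ‖x‖ + k / ‖x‖ *
        (inner ℝ (EuclideanSpace.single i (1 : ℝ)) x *
          inner ℝ x (EuclideanSpace.single i (1 : ℝ))) := by
    intro i
    rw [(hasFDerivAt_comp_norm_mul_inner hx hM _).fderiv]
    simp only [add_apply, smul_apply, innerSL_apply_apply, smul_eq_mul,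
      real_inner_self_eq_norm_sq, PiLp.norm_single, norm_one, one_pow, mul_one]
    ring
  simp_rw [h1]
  rw [Finset.sum_add_distrib, ← Finset.mul_sum, sum_inner_single_sq]
  simp
  field_simp

variable {p q α : ℝ} {f : ℝ → ℝ}

lemma IsPositiveProfile.continuous_rpow_flux {m : ℝ} {a a' : ℝ → ℝ} {R : ℝ}
    (h : IsPositiveProfile a p q α R f) (w : IsRadialWeight m a a')
    (hp : 1 < p) (hq : 0 < q) :
    Continuous fun s => radialFlux a (fun t => f t ^ q) s ^ (1 / (p - 1)) :=
  (Real.continuous_rpow_const (by have := sub_pos.2 hp; positivity)).comp (h.continuous_flux w hq)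

/-- The radial field `c (r) x / r` is continuous if `c` is and `c (0) = 0`. -/
lemma continuous_radialField {E : Type*} [NormedAddCommGroup E] [NormedSpace ℝ E] {c : ℝ → ℝ}
    (hc : Continuous c) (h0 : c 0 = 0) : Continuous fun x : E => (c ‖x‖ / ‖x‖) • x := by
  rw [continuous_iff_continuousAt]
  intro x
  rcases eq_or_ne x 0 with rfl | hx
  · rw [ContinuousAt, smul_zero]
    refine squeeze_zero_norm (a := fun x : E => |c ‖x‖|) (fun y => ?_) ?_
    · rw [norm_smul, norm_div, norm_norm, Real.norm_eq_abs]
      rcases (norm_nonneg y).eq_or_lt with h | h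
      · rw [← h]; simp
      · rw [div_mul_cancel₀ _ h.ne']
    · have : Continuous fun x : E => |c ‖x‖| := by fun_prop
      simpa [h0] using this.tendsto 0
  · exact ((hc.comp continuous_norm).continuousAt.div continuous_norm.continuousAt
      (norm_ne_zero_iff.2 hx)).smul continuousAt_id

/-- Everywhere differentiability with a derivative bounded on the support of `φ` replaces `C¹`, so
no continuity of the derivative at the pole has to be checked. -/
lemma integral_mul_fderiv_eq_neg {E : Type*} [NormedAddCommGroup E] [NormedSpace ℝ E]
    [FiniteDimensional ℝ E] [MeasurableSpace E] [BorelSpace E] {μ : Measure E}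
    [μ.IsAddHaarMeasure] {w φ : E → ℝ} (hw : Differentiable ℝ w)
    (hφ : ContDiff ℝ ∞ φ) (hφc : HasCompactSupport φ) (v : E) {C : ℝ}
    (hC : ∀ᵐ x ∂μ, x ∈ tsupport φ → |fderiv ℝ w x v| ≤ C) :
    Integrable (fun x => fderiv ℝ w x v * φ x) μ ∧
    ∫ x, w x * fderiv ℝ φ x v ∂μ = - ∫ x, fderiv ℝ w x v * φ x ∂μ := by
  have hφd : Continuous fun x => fderiv ℝ φ x v :=
    (hφ.continuous_fderiv (by simp)).clm_apply continuous_const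
  have hφdc : HasCompactSupport fun x => fderiv ℝ φ x v := hφc.fderiv_apply (𝕜 := ℝ) v
  have h1 : Integrable (fun x => fderiv ℝ w x v * φ x) μ := by
    have hb : Integrable (fun x => C * |φ x|) μ :=
      ((hφ.continuous.abs.integrable_of_hasCompactSupport hφc.norm)).const_mul C
    refine hb.mono' ((measurable_fderiv_apply_const ℝ w v).aestronglyMeasurable.mul
      hφ.continuous.aestronglyMeasurable) ?_
    filter_upwards [hC] with x hx
    rw [norm_mul, Real.norm_eq_abs, Real.norm_eq_abs]
    by_cases hx' : x ∈ tsupport φ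
    · exact mul_le_mul_of_nonneg_right (hx hx') (abs_nonneg _)
    · rw [image_eq_zero_of_notMem_tsupport hx']; simp
  refine ⟨h1, integral_mul_fderiv_eq_neg_fderiv_mul_of_integrable h1 ?_ ?_ (fun x _ => hw x)
    fun x _ => (hφ.differentiable (by simp)) x⟩
  · exact (hw.continuous.mul hφd).integrable_of_hasCompactSupport hφdc.mul_left
  · exact (hw.continuous.mul hφ.continuous).integrable_of_hasCompactSupport hφc.mul_left

/-- The gradient of the radial function with profile `f`. -/
noncomputable def profileGradient (n : ℕ) (ψ : ℝ → ℝ) (p q : ℝ) (f : ℝ → ℝ)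
    (x : EuclideanSpace ℝ (Fin n)) : EuclideanSpace ℝ (Fin n) :=
  (-radialFlux (modelWeight n ψ) (fun t => f t ^ q) ‖x‖ ^ (1 / (p - 1)) / ‖x‖) • x

lemma hasFDerivAt_integral_norm {k : ℝ → ℝ} (hk : Continuous k) (h0 : k 0 = 0)
    (x : EuclideanSpace ℝ (Fin n)) :
    HasFDerivAt (fun y : EuclideanSpace ℝ (Fin n) => ∫ s in (0 : ℝ)..‖y‖, k s)
      (innerSL ℝ ((k ‖x‖ / ‖x‖) • x)) x := by
  have hd : ∀ r, HasDerivAt (fun r => ∫ s in (0 : ℝ)..r, k s) (k r) r := fun r =>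
    (hk.integral_hasStrictDerivAt 0 r).hasDerivAt
  rcases eq_or_ne x 0 with rfl | hx
  · have h1 := hd 0
    rw [h0] at h1
    simpa using h1.hasFDerivAt_comp_norm_zero (E := EuclideanSpace ℝ (Fin n))
  · refine ((hd ‖x‖).hasFDerivAt_comp_norm hx).congr_fderiv ?_
    rw [map_smul]

lemma hasFDerivAt_profile (hn : 2 ≤ n) (hψ : IsCartanHadamardModel ψ) (hp : 1 < p) (hq : 0 < q)
    (h : ∀ R, IsPositiveProfile (modelWeight n ψ) p q α R f) (x : EuclideanSpace ℝ (Fin n)) :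
    HasFDerivAt (fun y : EuclideanSpace ℝ (Fin n) => f ‖y‖)
      (innerSL ℝ (profileGradient n ψ p q f x)) x := by
  have w := hψ.isRadialWeight hn
  have hγ : 1 / (p - 1) ≠ 0 := by have := sub_pos.2 hp; positivity
  have h1 := (hasFDerivAt_integral_norm ((h 0).continuous_rpow_flux w hp hq).neg (by
    rw [Pi.neg_apply, w.radialFlux_of_nonpos _ le_rfl, Real.zero_rpow hγ, neg_zero]) x).const_add α
  refine h1.congr_of_eventuallyEq (Eventually.of_forall fun y => ?_)
  simp only [Pi.neg_apply, intervalIntegral.integral_neg, ← sub_eq_add_neg]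
  exact (h ‖y‖).eq ‖y‖ ⟨norm_nonneg y, le_rfl⟩

lemma continuous_profileGradient (hn : 2 ≤ n) (hψ : IsCartanHadamardModel ψ) (hp : 1 < p)
    (hq : 0 < q) (h : ∀ R, IsPositiveProfile (modelWeight n ψ) p q α R f) :
    Continuous (profileGradient n ψ p q f) := by
  have w := hψ.isRadialWeight hn
  have hγ : 1 / (p - 1) ≠ 0 := by have := sub_pos.2 hp; positivity
  refine continuous_radialField ((h 0).continuous_rpow_flux w hp hq).neg ?_
  rw [Pi.neg_apply, w.radialFlux_of_nonpos _ le_rfl, Real.zero_rpow hγ, neg_zero]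

variable [NeZero n]

lemma isLocSobolevBounded_profile (hn : 2 ≤ n) (hψ : IsCartanHadamardModel ψ) (hp : 1 < p)
    (hq : 0 < q) (h : ∀ R, IsPositiveProfile (modelWeight n ψ) p q α R f) :
    IsLocSobolevBounded n ψ p (fun x => f ‖x‖) (profileGradient n ψ p q f) := by
  have hu : Continuous fun x : EuclideanSpace ℝ (Fin n) => f ‖x‖ :=
    (h 0).continuous.comp continuous_norm
  have hX := continuous_profileGradient hn hψ hp hq h
  have hfd := hasFDerivAt_profile hn hψ hp hq h
  refine ⟨fun K hK => memLp_modelVolume_of_continuous hψ hu hK,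
    fun K hK => memLp_modelVolume_of_continuous hψ hu hK, fun φ hφ hφc v => ?_,
    hX.aestronglyMeasurable, fun K hK => memLp_modelVolume_of_continuous hψ ?_ hK⟩
  · have hcont : Continuous fun x => inner ℝ (profileGradient n ψ p q f x) v :=
      hX.inner continuous_const
    obtain ⟨C, hC⟩ := hφc.isCompact.exists_bound_of_continuousOn hcont.continuousOn
    have h1 := (integral_mul_fderiv_eq_neg (μ := volume) (w := fun x => f ‖x‖)
      (fun x => (hfd x).differentiableAt) hφ hφc v (C := C) (ae_of_all _ fun x hx => by
        rw [(hfd x).fderiv]; exact hC x hx)).2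
    rw [h1]
    congr 1
    refine integral_congr_ae (ae_of_all _ fun x => ?_)
    simp only
    rw [(hfd x).fderiv, profileGradient, modelMetric_smul_self, innerSL_apply_apply,
      real_inner_smul_left]
  · have : (fun x => modelNorm n ψ x (profileGradient n ψ p q f x)) =
        fun x => ‖profileGradient n ψ p q f x‖ := by
      funext x
      rw [profileGradient, modelNorm_smul_self, norm_smul, Real.norm_eq_abs]
    rw [this]
    exact hX.norm

/-- The flux `∫₀ʳ ψ^{n-1} f^q` divided by `r ^ n`, extended to the pole. -/
noncomputable def fluxField (n : ℕ) (ψ : ℝ → ℝ) (q : ℝ) (f : ℝ → ℝ) (r : ℝ) : ℝ :=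
  if 0 < r then (∫ t in (0 : ℝ)..r, modelWeight n ψ t * f t ^ q) / r ^ n else f 0 ^ q / n

omit [NeZero n] in
lemma hasDerivAt_integral_modelWeight (hn : 2 ≤ n) (hψ : IsCartanHadamardModel ψ)
    {b : ℝ → ℝ} (hb : Continuous b) (r : ℝ) :
    HasDerivAt (fun r => ∫ t in (0 : ℝ)..r, modelWeight n ψ t * b t) (modelWeight n ψ r * b r) r :=
  (((hψ.isRadialWeight hn).continuous.mul hb).integral_hasStrictDerivAt 0 r).hasDerivAt

-- With `M = fluxField n ψ q f`, the formula says `n M + r M' = (ψ/r)^(n-1) f^q`, whose left side is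
-- the Euclidean divergence of the field `M(r) x`.
omit [NeZero n] in
lemma hasDerivAt_fluxField (hn : 2 ≤ n) (hψ : IsCartanHadamardModel ψ) (hq : 0 < q)
    (hf : Continuous f) {r : ℝ} (hr : 0 < r) :
    HasDerivAt (fluxField n ψ q f)
      ((radialDensity n ψ r * f r ^ q - n * fluxField n ψ q f r) / r) r := by
  have h1 := (hasDerivAt_integral_modelWeight hn hψ (b := fun t => f t ^ q)
    ((Real.continuous_rpow_const hq.le).comp hf) r).div
      (hasDerivAt_pow n r) (pow_pos hr n).ne'
  refine (h1.congr_of_eventuallyEq ?_).congr_deriv ?_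
  · filter_upwards [Ioi_mem_nhds hr] with s hs
    rw [fluxField, if_pos (mem_Ioi.1 hs)]
    rfl
  · rw [fluxField, if_pos hr, radialDensity]
    obtain ⟨k, rfl⟩ : ∃ k, n = k + 1 := ⟨n - 1, by omega⟩
    simp only [Nat.add_sub_cancel]
    field_simp
    ring

/-- L'Hôpital's rule, the quotient of derivatives being `(ψ/r)^(n-1) f^q / n` with `ψ(r)/r → 1`.
This explains the value chosen for `fluxField` at the pole. -/
lemma tendsto_fluxField (hn : 2 ≤ n) (hψ : IsCartanHadamardModel ψ) (hq : 0 < q)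
    (hf : Continuous f) : Tendsto (fluxField n ψ q f) (𝓝[>] 0) (𝓝 (f 0 ^ q / n)) := by
  have hn0 : (n : ℝ) ≠ 0 := NeZero.ne _
  have hfq : Continuous fun t => f t ^ q := (Real.continuous_rpow_const hq.le).comp hf
  have hI := hasDerivAt_integral_modelWeight hn hψ hfq
  have h1 : Tendsto (fun r => (∫ t in (0 : ℝ)..r, modelWeight n ψ t * f t ^ q) / r ^ n) (𝓝[>] 0)
      (𝓝 (f 0 ^ q / n)) := by
    refine HasDerivAt.lhopital_zero_nhdsGT (f' := fun r => modelWeight n ψ r * f r ^ q)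
      (g' := fun r => n * r ^ (n - 1)) (Eventually.of_forall hI)
      (Eventually.of_forall fun r => hasDerivAt_pow n r) ?_ ?_ ?_ ?_
    · filter_upwards [self_mem_nhdsWithin] with r hr
      have : 0 < r := hr
      positivity
    · simpa using (hI 0).continuousAt.tendsto.mono_left nhdsWithin_le_nhds
    · have : Continuous fun r : ℝ => r ^ n := by fun_prop
      simpa [zero_pow (NeZero.ne n)] using
        (this.tendsto 0).mono_left (nhdsWithin_le_nhds (s := Ioi 0))
    · have h2 := ((tendsto_radialDensity (n := n) hψ).mul
        ((hfq.tendsto 0).mono_left nhdsWithin_le_nhds)).div_const (n : ℝ)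
      rw [one_mul] at h2
      refine h2.congr' ?_
      filter_upwards [self_mem_nhdsWithin] with r hr
      have : 0 < r := hr
      rw [radialDensity]
      field_simp
  refine h1.congr' ?_
  filter_upwards [self_mem_nhdsWithin] with r hr
  rw [fluxField, if_pos (mem_Ioi.1 hr)]

lemma continuousOn_fluxField (hn : 2 ≤ n) (hψ : IsCartanHadamardModel ψ) (hq : 0 < q)
    (hf : Continuous f) : ContinuousOn (fluxField n ψ q f) (Ici 0) := by
  intro r hr
  rcases (mem_Ici.1 hr).eq_or_lt with rfl | h0
  · rw [← continuousWithinAt_Ioi_iff_Ici, ContinuousWithinAt]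
    have : fluxField n ψ q f 0 = f 0 ^ q / n := if_neg (lt_irrefl _)
    rw [this]
    exact tendsto_fluxField hn hψ hq hf
  · exact (hasDerivAt_fluxField hn hψ hq hf h0).continuousAt.continuousWithinAt

/-- Divergence of the flux field, tested against `φ`. -/
lemma integral_fluxField_mul_fderiv (hn : 2 ≤ n) (hψ : IsCartanHadamardModel ψ) (hq : 0 < q)
    (hf : Continuous f) {φ : EuclideanSpace ℝ (Fin n) → ℝ} (hφ : ContDiff ℝ ∞ φ)
    (hφc : HasCompactSupport φ) :
    ∫ x, fluxField n ψ q f ‖x‖ * fderiv ℝ φ x x =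
      - ∫ x, radialDensity n ψ ‖x‖ * (f ‖x‖ ^ q * φ x) := by
  set e : Fin n → EuclideanSpace ℝ (Fin n) := fun i => EuclideanSpace.single i 1 with he
  set w : Fin n → EuclideanSpace ℝ (Fin n) → ℝ :=
    fun i y => fluxField n ψ q f ‖y‖ * inner ℝ (e i) y with hw
  have hMc : Continuous fun x : EuclideanSpace ℝ (Fin n) => fluxField n ψ q f ‖x‖ :=
    (continuousOn_fluxField hn hψ hq hf).comp_continuous continuous_norm norm_nonneg
  have hfq : Continuous fun x : EuclideanSpace ℝ (Fin n) => f ‖x‖ ^ q :=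
    (Real.continuous_rpow_const hq.le).comp (hf.comp continuous_norm)
  have hwd : ∀ i, Differentiable ℝ (w i) := by
    intro i x
    rcases eq_or_ne x 0 with rfl | hx
    · exact (hasFDerivAt_mul_inner_zero hMc.continuousAt (e i)).differentiableAt
    · exact (hasFDerivAt_comp_norm_mul_inner hx
        (hasDerivAt_fluxField hn hψ hq hf (norm_pos_iff.2 hx)) (e i)).differentiableAt
  obtain ⟨R, hR, hKR⟩ := hφc.isCompact.isBounded.subset_closedBall_lt 0
    (0 : EuclideanSpace ℝ (Fin n))
  obtain ⟨C₁, hC₁⟩ := hφc.isCompact.exists_bound_of_continuousOn hMc.continuousOn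
  obtain ⟨C₂, hC₂⟩ := hφc.isCompact.exists_bound_of_continuousOn hfq.continuousOn
  have hbd : ∀ i, ∀ᵐ x : EuclideanSpace ℝ (Fin n), x ∈ tsupport φ → |fderiv ℝ (w i) x (e i)| ≤
      C₁ + ((ψ R / R) ^ (n - 1) * C₂ + n * C₁) := by
    intro i
    filter_upwards [Measure.ae_ne volume (0 : EuclideanSpace ℝ (Fin n))] with x hx hxs
    have hr : 0 < ‖x‖ := norm_pos_iff.2 hx
    have hxR : ‖x‖ ≤ R := mem_closedBall_zero_iff.1 (hKR hxs)
    have hei : ‖e i‖ = 1 := by simp [he]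
    rw [(hasFDerivAt_comp_norm_mul_inner hx
        (hasDerivAt_fluxField hn hψ hq hf (norm_pos_iff.2 hx)) (e i)).fderiv]
    simp only [add_apply, smul_apply, innerSL_apply_apply,
      smul_eq_mul, real_inner_self_eq_norm_sq, hei]
    set k := radialDensity n ψ ‖x‖ * f ‖x‖ ^ q - n * fluxField n ψ q f ‖x‖ with hk
    have hk1 : |k| ≤ (ψ R / R) ^ (n - 1) * C₂ + n * C₁ := by
      refine (abs_sub _ _).trans (add_le_add ?_ ?_)
      · rw [abs_mul, abs_of_nonneg (radialDensity_nonneg hψ hr.le)]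
        exact mul_le_mul (radialDensity_le hψ hr hxR) (hC₂ x hxs) (abs_nonneg _)
          (pow_nonneg (div_nonneg (hψ.nonneg hR.le) hR.le) _)
      · rw [abs_mul, abs_of_nonneg (Nat.cast_nonneg n)]
        exact mul_le_mul_of_nonneg_left (hC₁ x hxs) (Nat.cast_nonneg n)
    refine (abs_add_le _ _).trans (add_le_add ?_ ?_)
    · simpa using hC₁ x hxs
    · have h1 : |inner ℝ (e i) x| ≤ ‖x‖ := by
        simpa [hei] using abs_real_inner_le_norm (e i) x
      have h2 : |inner ℝ x (e i)| ≤ ‖x‖ := by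
        simpa [hei] using abs_real_inner_le_norm x (e i)
      rw [abs_mul, abs_mul, abs_div, abs_div, abs_norm]
      calc |inner ℝ (e i) x| * (|k| / ‖x‖ / ‖x‖ * |inner ℝ x (e i)|)
          ≤ ‖x‖ * (|k| / ‖x‖ / ‖x‖ * ‖x‖) := by gcongr
        _ = |k| := by field_simp
        _ ≤ _ := hk1
  have hibp := fun i => integral_mul_fderiv_eq_neg (μ := volume) (hwd i) hφ hφc (e i) (hbd i)
  -- Splitting `dφ(x)` into coordinates allows integration by parts in each component of the field
  -- separately.
  have h1 : ∀ x, fluxField n ψ q f ‖x‖ * fderiv ℝ φ x x =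
      ∑ i, w i x * fderiv ℝ φ x (e i) := by
    intro x
    rw [← sum_inner_single_mul x (fderiv ℝ φ x), Finset.mul_sum]
    exact Finset.sum_congr rfl fun i _ => by simp only [hw, he]; ring
  simp_rw [h1]
  rw [integral_finsetSum]
  · simp_rw [fun i => (hibp i).2]
    rw [Finset.sum_neg_distrib, ← integral_finsetSum _ fun i _ => (hibp i).1]
    congr 1
    refine integral_congr_ae ?_
    filter_upwards [Measure.ae_ne volume (0 : EuclideanSpace ℝ (Fin n))] with x hx
    rw [← Finset.sum_mul, sum_fderiv_comp_norm_mul_inner hx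
      (hasDerivAt_fluxField hn hψ hq hf (norm_pos_iff.2 hx))]
    have hr : ‖x‖ ≠ 0 := norm_ne_zero_iff.2 hx
    field_simp
    ring
  · intro i _
    exact ((hwd i).continuous.mul ((hφ.continuous_fderiv (by simp)).clm_apply
      continuous_const)).integrable_of_hasCompactSupport
        (hφc.fderiv_apply (𝕜 := ℝ) (e i)).mul_left

/-- A positive solution of the radial equation defines a radial weak solution. -/
theorem isRadialSolution_of_isPositiveProfile (hn : 2 ≤ n) (hψ : IsCartanHadamardModel ψ)
    (hp : 1 < p) (hq : 0 < q) (h : ∀ R, IsPositiveProfile (modelWeight n ψ) p q α R f) :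
    IsRadialSolution n ψ p q (fun x => f ‖x‖) := by
  have w := hψ.isRadialWeight hn
  have hp1 : 0 < p - 1 := sub_pos.2 hp
  refine ⟨⟨ae_of_all _ fun x => (h ‖x‖).pos _ ⟨norm_nonneg x, le_rfl⟩, _,
    isLocSobolevBounded_profile hn hψ hp hq h, fun φ hφ hφc => ?_⟩, f, ae_of_all _ fun x => rfl⟩
  rw [integral_modelVolume hψ, integral_modelVolume hψ]
  have h1 := integral_fluxField_mul_fderiv hn hψ hq (h 0).continuous hφ hφc
  rw [eq_neg_iff_add_eq_zero, add_comm, ← eq_neg_iff_add_eq_zero] at h1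
  rw [h1, ← integral_neg]
  -- Pointwise, the weighted `p`-flux `(ψ/r)^(n-1) |∇u|^(p-2) ∇u` equals `-fluxField · x`, because
  -- `|f'|^(p-2) |f'| = y` and `a y = ∫₀ʳ a f^q`.
  refine integral_congr_ae ?_
  filter_upwards [Measure.ae_ne volume (0 : EuclideanSpace ℝ (Fin n))] with x hx
  have hr : 0 < ‖x‖ := norm_pos_iff.2 hx
  set y := radialFlux (modelWeight n ψ) (fun t => f t ^ q) ‖x‖ with hy
  have hy0 : 0 < y := (h ‖x‖).flux_pos w hq ⟨hr, le_rfl⟩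
  have hyγ : 0 < y ^ (1 / (p - 1)) := Real.rpow_pos_of_pos hy0 _
  have e1 : (y ^ (1 / (p - 1))) ^ (p - 2) * y ^ (1 / (p - 1)) = y := by
    rw [← Real.rpow_add_one hyγ.ne', ← Real.rpow_mul hy0.le]
    rw [show 1 / (p - 1) * (p - 2 + 1) = 1 by field_simp; ring, Real.rpow_one]
  have e2 : modelWeight n ψ ‖x‖ * y = ∫ t in (0 : ℝ)..‖x‖, modelWeight n ψ t * f t ^ q :=
    w.mul_radialFlux _ hr
  rw [profileGradient, modelNorm_smul_self, map_smul, ← hy, abs_div, abs_neg, abs_norm,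
    abs_of_pos hyγ, div_mul_cancel₀ _ hr.ne', fluxField, if_pos hr, ← e2, smul_eq_mul,
    radialDensity]
  nth_rewrite 3 [← e1]
  obtain ⟨k, rfl⟩ : ∃ k, n = k + 1 := ⟨n - 1, by omega⟩
  simp only [Nat.add_sub_cancel]
  field_simp
  ring

end Existence

/-! ### Mollification by radial kernels; weak gradients of radial functions. -/

section Mollify

variable {n : ℕ}

/-- A smooth radial bump supported in the unit ball. -/
noncomputable def radialBump (n : ℕ) (x : EuclideanSpace ℝ (Fin n)) : ℝ :=
  Real.smoothTransition (1 - ‖x‖ ^ 2)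

lemma contDiff_radialBump : ContDiff ℝ ∞ (radialBump n) :=
  (Real.smoothTransition.contDiff (n := ⊤)).comp (contDiff_const.sub (contDiff_norm_sq ℝ))

lemma radialBump_nonneg (x : EuclideanSpace ℝ (Fin n)) : 0 ≤ radialBump n x :=
  Real.smoothTransition.nonneg _

lemma radialBump_le_one (x : EuclideanSpace ℝ (Fin n)) : radialBump n x ≤ 1 :=
  Real.smoothTransition.le_one _

lemma radialBump_eq_zero {x : EuclideanSpace ℝ (Fin n)} (hx : 1 ≤ ‖x‖) : radialBump n x = 0 :=
  Real.smoothTransition.zero_of_nonpos (by nlinarith)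

lemma hasCompactSupport_radialBump : HasCompactSupport (radialBump n) :=
  HasCompactSupport.intro (isCompact_closedBall 0 1) fun x hx =>
    radialBump_eq_zero (le_of_lt (by simpa using hx))

lemma integral_radialBump_pos : 0 < ∫ x, radialBump n x := by
  refine contDiff_radialBump.continuous.integral_pos_of_hasCompactSupport_nonneg_nonzero
    hasCompactSupport_radialBump radialBump_nonneg (x := 0) ?_
  simp [radialBump]

/-- The rescaled radial bump, of integral one. -/
noncomputable def radialKernel (n : ℕ) (δ : ℝ) (x : EuclideanSpace ℝ (Fin n)) : ℝ :=
  (δ ^ n * ∫ y, radialBump n y)⁻¹ * radialBump n (δ⁻¹ • x)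

lemma contDiff_radialKernel (δ : ℝ) : ContDiff ℝ ∞ (radialKernel n δ) :=
  contDiff_const.mul (contDiff_radialBump.comp (contDiff_const_smul _))

lemma radialKernel_eq_zero {δ : ℝ} (hδ : 0 < δ) {x : EuclideanSpace ℝ (Fin n)} (hx : δ ≤ ‖x‖) :
    radialKernel n δ x = 0 := by
  rw [radialKernel, radialBump_eq_zero, mul_zero]
  rwa [norm_smul, norm_inv, Real.norm_of_nonneg hδ.le, ← div_eq_inv_mul, one_le_div hδ]

lemma hasCompactSupport_radialKernel {δ : ℝ} (hδ : 0 < δ) :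
    HasCompactSupport (radialKernel n δ) :=
  HasCompactSupport.intro (isCompact_closedBall 0 δ) fun x hx =>
    radialKernel_eq_zero hδ (le_of_lt (by simpa using hx))

lemma radialKernel_congr {δ : ℝ} {x y : EuclideanSpace ℝ (Fin n)} (h : ‖x‖ = ‖y‖) :
    radialKernel n δ x = radialKernel n δ y := by
  simp [radialKernel, radialBump, norm_smul, h]

lemma integral_radialKernel {δ : ℝ} (hδ : 0 < δ) : ∫ x, radialKernel n δ x = 1 := by
  simp only [radialKernel]
  rw [integral_const_mul, Measure.integral_comp_smul, finrank_euclideanSpace_fin]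
  have := integral_radialBump_pos (n := n)
  rw [inv_pow, inv_inv, abs_of_pos (by positivity), smul_eq_mul, inv_mul_cancel₀ (by positivity)]

/-- Both sides scale like `δ^(-n)`; this is the uniform domination that Lebesgue differentiation
requires of an approximate identity. -/
lemma abs_radialKernel_le {δ : ℝ} (hδ : 0 < δ) (x z : EuclideanSpace ℝ (Fin n)) :
    |radialKernel n δ x| ≤ (volume.real (Metric.ball (0 : EuclideanSpace ℝ (Fin n)) 1) /
      ∫ y, radialBump n y) / volume.real (Metric.closedBall z δ) := by
  have h1 := integral_radialBump_pos (n := n)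
  have h2 : 0 < volume.real (Metric.ball (0 : EuclideanSpace ℝ (Fin n)) 1) :=
    ENNReal.toReal_pos (Metric.measure_ball_pos _ _ one_pos).ne' measure_ball_lt_top.ne
  rw [Measure.addHaar_real_closedBall _ _ hδ.le, finrank_euclideanSpace_fin, radialKernel, abs_mul,
    abs_of_nonneg (radialBump_nonneg _), abs_of_pos (by positivity)]
  calc _ ≤ (δ ^ n * ∫ y, radialBump n y)⁻¹ * 1 := by
        gcongr
        exact radialBump_le_one _
    _ = _ := by field_simp

/-- Convolution with the radial kernel. -/
noncomputable def radialMollify {F : Type*} [NormedAddCommGroup F] [NormedSpace ℝ F] (δ : ℝ)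
    (f : EuclideanSpace ℝ (Fin n) → F) (x : EuclideanSpace ℝ (Fin n)) : F :=
  ∫ y, radialKernel n δ (x - y) • f y

/-- Convergence holds at every Lebesgue point, since the kernels have integral one, live on
shrinking balls and are dominated by multiples of normalised indicators of these balls. -/
lemma ae_tendsto_radialMollify {F : Type*} [NormedAddCommGroup F] [NormedSpace ℝ F]
    [CompleteSpace F] {f : EuclideanSpace ℝ (Fin n) → F} (hf : LocallyIntegrable f) :
    ∀ᵐ x, Tendsto (fun j : ℕ => radialMollify (1 / ((j : ℝ) + 1)) f x) atTop (𝓝 (f x)) := by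
  filter_upwards [(Besicovitch.vitaliFamily (volume : Measure
    (EuclideanSpace ℝ (Fin n)))).ae_tendsto_average_norm_sub hf] with x₀ h₀
  have hδ : ∀ j : ℕ, 0 < 1 / ((j : ℝ) + 1) := fun j => by positivity
  have hφ' : Tendsto (fun j : ℕ => 1 / ((j : ℝ) + 1)) atTop (𝓝[>] 0) :=
    tendsto_nhdsWithin_iff.2 ⟨tendsto_one_div_add_atTop_nhds_zero_nat, Eventually.of_forall hδ⟩
  have := (h₀.comp (Besicovitch.tendsto_filterAt volume x₀)).comp hφ'
  refine tendsto_integral_smul_of_tendsto_average_norm_sub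
    (volume.real (Metric.ball (0 : EuclideanSpace ℝ (Fin n)) 1) / ∫ y, radialBump n y) this ?_ ?_
    ?_ ?_
  · exact Eventually.of_forall fun j => hf.integrableOn_isCompact (isCompact_closedBall _ _)
  · refine tendsto_const_nhds.congr fun j => ?_
    rw [integral_sub_left_eq_self (fun y => radialKernel n (1 / ((j : ℝ) + 1)) y),
      integral_radialKernel (hδ j)]
  · refine Eventually.of_forall fun j y hy => ?_
    by_contra hcon
    refine hy (radialKernel_eq_zero (hδ j) ?_)
    rw [Metric.mem_closedBall, dist_comm, dist_eq_norm, not_le] at hcon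
    exact hcon.le
  · exact Eventually.of_forall fun j y => abs_radialKernel_le (hδ j) _ _

/-- The derivative falls on the kernel, and the translated kernel `t ↦ radialKernel n δ (x - t)` is
an admissible test function; the two minus signs, from the reflection and from the weak derivative,
cancel. -/
lemma hasFDerivAt_radialMollify {u : EuclideanSpace ℝ (Fin n) → ℝ}
    {ξ : EuclideanSpace ℝ (Fin n) → EuclideanSpace ℝ (Fin n)} (hu : LocallyIntegrable u)
    (hξ : LocallyIntegrable ξ)
    (hw : ∀ φ : EuclideanSpace ℝ (Fin n) → ℝ, ContDiff ℝ ∞ φ → HasCompactSupport φ →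
      ∀ v, ∫ x, u x * fderiv ℝ φ x v = - ∫ x, inner ℝ (ξ x) v * φ x)
    {δ : ℝ} (hδ : 0 < δ) (x : EuclideanSpace ℝ (Fin n)) :
    HasFDerivAt (radialMollify δ u) (innerSL ℝ (radialMollify δ ξ x)) x := by
  have hη := contDiff_radialKernel (n := n) δ
  have hηc := hasCompactSupport_radialKernel (n := n) hδ
  have h1 := hηc.hasFDerivAt_convolution_right (ContinuousLinearMap.mul ℝ ℝ) hu
    (hη.of_le (by simp)) x
  have e : radialMollify δ u = convolution u (radialKernel n δ) (ContinuousLinearMap.mul ℝ ℝ)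
      volume := by
    funext y
    simp only [radialMollify, convolution_def, ContinuousLinearMap.mul_apply', smul_eq_mul]
    exact integral_congr_ae (ae_of_all _ fun t => mul_comm _ _)
  rw [e]
  refine h1.congr_fderiv ?_
  ext v
  rw [convolution_precompR_apply _ hu (hηc.fderiv (𝕜 := ℝ)) (hη.continuous_fderiv (by simp)),
    convolution_def, innerSL_apply_apply]
  have hφ : ContDiff ℝ ∞ fun t => radialKernel n δ (x - t) :=
    hη.comp (contDiff_const.sub contDiff_id)
  have hφc : HasCompactSupport fun t => radialKernel n δ (x - t) :=
    hηc.comp_homeomorph (Homeomorph.subLeft x)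
  have h2 := hw _ hφ hφc v
  have h3 : ∀ t, fderiv ℝ (fun t => radialKernel n δ (x - t)) t v =
      - fderiv ℝ (radialKernel n δ) (x - t) v := by
    intro t
    have hd := ((hη.differentiable (by simp)) (x - t)).hasFDerivAt.comp t
      ((hasFDerivAt_id (𝕜 := ℝ) t).const_sub x)
    have := hd.fderiv
    simp only [Function.comp_def] at this
    rw [this]
    simp
  simp only [h3, mul_neg, integral_neg, neg_inj] at h2
  simp only [ContinuousLinearMap.mul_apply']
  rw [h2, radialMollify]
  have hint : Integrable fun y => radialKernel n δ (x - y) • ξ y :=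
    hξ.integrable_smul_left_of_hasCompactSupport hφ.continuous hφc
  rw [real_inner_comm, ← innerSL_apply_apply ℝ, ← ContinuousLinearMap.integral_comp_comm _ hint]
  refine integral_congr_ae (ae_of_all _ fun y => ?_)
  simp [real_inner_comm, mul_comm]

/-- The reflection exchanging `x` and `y` is an isometry fixing the origin; it preserves the
measure, the kernel and the profile of `u`. -/
lemma radialMollify_congr {u : EuclideanSpace ℝ (Fin n) → ℝ} {g : ℝ → ℝ}
    (hug : ∀ᵐ x, u x = g ‖x‖) (δ : ℝ) {x y : EuclideanSpace ℝ (Fin n)} (hxy : ‖x‖ = ‖y‖) :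
    radialMollify δ u x = radialMollify δ u y := by
  have e : ∀ z, radialMollify δ u z = ∫ t, radialKernel n δ (z - t) * g ‖t‖ := fun z => by
    refine integral_congr_ae ?_
    filter_upwards [hug] with t ht
    rw [ht, smul_eq_mul]
  set T := Submodule.reflection (ℝ ∙ (x - y))ᗮ with hT
  have hTx : T x = y := Submodule.reflection_sub hxy
  rw [e, e y, ← (T.measurePreserving).integral_comp T.toHomeomorph.measurableEmbedding
    fun t => radialKernel n δ (y - t) * g ‖t‖]
  refine integral_congr_ae (ae_of_all _ fun t => ?_)
  simp only
  rw [← hTx, ← map_sub, T.norm_map, radialKernel_congr (T.norm_map (x - t))]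

/-- The weak gradient of a radial function is radial. -/
lemma exists_radial_gradient [NeZero n] {u : EuclideanSpace ℝ (Fin n) → ℝ}
    {ξ : EuclideanSpace ℝ (Fin n) → EuclideanSpace ℝ (Fin n)} {g : ℝ → ℝ}
    (hug : ∀ᵐ x, u x = g ‖x‖) (hu : LocallyIntegrable u) (hξ : LocallyIntegrable ξ)
    (hw : ∀ φ : EuclideanSpace ℝ (Fin n) → ℝ, ContDiff ℝ ∞ φ → HasCompactSupport φ →
      ∀ v, ∫ x, u x * fderiv ℝ φ x v = - ∫ x, inner ℝ (ξ x) v * φ x) :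
    ∃ κ : ℝ → ℝ, ∀ᵐ x, ξ x = κ ‖x‖ • x := by
  set e : EuclideanSpace ℝ (Fin n) := EuclideanSpace.single 0 1 with he
  have hen : ‖e‖ = 1 := by simp [he]
  set c : ℕ → ℝ → ℝ := fun j r => inner ℝ (radialMollify (1 / ((j : ℝ) + 1)) ξ (r • e)) e / r
    with hc
  -- The mollified `u` is smooth and radial, so it is a function of `‖x‖` read off on the ray
  -- through `e`, and its gradient points along `x`. The coefficient then passes to the almost
  -- everywhere limit.
  have key : ∀ j : ℕ, ∀ x, x ≠ 0 → radialMollify (1 / ((j : ℝ) + 1)) ξ x = c j ‖x‖ • x := by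
    intro j x hx
    have hδ : 0 < 1 / ((j : ℝ) + 1) := by positivity
    have hd := hasFDerivAt_radialMollify hu hξ hw hδ
    have h1 : HasDerivAt (fun r : ℝ => radialMollify (1 / ((j : ℝ) + 1)) u (r • e))
        (inner ℝ (radialMollify (1 / ((j : ℝ) + 1)) ξ (‖x‖ • e)) e) ‖x‖ := by
      have := (hd (‖x‖ • e)).comp_hasDerivAt ‖x‖ ((hasDerivAt_id ‖x‖).smul_const e)
      simpa [Function.comp_def] using this
    have h2 := h1.hasFDerivAt_comp_norm hx
    have h3 : (fun y : EuclideanSpace ℝ (Fin n) =>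
        radialMollify (1 / ((j : ℝ) + 1)) u (‖y‖ • e)) = radialMollify (1 / ((j : ℝ) + 1)) u := by
      funext y
      exact radialMollify_congr hug _ (by rw [norm_smul, hen, norm_norm, mul_one])
    rw [h3] at h2
    have h4 := (hd x).unique h2
    rw [← map_smul] at h4
    exact innerSL_inj.1 h4
  refine ⟨fun r => limUnder atTop fun j => c j r, ?_⟩
  filter_upwards [ae_tendsto_radialMollify hξ,
    Measure.ae_ne volume (0 : EuclideanSpace ℝ (Fin n))] with x hx hx0
  have hr : ‖x‖ ^ 2 ≠ 0 := pow_ne_zero _ (norm_ne_zero_iff.2 hx0)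
  have h1 : Tendsto (fun j => c j ‖x‖) atTop (𝓝 (inner ℝ (ξ x) x / ‖x‖ ^ 2)) := by
    refine ((hx.inner (tendsto_const_nhds (x := x))).div_const (‖x‖ ^ 2)).congr fun j => ?_
    rw [key j x hx0, real_inner_smul_left, real_inner_self_eq_norm_sq, mul_div_cancel_right₀ _ hr]
  have h2 : Tendsto (fun j : ℕ => radialMollify (1 / ((j : ℝ) + 1)) ξ x) atTop
      (𝓝 ((inner ℝ (ξ x) x / ‖x‖ ^ 2) • x)) :=
    (h1.smul_const x).congr fun j => (key j x hx0).symm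
  rw [h1.limUnder_eq]
  exact tendsto_nhds_unique hx h2

/-- A function with vanishing weak gradient is constant. -/
lemma ae_eq_const_of_weak_gradient_zero {u : EuclideanSpace ℝ (Fin n) → ℝ}
    (hu : LocallyIntegrable u)
    (hw : ∀ φ : EuclideanSpace ℝ (Fin n) → ℝ, ContDiff ℝ ∞ φ → HasCompactSupport φ →
      ∀ v, ∫ x, u x * fderiv ℝ φ x v = 0) : ∃ C, ∀ᵐ x, u x = C := by
  have hd : ∀ j : ℕ, ∀ x, HasFDerivAt (radialMollify (1 / ((j : ℝ) + 1)) u)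
      (0 : EuclideanSpace ℝ (Fin n) →L[ℝ] ℝ) x := by
    intro j x
    have := hasFDerivAt_radialMollify (ξ := fun _ => 0) hu (locallyIntegrable_const 0)
      (fun φ hφ hφc v => by simpa using hw φ hφ hφc v) (δ := 1 / ((j : ℝ) + 1)) (by positivity) x
    simpa [radialMollify] using this
  have hconst : ∀ (j : ℕ) x, radialMollify (1 / ((j : ℝ) + 1)) u x =
      radialMollify (1 / ((j : ℝ) + 1)) u 0 := fun j x =>
    is_const_of_fderiv_eq_zero (𝕜 := ℝ) (fun y => (hd j y).differentiableAt)
      (fun y => (hd j y).fderiv) x 0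
  refine ⟨limUnder atTop fun j : ℕ => radialMollify (1 / ((j : ℝ) + 1)) u 0, ?_⟩
  filter_upwards [ae_tendsto_radialMollify hu] with x hx
  simp_rw [hconst _ x] at hx
  exact hx.limUnder_eq.symm

end Mollify

/-! ### Null sets and measurability in polar coordinates. -/

section Polar

variable {n : ℕ}

lemma ae_polar_iff {Q : Metric.sphere (0 : EuclideanSpace ℝ (Fin n)) 1 × Ioi (0 : ℝ) → Prop} :
    (∀ᵐ x : ({0}ᶜ : Set (EuclideanSpace ℝ (Fin n))) ∂(volume.comap Subtype.val),
      Q (homeomorphUnitSphereProd (EuclideanSpace ℝ (Fin n)) x)) ↔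
    ∀ᵐ y ∂((volume : Measure (EuclideanSpace ℝ (Fin n))).toSphere.prod (Measure.volumeIoiPow
      (Module.finrank ℝ (EuclideanSpace ℝ (Fin n)) - 1))), Q y := by
  rw [← (Measure.measurePreserving_homeomorphUnitSphereProd
    (volume : Measure (EuclideanSpace ℝ (Fin n)))).map_eq,
    (Homeomorph.measurableEmbedding _).ae_map_iff]

lemma ae_volumeIoiPow_iff {k : ℕ} {P : ℝ → Prop} :
    (∀ᵐ r : Ioi (0 : ℝ) ∂(Measure.volumeIoiPow k), P r) ↔ ∀ᵐ r ∂(volume.restrict (Ioi (0 : ℝ))), P r := by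
  rw [ae_restrict_iff_subtype measurableSet_Ioi, Measure.volumeIoiPow,
    ae_withDensity_iff (by fun_prop)]
  refine eventually_congr (ae_of_all _ fun r => ?_)
  have : ENNReal.ofReal ((r : ℝ) ^ k) ≠ 0 := by
    rw [Ne, ENNReal.ofReal_eq_zero, not_le]
    exact pow_pos r.2 k
  simp [this]

variable [NeZero n]

/-- A property of the radius holds almost everywhere iff it does so on `(0, ∞)`. -/
lemma ae_norm_iff {P : ℝ → Prop} :
    (∀ᵐ x : EuclideanSpace ℝ (Fin n), P ‖x‖) ↔ ∀ᵐ r ∂(volume.restrict (Ioi (0 : ℝ))), P r := by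
  rw [← ae_volumeIoiPow_iff (k := Module.finrank ℝ (EuclideanSpace ℝ (Fin n)) - 1)]
  rw [← restrict_compl_singleton (μ := (volume : Measure (EuclideanSpace ℝ (Fin n)))) 0,
    ae_restrict_iff_subtype (measurableSet_singleton _).compl]
  have h1 := ae_polar_iff (n := n) (Q := fun y => P (y.2 : ℝ))
  simp only [homeomorphUnitSphereProd_apply_snd_coe] at h1
  rw [h1, ae_iff, ae_iff]
  have h2 : {a : Metric.sphere (0 : EuclideanSpace ℝ (Fin n)) 1 × Ioi (0 : ℝ) | ¬P (a.2 : ℝ)} =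
      univ ×ˢ {r : Ioi (0 : ℝ) | ¬ P r} := by ext; simp
  rw [h2, Measure.prod_prod, mul_eq_zero, or_iff_right]
  rw [Measure.measure_univ_eq_zero]
  exact Measure.toSphere_ne_zero _

/-- A measurable radial function has a measurable profile. -/
lemma exists_measurable_profile {v : EuclideanSpace ℝ (Fin n) → ℝ}
    (hv : AEStronglyMeasurable v) {g : ℝ → ℝ} (hvg : ∀ᵐ x, v x = g ‖x‖) :
    ∃ g₁ : ℝ → ℝ, Measurable g₁ ∧ ∀ᵐ x, v x = g₁ ‖x‖ := by
  obtain ⟨v', hv', hvv'⟩ := hv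
  have h1 : ∀ᵐ x, v' x = g ‖x‖ := by
    filter_upwards [hvg, hvv'] with x h h'
    rw [← h', h]
  have h2 := h1
  rw [← restrict_compl_singleton (μ := (volume : Measure (EuclideanSpace ℝ (Fin n)))) 0,
    ae_restrict_iff_subtype (measurableSet_singleton _).compl] at h2
  have h3 := (ae_polar_iff (n := n) (Q := fun y => v' ((y.2 : ℝ) • (y.1 :
    EuclideanSpace ℝ (Fin n))) = g y.2)).1 (by
      filter_upwards [h2] with x hx
      have hx0 : ‖(x : EuclideanSpace ℝ (Fin n))‖ ≠ 0 := norm_ne_zero_iff.2 x.2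
      rw [homeomorphUnitSphereProd_apply_snd_coe, homeomorphUnitSphereProd_apply_fst_coe,
        smul_smul, mul_inv_cancel₀ hx0, one_smul]
      exact hx)
  have h4 := Measure.ae_ae_of_ae_prod h3
  have : (ae (volume : Measure (EuclideanSpace ℝ (Fin n))).toSphere).NeBot :=
    ae_neBot.2 (Measure.toSphere_ne_zero _)
  -- By Fubini, on almost every ray `v'` agrees with `g` at almost every radius; restricting the
  -- measurable `v'` to one such ray gives the measurable profile.
  obtain ⟨σ, hσ⟩ := h4.exists
  refine ⟨fun r => v' (r • (σ : EuclideanSpace ℝ (Fin n))),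
    hv'.measurable.comp (by fun_prop), ?_⟩
  have h5 := (ae_norm_iff (n := n)).2 ((ae_volumeIoiPow_iff (P := fun r =>
    v' (r • (σ : EuclideanSpace ℝ (Fin n))) = g r)).1 hσ)
  filter_upwards [hvg, h5] with x hx hx'
  rw [hx, hx']

end Polar

/-! ### Euclidean form of the weak gradient. -/

section WeakSolution

variable {n : ℕ} {ψ : ℝ → ℝ}

/-- The Euclidean representative of the covector `g (X, ·)`. -/
noncomputable def flatGradient (n : ℕ) (ψ : ℝ → ℝ)
    (X : EuclideanSpace ℝ (Fin n) → EuclideanSpace ℝ (Fin n))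
    (x : EuclideanSpace ℝ (Fin n)) : EuclideanSpace ℝ (Fin n) :=
  (ψ ‖x‖ / ‖x‖) ^ 2 • X x + ((1 - (ψ ‖x‖ / ‖x‖) ^ 2) * (inner ℝ x (X x) / ‖x‖ ^ 2)) • x

lemma inner_flatGradient {X : EuclideanSpace ℝ (Fin n) → EuclideanSpace ℝ (Fin n)}
    {x : EuclideanSpace ℝ (Fin n)} (hx : x ≠ 0) (v : EuclideanSpace ℝ (Fin n)) :
    inner ℝ (flatGradient n ψ X x) v = modelMetric n ψ x (X x) v := by
  have hr : ‖x‖ ≠ 0 := norm_ne_zero_iff.2 hx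
  rw [flatGradient, modelMetric_of_ne hx, inner_add_left, real_inner_smul_left,
    real_inner_smul_left]
  field_simp
  ring

lemma modelMetric_self_nonneg {x : EuclideanSpace ℝ (Fin n)}
    (v : EuclideanSpace ℝ (Fin n)) : 0 ≤ modelMetric n ψ x v v := by
  rcases eq_or_ne x 0 with rfl | hx
  · simp [modelMetric]
  have hr : 0 < ‖x‖ := norm_pos_iff.2 hx
  rw [modelMetric_of_ne hx]
  have h1 : (inner ℝ x v / ‖x‖) * (inner ℝ x v / ‖x‖) ≤ inner ℝ v v := by
    rw [div_mul_div_comm, div_le_iff₀ (by positivity)]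
    have := real_inner_mul_inner_self_le x v
    rw [real_inner_self_eq_norm_sq x] at this
    nlinarith
  have := mul_nonneg (sq_nonneg (ψ ‖x‖ / ‖x‖)) (sub_nonneg.2 h1)
  nlinarith [mul_self_nonneg (inner ℝ x v / ‖x‖)]

/-- Split `X` into radial and tangential parts `A`, `B` and put `c = ψ(r)/r ≥ 1`: the claim is `A² +
c⁴ B² ≤ c² (A² + c² B²)`. It turns local `L^p` bounds in the metric `g` into Euclidean
integrability. -/
lemma norm_flatGradient_le (hψ : IsCartanHadamardModel ψ)
    {X : EuclideanSpace ℝ (Fin n) → EuclideanSpace ℝ (Fin n)}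
    {x : EuclideanSpace ℝ (Fin n)} (hx : x ≠ 0) :
    ‖flatGradient n ψ X x‖ ≤ ψ ‖x‖ / ‖x‖ * modelNorm n ψ x (X x) := by
  have hr : 0 < ‖x‖ := norm_pos_iff.2 hx
  have hc : 1 ≤ ψ ‖x‖ / ‖x‖ := (one_le_div hr).2 (hψ.self_le hr.le)
  have hM := modelMetric_self_nonneg (n := n) (ψ := ψ) (x := x) (X x)
  rw [← Real.sqrt_sq (norm_nonneg _), modelNorm, ← Real.sqrt_sq (zero_le_one.trans hc),
    ← Real.sqrt_mul (sq_nonneg _)]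
  refine Real.sqrt_le_sqrt ?_
  rw [← real_inner_self_eq_norm_sq, inner_flatGradient hx,
    modelMetric_of_ne hx, modelMetric_of_ne hx, flatGradient]
  set c := ψ ‖x‖ / ‖x‖
  set s := inner ℝ x (X x) with hs
  rw [inner_add_right, real_inner_smul_right, inner_add_right, real_inner_smul_right,
    real_inner_smul_right, real_inner_smul_right, real_inner_self_eq_norm_sq x,
    real_inner_comm x (X x), ← hs]
  have e : c ^ 2 * (s / ‖x‖ * (s / ‖x‖) + c ^ 2 * (inner ℝ (X x) (X x) - s / ‖x‖ * (s / ‖x‖))) -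
      (s / ‖x‖ * ((c ^ 2 * s + (1 - c ^ 2) * (s / ‖x‖ ^ 2) * ‖x‖ ^ 2) / ‖x‖) +
      c ^ 2 * (c ^ 2 * inner ℝ (X x) (X x) + (1 - c ^ 2) * (s / ‖x‖ ^ 2) * s -
        s / ‖x‖ * ((c ^ 2 * s + (1 - c ^ 2) * (s / ‖x‖ ^ 2) * ‖x‖ ^ 2) / ‖x‖))) =
      (c ^ 2 - 1) * (s / ‖x‖) ^ 2 := by
    field_simp
    ring
  have h2 : 0 ≤ (c ^ 2 - 1) * (s / ‖x‖) ^ 2 :=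
    mul_nonneg (by nlinarith) (sq_nonneg _)
  linarith

variable {p q : ℝ} {u : EuclideanSpace ℝ (Fin n) → ℝ}
  {X : EuclideanSpace ℝ (Fin n) → EuclideanSpace ℝ (Fin n)} [NeZero n]

lemma IsLocSobolevBounded.locallyIntegrable (hψ : IsCartanHadamardModel ψ)
    (h : IsLocSobolevBounded n ψ p u X) : LocallyIntegrable u := by
  rw [locallyIntegrable_iff]
  intro K hK
  have : IsFiniteMeasure ((volume : Measure (EuclideanSpace ℝ (Fin n))).restrict K) :=
    ⟨by rw [Measure.restrict_apply_univ]; exact hK.measure_lt_top⟩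
  exact ((h.memLp_top K hK).mono_measure (volume_restrict_le hψ K)).integrable le_top

lemma aestronglyMeasurable_of_modelVolume (hψ : IsCartanHadamardModel ψ) {F : Type*}
    [TopologicalSpace F] {v : EuclideanSpace ℝ (Fin n) → F}
    (h : AEStronglyMeasurable v (modelVolume n ψ)) : AEStronglyMeasurable v :=
  h.mono_ac (Measure.ae_le_iff_absolutelyContinuous.1 (ae_modelVolume hψ).ge)

lemma IsLocSobolevBounded.locallyIntegrable_flatGradient (hψ : IsCartanHadamardModel ψ)
    (hp : 1 < p) (h : IsLocSobolevBounded n ψ p u X) :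
    LocallyIntegrable (flatGradient n ψ X) := by
  have hX := aestronglyMeasurable_of_modelVolume hψ h.aestronglyMeasurable_grad
  have hψm : Measurable fun x : EuclideanSpace ℝ (Fin n) => ψ ‖x‖ / ‖x‖ :=
    (hψ.continuousOn.comp_continuous continuous_norm norm_nonneg).measurable.div measurable_norm
  have hm : AEStronglyMeasurable (flatGradient n ψ X) := by
    have hi : AEStronglyMeasurable fun x => inner ℝ x (X x) :=
      aestronglyMeasurable_id.inner hX
    have hs : AEStronglyMeasurable fun x : EuclideanSpace ℝ (Fin n) =>
        (1 - (ψ ‖x‖ / ‖x‖) ^ 2) * (inner ℝ x (X x) / ‖x‖ ^ 2) :=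
      (measurable_const.sub (hψm.pow_const 2)).aestronglyMeasurable.mul
        (hi.aemeasurable.div (measurable_norm.pow_const 2).aemeasurable).aestronglyMeasurable
    exact ((hψm.pow_const 2).aestronglyMeasurable.smul hX).add (hs.smul aestronglyMeasurable_id)
  rw [locallyIntegrable_iff]
  intro K hK
  have : IsFiniteMeasure ((volume : Measure (EuclideanSpace ℝ (Fin n))).restrict K) :=
    ⟨by rw [Measure.restrict_apply_univ]; exact hK.measure_lt_top⟩
  have h1 := ((h.memLp_grad K hK).mono_measure (volume_restrict_le hψ K)).integrable
    (by rw [← ENNReal.ofReal_one]; exact ENNReal.ofReal_le_ofReal hp.le)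
  obtain ⟨R, hR, hKR⟩ := hK.isBounded.subset_closedBall_lt 0 (0 : EuclideanSpace ℝ (Fin n))
  refine (h1.const_mul (ψ R / R)).mono' hm.restrict ?_
  rw [ae_restrict_iff' hK.measurableSet]
  filter_upwards [Measure.ae_ne volume (0 : EuclideanSpace ℝ (Fin n))] with x hx hxK
  refine (norm_flatGradient_le hψ hx).trans ?_
  exact mul_le_mul_of_nonneg_right (hψ.div_le_div (norm_pos_iff.2 hx)
    (mem_closedBall_zero_iff.1 (hKR hxK))) (Real.sqrt_nonneg _)

lemma IsLocSobolevBounded.integral_mul_fderiv (h : IsLocSobolevBounded n ψ p u X)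
    {φ : EuclideanSpace ℝ (Fin n) → ℝ} (hφ : ContDiff ℝ ∞ φ) (hφc : HasCompactSupport φ)
    (v : EuclideanSpace ℝ (Fin n)) :
    ∫ x, u x * fderiv ℝ φ x v = - ∫ x, inner ℝ (flatGradient n ψ X x) v * φ x := by
  rw [h.isWeakGradient φ hφ hφc v]
  congr 1
  refine integral_congr_ae ?_
  filter_upwards [Measure.ae_ne volume (0 : EuclideanSpace ℝ (Fin n))] with x hx
  rw [inner_flatGradient hx]

end WeakSolution

/-! ### Reduction of the weak equation to the half line. -/

section Converse

/-- The weak form of `W' = -b`, `W (0) = 0`. -/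
lemma ae_eq_neg_integral {W b : ℝ → ℝ} (hW : ∀ R, IntegrableOn W (Ioc 0 R))
    (hb : ∀ R, IntegrableOn b (Ioc 0 R))
    (h : ∀ (η : ℝ → ℝ) (ε R : ℝ), 0 < ε → ContDiff ℝ ∞ η → (∀ r ≤ ε, η r = η 0) →
      (∀ r ≥ R, η r = 0) → ∫ r in Ioi (0 : ℝ), W r * deriv η r = ∫ r in Ioi (0 : ℝ), b r * η r) :
    ∀ᵐ r ∂(volume.restrict (Ioi (0 : ℝ))), W r = - ∫ s in (0 : ℝ)..r, b s := by
  have hbi : ∀ R, 0 ≤ R → IntervalIntegrable b volume 0 R := fun R hR =>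
    (intervalIntegrable_iff_integrableOn_Ioc_of_le hR).2 (hb R)
  set F : ℝ → ℝ := fun r => ∫ s in (0 : ℝ)..r, b s with hF
  have hFac : ∀ R, 0 ≤ R → AbsolutelyContinuousOnInterval F 0 R := fun R hR =>
    (hbi R hR).absolutelyContinuousOnInterval_intervalIntegral left_mem_uIcc
  have hloc : LocallyIntegrableOn (fun r => W r + F r) (Ioi 0) := by
    rw [locallyIntegrableOn_iff isOpen_Ioi.isLocallyClosed]
    intro K hK hKc
    obtain ⟨R, hR, hKR⟩ := hKc.isBounded.subset_closedBall_lt 0 0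
    have hsub : K ⊆ Ioc 0 R := fun x hx =>
      ⟨hK hx, (le_abs_self x).trans (by simpa using hKR hx)⟩
    refine IntegrableOn.mono_set ((hW R).add ?_) hsub
    have := (hFac R hR.le).continuousOn
    rw [uIcc_of_le hR.le] at this
    exact (this.integrableOn_compact isCompact_Icc).mono_set Ioc_subset_Icc_self
  have key := IsOpen.ae_eq_zero_of_integral_contDiff_smul_eq_zero isOpen_Ioi hloc ?_
  · rw [ae_restrict_iff' measurableSet_Ioi]
    filter_upwards [key] with r hr hr0
    linarith [hr hr0]
  intro ζ hζ hζc hζs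
  obtain ⟨R, hR, hKR⟩ := hζc.isCompact.isBounded.subset_closedBall_lt 0 0
  have hζR : ∀ r, R < r → ζ r = 0 := fun r hr => by
    refine image_eq_zero_of_notMem_tsupport fun hmem => ?_
    have := hKR hmem
    rw [mem_closedBall_zero_iff, Real.norm_eq_abs] at this
    exact absurd ((le_abs_self r).trans this) (not_le.2 hr)
  obtain ⟨ε, hε, hζε⟩ : ∃ ε, 0 < ε ∧ ∀ r ≤ ε, ζ r = 0 := by
    have hopen : (tsupport ζ)ᶜ ∈ 𝓝 (0 : ℝ) :=
      (isClosed_tsupport ζ).isOpen_compl.mem_nhds fun h0 => lt_irrefl (0 : ℝ) (hζs h0)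
    obtain ⟨ε, hε, hball⟩ := Metric.mem_nhds_iff.1 hopen
    refine ⟨ε / 2, half_pos hε, fun r hr => ?_⟩
    refine image_eq_zero_of_notMem_tsupport fun hmem => ?_
    have h0 : 0 < r := hζs hmem
    refine hball ?_ hmem
    rw [mem_ball_zero_iff, Real.norm_eq_abs, abs_of_pos h0]
    linarith
  -- The primitive of `ζ` that vanishes beyond `R` is admissible: it is constant near zero but need
  -- not vanish there. Allowing `η 0 ≠ 0` is what encodes `W(0) = 0` and leaves no integration
  -- constant.
  set η : ℝ → ℝ := fun r => ∫ s in R..r, ζ s with hη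
  have hηd : ∀ r, HasDerivAt η (ζ r) r := fun r =>
    (hζ.continuous.integral_hasStrictDerivAt R r).hasDerivAt
  have hηd' : deriv η = ζ := funext fun r => (hηd r).deriv
  have hηs : ContDiff ℝ ∞ η := contDiff_infty_iff_deriv.2
    ⟨fun r => (hηd r).differentiableAt, by rw [hηd']; exact hζ⟩
  have hη0 : ∀ r ≤ ε, η r = η 0 := by
    intro r hr
    have hi : ∀ x y, IntervalIntegrable ζ volume x y := fun x y =>
      hζ.continuous.intervalIntegrable x y
    have h1 : η 0 + ∫ s in (0 : ℝ)..r, ζ s = η r :=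
      intervalIntegral.integral_add_adjacent_intervals (hi _ _) (hi _ _)
    have h2 : ∫ s in (0 : ℝ)..r, ζ s = 0 := by
      refine (intervalIntegral.integral_congr (g := fun _ => 0) fun s hs => ?_).trans (by simp)
      refine hζε s (hs.2.trans ?_)
      exact max_le hε.le hr
    rw [← h1, h2, add_zero]
  have hηR : ∀ r ≥ R, η r = 0 := by
    intro r hr
    refine (intervalIntegral.integral_congr_ae (g := fun _ => 0) (ae_of_all _ fun s hs => ?_)).trans
      (by simp)
    rw [uIoc_of_le hr] at hs
    exact hζR s hs.1
  have h1 := h η ε R hε hηs hη0 hηR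
  rw [hηd'] at h1
  have h2 : ∫ r in Ioi (0 : ℝ), b r * η r = ∫ r in (0 : ℝ)..R, b r * η r := by
    rw [intervalIntegral.integral_of_le hR.le]
    refine (setIntegral_eq_of_subset_of_forall_sdiff_eq_zero measurableSet_Ioi
      Ioc_subset_Ioi_self fun r hr => ?_)
    have : R ≤ r := by
      by_contra hcon
      exact hr.2 ⟨hr.1, (not_le.1 hcon).le⟩
    rw [hηR r this, mul_zero]
  have hηac : AbsolutelyContinuousOnInterval η 0 R := by
    have := (hζ.continuous.intervalIntegrable 0 R).absolutelyContinuousOnInterval_intervalIntegral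
      (c := R) right_mem_uIcc
    exact this
  -- Here `b` is only integrable, so integration by parts is done for absolutely continuous
  -- functions. Both boundary terms vanish: `F 0 = 0` and `η R = 0`.
  have h3 := (hFac R hR.le).integral_mul_deriv_eq_deriv_mul hηac
  rw [hηR R le_rfl, hηd'] at h3
  have hF0 : F 0 = 0 := by simp [hF]
  rw [hF0, mul_zero, zero_mul, sub_zero, zero_sub] at h3
  have h4 : ∫ r in (0 : ℝ)..R, deriv F r * η r = ∫ r in (0 : ℝ)..R, b r * η r := by
    refine intervalIntegral.integral_congr_ae ?_
    filter_upwards [(hbi R hR.le).ae_hasDerivAt_integral] with r hr hrR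
    rw [((hr (uIoc_subset_uIcc hrR)) 0 left_mem_uIcc).deriv]
  have h5 : ∀ G : ℝ → ℝ, ∫ r in Ioi (0 : ℝ), G r * ζ r = ∫ r in (0 : ℝ)..R, G r * ζ r := by
    intro G
    rw [intervalIntegral.integral_of_le hR.le]
    refine (setIntegral_eq_of_subset_of_forall_sdiff_eq_zero measurableSet_Ioi
      Ioc_subset_Ioi_self fun r hr => ?_)
    have : R < r := by
      by_contra hcon
      exact hr.2 ⟨hr.1, not_lt.1 hcon⟩
    rw [hζR r this, mul_zero]
  have h6 : ∫ r, ζ r • (W r + F r) = ∫ r in Ioi (0 : ℝ), (W r + F r) * ζ r := by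
    symm
    refine (setIntegral_eq_integral_of_forall_compl_eq_zero fun r hr => ?_).trans
      (integral_congr_ae (ae_of_all _ fun r => mul_comm _ _))
    rw [hζε r ((not_lt.1 hr).trans hε.le), mul_zero]
  rw [h6, h5]
  have hWi : IntervalIntegrable (fun r => W r * ζ r) volume 0 R :=
    (((intervalIntegrable_iff_integrableOn_Ioc_of_le hR.le).2 (hW R))).mul_continuousOn
      hζ.continuous.continuousOn
  have hFi : IntervalIntegrable (fun r => F r * ζ r) volume 0 R :=
    ((hFac R hR.le).continuousOn.mul hζ.continuous.continuousOn).intervalIntegrable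
  simp_rw [add_mul]
  rw [intervalIntegral.integral_add hWi hFi, h3, h4, ← h2, ← h1, h5]
  ring

variable {n : ℕ} {ψ : ℝ → ℝ} {p q : ℝ} {u : EuclideanSpace ℝ (Fin n) → ℝ}
  {X : EuclideanSpace ℝ (Fin n) → EuclideanSpace ℝ (Fin n)} {g κ : ℝ → ℝ}

/-- Smoothness of radial test functions. -/
lemma contDiff_comp_norm {η : ℝ → ℝ} {ε : ℝ} (hε : 0 < ε) (hη : ContDiff ℝ ∞ η)
    (h0 : ∀ r ≤ ε, η r = η 0) : ContDiff ℝ ∞ fun x : EuclideanSpace ℝ (Fin n) => η ‖x‖ := by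
  rw [contDiff_iff_contDiffAt]
  intro x
  rcases eq_or_ne x 0 with rfl | hx
  · refine (contDiffAt_const (c := η 0)).congr_of_eventuallyEq ?_
    filter_upwards [Metric.ball_mem_nhds (0 : EuclideanSpace ℝ (Fin n)) hε] with y hy
    exact h0 _ (mem_ball_zero_iff.1 hy).le
  · exact hη.contDiffAt.comp x (contDiffAt_norm ℝ hx)

variable [NeZero n]

/-- The weak equation tested with radial functions. -/
lemma integral_radial_test (hψ : IsCartanHadamardModel ψ)
    (hX : ∀ᵐ x : EuclideanSpace ℝ (Fin n), modelNorm n ψ x (X x) = |κ ‖x‖ * ‖x‖| ∧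
      inner ℝ x (X x) = κ ‖x‖ * ‖x‖ ^ 2)
    (hug : ∀ᵐ x, u x = g ‖x‖)
    (hw : ∀ φ : EuclideanSpace ℝ (Fin n) → ℝ, ContDiff ℝ ∞ φ → HasCompactSupport φ →
      ∫ x, modelNorm n ψ x (X x) ^ (p - 2) * fderiv ℝ φ x (X x) ∂(modelVolume n ψ) =
        ∫ x, u x ^ q * φ x ∂(modelVolume n ψ))
    {η : ℝ → ℝ} {ε R : ℝ} (hε : 0 < ε) (hη : ContDiff ℝ ∞ η)
    (h0 : ∀ r ≤ ε, η r = η 0) (hR : ∀ r ≥ R, η r = 0) :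
    ∫ r in Ioi (0 : ℝ), modelWeight n ψ r * (|κ r * r| ^ (p - 2) * (κ r * r)) * deriv η r =
      ∫ r in Ioi (0 : ℝ), modelWeight n ψ r * g r ^ q * η r := by
  have h1 := hw (fun x => η ‖x‖) (contDiff_comp_norm hε hη h0)
    (HasCompactSupport.intro (isCompact_closedBall 0 R) fun x hx => hR _ (by
      rw [mem_closedBall_zero_iff, not_le] at hx; exact hx.le))
  rw [integral_modelVolume hψ, integral_modelVolume hψ] at h1
  have e1 : ∫ x : EuclideanSpace ℝ (Fin n), radialDensity n ψ ‖x‖ *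
      (modelNorm n ψ x (X x) ^ (p - 2) * fderiv ℝ (fun x => η ‖x‖) x (X x)) =
      ∫ x : EuclideanSpace ℝ (Fin n), (fun r => radialDensity n ψ r *
        (|κ r * r| ^ (p - 2) * (κ r * r)) * deriv η r) ‖x‖ := by
    refine integral_congr_ae ?_
    filter_upwards [hX, Measure.ae_ne volume (0 : EuclideanSpace ℝ (Fin n))] with x hx hx0
    have hr : ‖x‖ ≠ 0 := norm_ne_zero_iff.2 hx0
    rw [hx.1, (((hη.differentiable (by simp)) ‖x‖).hasDerivAt.hasFDerivAt_comp_norm hx0).fderiv,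
      smul_apply, innerSL_apply_apply, hx.2, smul_eq_mul]
    field_simp
  have e2 : ∫ x : EuclideanSpace ℝ (Fin n), radialDensity n ψ ‖x‖ * (u x ^ q * η ‖x‖) =
      ∫ x : EuclideanSpace ℝ (Fin n), (fun r => radialDensity n ψ r * g r ^ q * η r) ‖x‖ := by
    refine integral_congr_ae ?_
    filter_upwards [hug] with x hx
    rw [hx, mul_assoc]
  rw [e1, e2, integral_fun_norm_addHaar volume fun r => radialDensity n ψ r *
    (|κ r * r| ^ (p - 2) * (κ r * r)) * deriv η r, integral_fun_norm_addHaar volume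
    fun r => radialDensity n ψ r * g r ^ q * η r, finrank_euclideanSpace_fin] at h1
  have hball : volume.real (Metric.ball (0 : EuclideanSpace ℝ (Fin n)) 1) ≠ 0 :=
    (ENNReal.toReal_pos (Metric.measure_ball_pos _ _ one_pos).ne' measure_ball_lt_top.ne).ne'
  rw [nsmul_eq_mul, nsmul_eq_mul, smul_eq_mul, smul_eq_mul] at h1
  have h2 := mul_left_cancel₀ hball (mul_left_cancel₀ (NeZero.ne (n : ℝ)) h1)
  have e3 : ∀ r ∈ Ioi (0 : ℝ), r ^ (n - 1) * radialDensity n ψ r = modelWeight n ψ r := by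
    intro r hr
    have : 0 < r := hr
    rw [radialDensity]
    field_simp
  refine (setIntegral_congr_fun measurableSet_Ioi fun r hr => ?_).trans
    (h2.trans (setIntegral_congr_fun measurableSet_Ioi fun r hr => ?_))
  · simp only [smul_eq_mul]
    rw [← e3 r hr]; ring
  · simp only [smul_eq_mul]
    rw [← e3 r hr]; ring

end Converse

/-! ### Radial weak solutions come from profiles. -/

section Classification

lemma eq_neg_rpow_of_abs_rpow_mul {p t y : ℝ} (hp : 1 < p) (hy : 0 ≤ y)
    (h : |t| ^ (p - 2) * t = -y) : t = -y ^ (1 / (p - 1)) := by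
  have hp1 : 0 < p - 1 := sub_pos.2 hp
  rcases lt_trichotomy t 0 with ht | rfl | ht
  · have h1 : y = (-t) ^ (p - 1) := by
      rw [abs_of_neg ht] at h
      rw [show p - 1 = p - 2 + 1 by ring, Real.rpow_add_one (neg_pos.2 ht).ne']
      linarith
    rw [h1, ← Real.rpow_mul (neg_pos.2 ht).le, mul_one_div_cancel hp1.ne', Real.rpow_one, neg_neg]
  · have : y = 0 := by simpa using h.symm
    rw [this, Real.zero_rpow (by positivity), neg_zero]
  · have h1 : 0 < |t| ^ (p - 2) * t := mul_pos (Real.rpow_pos_of_pos (abs_pos.2 ht.ne') _) ht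
    linarith

/-- Equality holds for `t ≠ 0`; at `t = 0` the left side is zero while the right side may be `0 ^ 0
= 1`. -/
lemma abs_abs_rpow_mul_le {p : ℝ} (t : ℝ) : |(|t| ^ (p - 2) * t)| ≤ |t| ^ (p - 1) := by
  rcases eq_or_ne t 0 with rfl | ht
  · simp [Real.rpow_nonneg]
  · rw [abs_mul, abs_of_nonneg (Real.rpow_nonneg (abs_nonneg _) _),
      ← Real.rpow_add_one (abs_pos.2 ht).ne']
    exact le_of_eq (by ring_nf)

variable {n : ℕ} {ψ : ℝ → ℝ} {p q : ℝ} {u : EuclideanSpace ℝ (Fin n) → ℝ}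
  {X : EuclideanSpace ℝ (Fin n) → EuclideanSpace ℝ (Fin n)} {g κ : ℝ → ℝ}

lemma modelNorm_eq_of_flatGradient_eq {x : EuclideanSpace ℝ (Fin n)} (hx : x ≠ 0) {c : ℝ}
    (h : flatGradient n ψ X x = c • x) :
    modelNorm n ψ x (X x) = |c * ‖x‖| ∧ inner ℝ x (X x) = c * ‖x‖ ^ 2 := by
  have hr : ‖x‖ ≠ 0 := norm_ne_zero_iff.2 hx
  have h1 : inner ℝ x (X x) = c * ‖x‖ ^ 2 := by
    have h2 := inner_flatGradient (ψ := ψ) (X := X) hx x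
    rw [h, real_inner_smul_left, real_inner_self_eq_norm_sq, modelMetric_of_ne hx,
      real_inner_self_eq_norm_sq, real_inner_comm x (X x)] at h2
    rw [h2]
    field_simp
    ring
  refine ⟨?_, h1⟩
  rw [modelNorm, ← inner_flatGradient hx, h, real_inner_smul_left, h1,
    show c * (c * ‖x‖ ^ 2) = (c * ‖x‖) ^ 2 by ring, Real.sqrt_sq_eq_abs]

variable [NeZero n]

lemma IsLocSobolevBounded.exists_ae_abs_le (hψ : IsCartanHadamardModel ψ)
    (h : IsLocSobolevBounded n ψ p u X) (hug : ∀ᵐ x, u x = g ‖x‖) (R : ℝ) :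
    ∃ M, ∀ᵐ r ∂(volume.restrict (Ioi (0 : ℝ))), r ≤ R → |g r| ≤ M := by
  have h1 := (h.memLp_top _ (isCompact_closedBall (0 : EuclideanSpace ℝ (Fin n)) R)).mono_measure
    (volume_restrict_le hψ _)
  have h2 := h1.eLpNorm_lt_top
  rw [eLpNorm_exponent_top] at h2
  refine ⟨(eLpNormEssSup u (volume.restrict (Metric.closedBall 0 R))).toReal,
    (ae_norm_iff (n := n)).1 ?_⟩
  have h3 := (ae_restrict_iff' (Metric.isClosed_closedBall.measurableSet)).1
    (ae_le_eLpNormEssSup (f := u)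
      (μ := volume.restrict (Metric.closedBall (0 : EuclideanSpace ℝ (Fin n)) R)))
  filter_upwards [hug, h3] with x hx hx3 hxR
  rw [← hx, ← Real.norm_eq_abs, ← toReal_enorm]
  exact ENNReal.toReal_mono h2.ne (hx3 (mem_closedBall_zero_iff.2 hxR))

/-- On a bounded set of finite volume, `|∇u| ∈ L^p` implies `|∇u|^(p-1) ∈ L¹`; polar coordinates
turn `dV` into `ψ^(n-1) dr`. -/
lemma IsLocSobolevBounded.integrableOn_weight_mul (hψ : IsCartanHadamardModel ψ) (hp : 1 < p)
    (h : IsLocSobolevBounded n ψ p u X) (hκ : Measurable κ)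
    (hX : ∀ᵐ x : EuclideanSpace ℝ (Fin n), modelNorm n ψ x (X x) = |κ ‖x‖ * ‖x‖|) (R : ℝ) :
    IntegrableOn (fun r => modelWeight n ψ r * (|κ r * r| ^ (p - 2) * (κ r * r))) (Ioc 0 R) := by
  have hp1 : 0 < p - 1 := sub_pos.2 hp
  set K := Metric.closedBall (0 : EuclideanSpace ℝ (Fin n)) (R + 1) with hK
  have hKc : IsCompact K := isCompact_closedBall _ _
  have : IsFiniteMeasure ((modelVolume n ψ).restrict K) :=
    ⟨by rw [Measure.restrict_apply_univ]; exact modelVolume_lt_top hψ hKc⟩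
  have h1 : MemLp (fun x => modelNorm n ψ x (X x)) (ENNReal.ofReal (p - 1))
      ((modelVolume n ψ).restrict K) :=
    (h.memLp_grad K hKc).mono_exponent (ENNReal.ofReal_le_ofReal (by linarith))
  have h2 := h1.integrable_norm_rpow (by simpa using hp1) ENNReal.ofReal_ne_top
  rw [ENNReal.toReal_ofReal hp1.le, modelVolume_eq hψ, restrict_withDensity hKc.measurableSet,
    integrable_withDensity_iff_integrable_smul' (measurable_radialDensity_norm hψ).ennreal_ofReal
      (ae_of_all _ fun _ => ENNReal.ofReal_lt_top)] at h2
  have h3 : IntegrableOn (fun x : EuclideanSpace ℝ (Fin n) =>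
      (fun r => radialDensity n ψ r * |κ r * r| ^ (p - 1)) ‖x‖) (Metric.ball 0 (R + 1)) := by
    refine IntegrableOn.mono_set (t := K) (h2.congr ?_) Metric.ball_subset_closedBall
    filter_upwards [ae_restrict_of_ae hX] with x hx
    rw [ENNReal.toReal_ofReal (radialDensity_nonneg hψ (norm_nonneg x)), hx, smul_eq_mul,
      Real.norm_eq_abs, abs_abs]
  rw [integrableOn_fun_norm_addHaar volume (f := fun r =>
    radialDensity n ψ r * |κ r * r| ^ (p - 1)), finrank_euclideanSpace_fin] at h3
  refine Integrable.mono' (h3.mono_set fun r hr => ⟨hr.1, hr.2.trans_lt (lt_add_one R)⟩) ?_ ?_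
  · have hw : Measurable (modelWeight n ψ) := (hψ.continuous_max.pow _).measurable
    have hk : Measurable fun r => κ r * r := hκ.mul measurable_id
    exact (hw.mul (((continuous_abs.measurable.comp hk).pow_const _).mul hk)).aestronglyMeasurable
  · refine ae_restrict_of_forall_mem measurableSet_Ioc fun r hr => ?_
    have hr0 : 0 < r := hr.1
    have hw : 0 ≤ modelWeight n ψ r := by
      rw [modelWeight_of_nonneg hr0.le]; exact pow_nonneg (hψ.nonneg hr0.le) _
    have e : r ^ (n - 1) * radialDensity n ψ r = modelWeight n ψ r := by
      rw [radialDensity, mul_div_cancel₀ _ (pow_pos hr0 _).ne']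
    rw [smul_eq_mul, ← mul_assoc (r ^ (n - 1)), e, norm_mul, Real.norm_of_nonneg hw]
    exact mul_le_mul_of_nonneg_left (abs_abs_rpow_mul_le _) hw

/-- Nonnegative measurable profile, vanishing on `(-∞, 0]`, together with the radial coefficient
of the gradient. -/
lemma IsRadialSolution.exists_measurable_data (hψ : IsCartanHadamardModel ψ) (hp : 1 < p)
    (h : IsRadialSolution n ψ p q u) :
    ∃ X : EuclideanSpace ℝ (Fin n) → EuclideanSpace ℝ (Fin n), ∃ g κ : ℝ → ℝ,
      IsLocSobolevBounded n ψ p u X ∧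
      (∀ φ : EuclideanSpace ℝ (Fin n) → ℝ, ContDiff ℝ ∞ φ → HasCompactSupport φ →
        ∫ x, modelNorm n ψ x (X x) ^ (p - 2) * fderiv ℝ φ x (X x) ∂(modelVolume n ψ) =
          ∫ x, u x ^ q * φ x ∂(modelVolume n ψ)) ∧
      Measurable g ∧ Measurable κ ∧ (∀ r, 0 ≤ g r) ∧ (∀ r ≤ 0, g r = 0) ∧
      (∀ᵐ x, 0 < u x) ∧ (∀ᵐ x, u x = g ‖x‖) ∧ (∀ᵐ x, flatGradient n ψ X x = κ ‖x‖ • x) := by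
  obtain ⟨⟨hpos, X, hS, hw⟩, g₀, hg₀⟩ := h
  rw [HasRadialProfile, ae_modelVolume hψ] at hg₀
  rw [ae_modelVolume hψ] at hpos
  have hu := hS.locallyIntegrable hψ
  have hξ := hS.locallyIntegrable_flatGradient hψ hp
  obtain ⟨g₁, hg₁m, hg₁⟩ := exists_measurable_profile hu.aestronglyMeasurable hg₀
  obtain ⟨κ₀, hκ₀⟩ := exists_radial_gradient hg₀ hu hξ
    fun φ hφ hφc v => hS.integral_mul_fderiv hφ hφc v
  have hne := Measure.ae_ne volume (0 : EuclideanSpace ℝ (Fin n))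
  obtain ⟨κ, hκm, hκ⟩ := exists_measurable_profile (g := κ₀)
    (v := fun x => inner ℝ (flatGradient n ψ X x) x / ‖x‖ ^ 2)
    ((hξ.aestronglyMeasurable.inner aestronglyMeasurable_id).aemeasurable.div
      (measurable_norm.pow_const 2).aemeasurable).aestronglyMeasurable (by
      filter_upwards [hκ₀, hne] with x hx hx0
      have hr : ‖x‖ ^ 2 ≠ 0 := pow_ne_zero _ (norm_ne_zero_iff.2 hx0)
      rw [hx, real_inner_smul_left, real_inner_self_eq_norm_sq, mul_div_cancel_right₀ _ hr])
  -- Replacing the profile by its absolute value on `(0, ∞)` and by zero elsewhere changes nothing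
  -- almost everywhere, since `u > 0`, and makes `g ^ q` nonnegative at every radius.
  refine ⟨X, (Ioi 0).indicator fun r => |g₁ r|, κ, hS, hw,
    (continuous_abs.measurable.comp hg₁m).indicator measurableSet_Ioi, hκm,
    fun r => indicator_nonneg (fun _ _ => abs_nonneg _) r,
    fun r hr => indicator_of_notMem (not_lt.2 hr) _, hpos, ?_, ?_⟩
  · filter_upwards [hg₁, hpos, hne] with x hx hx0 hxne
    rw [indicator_of_mem (mem_Ioi.2 (norm_pos_iff.2 hxne)), ← hx, abs_of_pos hx0]
  · filter_upwards [hκ₀, hκ, hne] with x hx hx1 hxne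
    have hr : ‖x‖ ^ 2 ≠ 0 := pow_ne_zero _ (norm_ne_zero_iff.2 hxne)
    rw [← hx1, hx, real_inner_smul_left, real_inner_self_eq_norm_sq, mul_div_cancel_right₀ _ hr]

/-- Radial weak solutions are given by positive solutions of the radial equation. -/
theorem IsRadialSolution.exists_isPositiveProfile (hn : 2 ≤ n) (hψ : IsCartanHadamardModel ψ)
    (hp : 1 < p) (hq : 0 < q) (h : IsRadialSolution n ψ p q u) :
    ∃ (f : ℝ → ℝ) (α : ℝ), (∀ R, IsPositiveProfile (modelWeight n ψ) p q α R f) ∧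
      ∀ᵐ x, u x = f ‖x‖ := by
  have hp1 : 0 < p - 1 := sub_pos.2 hp
  have hγ : 0 < 1 / (p - 1) := by positivity
  have w := hψ.isRadialWeight hn
  obtain ⟨X, g, κ, hS, hw, hgm, hκm, hg0, hgneg, hpos, hug, hξ⟩ := h.exists_measurable_data hψ hp
  have hne := Measure.ae_ne volume (0 : EuclideanSpace ℝ (Fin n))
  have hX : ∀ᵐ x : EuclideanSpace ℝ (Fin n), modelNorm n ψ x (X x) = |κ ‖x‖ * ‖x‖| ∧
      inner ℝ x (X x) = κ ‖x‖ * ‖x‖ ^ 2 := by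
    filter_upwards [hξ, hne] with x hx hx0 using modelNorm_eq_of_flatGradient_eq hx0 hx
  have hbound : ∀ R, ∃ M, 0 ≤ M ∧ ∀ᵐ r : ℝ, r ≤ R → |g r ^ q| ≤ M := by
    intro R
    obtain ⟨M, hM⟩ := hS.exists_ae_abs_le hψ hug R
    rw [ae_restrict_iff' measurableSet_Ioi] at hM
    refine ⟨|M| ^ q, by positivity, ?_⟩
    filter_upwards [hM] with r hr hrR
    rw [abs_of_nonneg (Real.rpow_nonneg (hg0 r) q)]
    refine Real.rpow_le_rpow (hg0 r) ?_ hq.le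
    rcases le_or_gt r 0 with h0 | h0
    · rw [hgneg r h0]; exact abs_nonneg _
    · exact (le_abs_self _).trans ((hr h0 hrR).trans (le_abs_self M))
  have hgi : ∀ x y, IntervalIntegrable (fun r => g r ^ q) volume x y := by
    intro x y
    obtain ⟨M, -, hM⟩ := hbound (max x y)
    rw [intervalIntegrable_iff]
    refine Measure.integrableOn_of_bounded (M := M) measure_Ioc_lt_top.ne
      (hgm.pow_const q).aestronglyMeasurable ?_
    rw [ae_restrict_iff' measurableSet_uIoc]
    exact hM.mono fun r hr hrm => hr hrm.2
  have hbi : ∀ x y, IntervalIntegrable (fun r => modelWeight n ψ r * g r ^ q) volume x y :=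
    fun x y => (hgi x y).continuousOn_mul w.continuous.continuousOn
  have hbO : ∀ R, IntegrableOn (fun r => modelWeight n ψ r * g r ^ q) (Ioc 0 R) := fun R =>
    (hbi 0 R).1
  -- Radial testing gives `a |κ r|^(p-2) κ r = -∫₀ʳ a g^q` almost everywhere; inverting `t ↦
  -- |t|^(p-2) t` then expresses `κ r` through the continuous flux `y`.
  have hWF := ae_eq_neg_integral
    (hS.integrableOn_weight_mul hψ hp hκm (hX.mono fun x hx => hx.1)) hbO
    fun η ε R hε hη h0 hR => integral_radial_test hψ hX hug hw hε hη h0 hR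
  set y := radialFlux (modelWeight n ψ) fun t => g t ^ q with hy
  have hyc : Continuous y := by
    obtain ⟨M, hM0, hM⟩ := hbound 1
    exact w.continuous_radialFlux_of_bounded hgi hM0 (hM.mono fun t ht h1 => ht h1.2)
  have hy0 : ∀ r, 0 ≤ y r := by
    intro r
    rcases le_or_gt r 0 with h0 | h0
    · exact (w.radialFlux_of_nonpos _ h0).ge
    · exact div_nonneg (intervalIntegral.integral_nonneg h0.le fun t _ =>
        mul_nonneg (w.nonneg t) (Real.rpow_nonneg (hg0 t) q)) (w.nonneg r)
  have hκy : ∀ᵐ x : EuclideanSpace ℝ (Fin n), κ ‖x‖ * ‖x‖ = -y ‖x‖ ^ (1 / (p - 1)) := by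
    refine (ae_norm_iff (P := fun r => κ r * r = -y r ^ (1 / (p - 1)))).2 ?_
    filter_upwards [hWF, ae_restrict_mem measurableSet_Ioi] with r hr hr0
    have hr0 : 0 < r := hr0
    refine eq_neg_rpow_of_abs_rpow_mul hp (hy0 r) ?_
    have har := w.pos r hr0
    rw [← w.mul_radialFlux _ hr0, ← mul_neg] at hr
    exact mul_left_cancel₀ har.ne' hr
  set k : ℝ → ℝ := fun r => -y r ^ (1 / (p - 1)) with hk
  have hkc : Continuous k := ((Real.continuous_rpow_const hγ.le).comp hyc).neg
  have hk0 : k 0 = 0 := by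
    simp only [hk, hy]
    rw [w.radialFlux_of_nonpos _ le_rfl, Real.zero_rpow hγ.ne', neg_zero]
  set G : ℝ → ℝ := fun r => ∫ s in (0 : ℝ)..r, k s with hG
  have hGd : ∀ r, HasDerivAt G (k r) r := fun r => (hkc.integral_hasStrictDerivAt 0 r).hasDerivAt
  have hGc : Continuous G := continuous_iff_continuousAt.2 fun r => (hGd r).continuousAt
  have hGn : Continuous fun x : EuclideanSpace ℝ (Fin n) => G ‖x‖ := hGc.comp continuous_norm
  have hu := hS.locallyIntegrable hψ
  -- The functions `u` and `G(‖x‖)` have the same weak gradient, so they differ by a constant, which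
  -- becomes the height `α`.
  have hzero : ∀ φ : EuclideanSpace ℝ (Fin n) → ℝ, ContDiff ℝ ∞ φ → HasCompactSupport φ →
      ∀ v, ∫ x, (u x - G ‖x‖) * fderiv ℝ φ x v = 0 := by
    intro φ hφ hφc v
    have hφd : Continuous fun x => fderiv ℝ φ x v :=
      (hφ.continuous_fderiv (by simp)).clm_apply continuous_const
    have hφdc : HasCompactSupport fun x => fderiv ℝ φ x v := hφc.fderiv_apply (𝕜 := ℝ) v
    have hfd := hasFDerivAt_integral_norm (n := n) hkc hk0
    have hcont : Continuous fun x : EuclideanSpace ℝ (Fin n) =>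
        inner ℝ ((k ‖x‖ / ‖x‖) • x) v :=
      (continuous_radialField hkc hk0).inner continuous_const
    obtain ⟨C, hC⟩ := hφc.isCompact.exists_bound_of_continuousOn hcont.continuousOn
    have h1 := (integral_mul_fderiv_eq_neg (μ := volume) (w := fun x => G ‖x‖)
      (fun x => (hfd x).differentiableAt) hφ hφc v (C := C) (ae_of_all _ fun x hx => by
        rw [(hfd x).fderiv]; exact hC x hx)).2
    have h2 := hS.integral_mul_fderiv hφ hφc v
    simp_rw [sub_mul]
    rw [integral_sub, h1, h2, sub_eq_zero, neg_inj]
    · refine integral_congr_ae ?_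
      filter_upwards [hξ, hκy, hne] with x hx hx1 hx0
      rw [(hfd x).fderiv, hx, innerSL_apply_apply]
      simp only [hk]
      rw [← hx1, mul_div_cancel_right₀ _ (norm_ne_zero_iff.2 hx0)]
    · have := hu.integrable_smul_right_of_hasCompactSupport hφd hφdc
      simpa using this
    · exact (hGn.mul hφd).integrable_of_hasCompactSupport hφdc.mul_left
  obtain ⟨α, hα⟩ := ae_eq_const_of_weak_gradient_zero (hu.sub hGn.locallyIntegrable) hzero
  have huf : ∀ᵐ x, u x = α + G ‖x‖ := hα.mono fun x hx => by
    have : u x - G ‖x‖ = α := hx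
    linarith
  have hgf : ∀ᵐ r ∂(volume.restrict (Ioi (0 : ℝ))), g r = α + G r := by
    refine (ae_norm_iff (n := n) (P := fun r => g r = α + G r)).1 ?_
    filter_upwards [hug, huf] with x h1 h2
    rw [← h1, h2]
  have hfpos : ∀ᵐ r ∂(volume.restrict (Ioi (0 : ℝ))), 0 < α + G r := by
    refine (ae_norm_iff (n := n) (P := fun r => 0 < α + G r)).1 ?_
    filter_upwards [hpos, huf] with x h1 h2
    rwa [← h2]
  have hGanti : Antitone G := antitone_of_hasDerivAt_nonpos hGd fun r =>
    neg_nonpos.2 (Real.rpow_nonneg (hy0 r) _)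
  refine ⟨fun r => α + G r, α, fun R => ⟨continuous_const.add hGc, fun r hr => ?_, fun r hr => ?_⟩,
    huf⟩
  -- Positivity is known only almost everywhere, but `G` is nonincreasing: a point `s > r` with a
  -- positive value makes the value at `r` positive too.
  · have h1 : ∀ᵐ s ∂(volume.restrict (Ioi r)), 0 < α + G s :=
      ae_restrict_of_ae_restrict_of_subset (Ioi_subset_Ioi hr.1) hfpos
    have : (ae (volume.restrict (Ioi r))).NeBot := by
      rw [ae_restrict_neBot]; simp
    obtain ⟨s, hs, hrs⟩ := (h1.and (ae_restrict_mem measurableSet_Ioi)).exists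
    have := hGanti (le_of_lt hrs : r ≤ s)
    linarith
  · simp only [hG, hk]
    rw [intervalIntegral.integral_neg, ← sub_eq_add_neg, sub_right_inj]
    refine intervalIntegral.integral_congr fun s hs => ?_
    rw [uIcc_of_le hr.1] at hs
    simp only [hy, radialFlux]
    congr 2
    refine intervalIntegral.integral_congr_ae ?_
    rw [ae_restrict_iff' measurableSet_Ioi] at hgf
    filter_upwards [hgf] with t ht hts
    rw [uIoc_of_le hs.1] at hts
    rw [ht hts.1]
    rfl

end Classification

/-! ### Invariance under almost everywhere equality, and the main theorem. -/

section Congr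

variable {n : ℕ} {ψ : ℝ → ℝ} {p q : ℝ} {u v : EuclideanSpace ℝ (Fin n) → ℝ}

/-- The infinitude claim concerns classes modulo null sets, whose chosen representative need not be
the continuous function that was constructed. -/
lemma IsRadialSolution.congr [NeZero n] (hψ : IsCartanHadamardModel ψ)
    (h : IsRadialSolution n ψ p q u) (huv : u =ᵐ[modelVolume n ψ] v) :
    IsRadialSolution n ψ p q v := by
  have huv' : u =ᵐ[volume] v := by
    rw [Filter.EventuallyEq, ← ae_modelVolume hψ]; exact huv
  obtain ⟨⟨hpos, X, hS, hw⟩, g, hg⟩ := h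
  refine ⟨⟨?_, X, ⟨fun K hK => (hS.memLp K hK).ae_eq (ae_restrict_of_ae huv),
    fun K hK => (hS.memLp_top K hK).ae_eq (ae_restrict_of_ae huv), fun φ hφ hφc w => ?_,
    hS.aestronglyMeasurable_grad, hS.memLp_grad⟩, fun φ hφ hφc => ?_⟩, g, ?_⟩
  · filter_upwards [hpos, huv] with x h1 h2
    rwa [← h2]
  · rw [← hS.isWeakGradient φ hφ hφc w]
    refine integral_congr_ae ?_
    filter_upwards [huv'] with x hx
    rw [hx]
  · rw [hw φ hφ hφc]
    refine integral_congr_ae ?_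
    filter_upwards [huv] with x hx
    rw [hx]
  · filter_upwards [hg, huv] with x h1 h2
    rw [← h2, h1]

end Congr

theorem mainTheorem3 (n : ℕ) (p q : ℝ) (hp : 1 < p) (hpn : p < (n : ℝ))
    (hq : (n : ℝ) * p / ((n : ℝ) - p) - 1 ≤ q)
    (ψ : ℝ → ℝ) (hψ : IsCartanHadamardModel ψ) :
    -- infinitely many radial solutions, as classes of functions modulo equality a.e.
    {U : EuclideanSpace ℝ (Fin n) →ₘ[modelVolume n ψ] ℝ |
      IsRadialSolution n ψ p q U}.Infinite ∧
    -- the `p`-stochastically complete case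
    (¬ IntegrableOn (fun r => modelTheta n ψ r ^ (1 / (p - 1))) (Ioi 0) →
      ∀ u : EuclideanSpace ℝ (Fin n) → ℝ, IsRadialSolution n ψ p q u →
        ∃ f : ℝ → ℝ, HasRadialProfile n ψ u f ∧ ContinuousOn f (Ici 0) ∧
          StrictAntiOn f (Ici 0) ∧ Tendsto f atTop (𝓝 0)) ∧
    -- the `p`-stochastically incomplete case
    (IntegrableOn (fun r => modelTheta n ψ r ^ (1 / (p - 1))) (Ioi 0) →
      ∀ u : EuclideanSpace ℝ (Fin n) → ℝ, IsRadialSolution n ψ p q u →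
        ∃ f : ℝ → ℝ, HasRadialProfile n ψ u f ∧ ContinuousOn f (Ici 0) ∧
          StrictAntiOn f (Ici 0) ∧ ∃ l : ℝ, 0 < l ∧ Tendsto f atTop (𝓝 l)) := by
  have hn : 2 ≤ n := by
    have h1 : (1 : ℝ) < n := hp.trans hpn
    exact_mod_cast h1
  have : NeZero n := ⟨by omega⟩
  have hp0 : 0 < p := by linarith
  have hnp : 0 < (n : ℝ) - p := sub_pos.2 hpn
  have hn0 : (0 : ℝ) < n := hp0.trans hpn
  have hq1 : (n : ℝ) * p / ((n : ℝ) - p) ≤ q + 1 := by linarith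
  have hpq : p < q + 1 := by
    refine lt_of_lt_of_le ?_ hq1
    rw [lt_div_iff₀ hnp]
    nlinarith
  have hq0 : 0 < q := by linarith
  -- This is the hypothesis `q + 1 ≥ p*` rewritten through `1/p* = (n - p)/(n p)`, with equality at
  -- the critical exponent.
  have hpq' : (p - 1) / p + 1 / (q + 1) ≤ 1 - 1 / (n : ℝ) := by
    have h1 : 1 / (q + 1) ≤ ((n : ℝ) - p) / (n * p) := by
      rw [← one_div_div ((n : ℝ) * p)]
      exact one_div_le_one_div_of_le (by positivity) hq1
    have h2 : (p - 1) / p + ((n : ℝ) - p) / (n * p) = 1 - 1 / (n : ℝ) := by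
      field_simp
      ring
    linarith
  have w := hψ.isRadialWeight hn
  have hΘ : IntegrableOn (fun r => modelTheta n ψ r ^ (1 / (p - 1))) (Ioi 0) ↔
      IntegrableOn (fun r => radialFlux (modelWeight n ψ) (fun _ => 1) r ^ (1 / (p - 1)))
        (Ioi 0) := by
    refine integrableOn_congr_fun (fun r hr => ?_) measurableSet_Ioi
    rw [modelTheta_eq hr]
  refine ⟨?_, fun hint u hu => ?_, fun hint u hu => ?_⟩
  -- One solution for each height `k + 1`. Continuous functions equal almost everywhere are equal,
  -- so evaluation at the pole separates the classes.
  · have hex : ∀ k : ℕ, ∃ f, ∀ R, IsPositiveProfile (modelWeight n ψ) p q ((k : ℝ) + 1) R f :=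
      fun k => w.exists_isPositiveProfile hp hpq hpq' (by positivity)
    choose f hf using hex
    have hfc : ∀ k, Continuous fun x : EuclideanSpace ℝ (Fin n) => f k ‖x‖ := fun k =>
      (hf k 0).continuous.comp continuous_norm
    refine Set.infinite_of_injective_forall_mem
      (f := fun k : ℕ => AEEqFun.mk (fun x : EuclideanSpace ℝ (Fin n) => f k ‖x‖)
        (hfc k).aestronglyMeasurable) (fun i j hij => ?_) fun k => ?_
    · have h1 := AEEqFun.mk_eq_mk.1 hij
      rw [Filter.EventuallyEq, ae_modelVolume hψ] at h1
      have h2 := (Continuous.ae_eq_iff_eq volume (hfc i) (hfc j)).1 h1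
      have h3 := congrFun h2 0
      simp only [norm_zero] at h3
      rw [(hf i 0).eq_initial le_rfl, (hf j 0).eq_initial le_rfl] at h3
      exact_mod_cast add_right_cancel h3
    · exact (isRadialSolution_of_isPositiveProfile hn hψ hp hq0 (hf k)).congr hψ
        (AEEqFun.coeFn_mk _ _).symm
  · obtain ⟨f, α, hf, huf⟩ := hu.exists_isPositiveProfile hn hψ hp hq0
    refine ⟨f, ?_, (hf 0).continuous.continuousOn,
      strictAntiOn_of_isPositiveProfile w hp hq0 hf,
      tendsto_zero_of_not_integrableOn w hp hq0 hf (hΘ.not.1 hint)⟩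
    rwa [HasRadialProfile, ae_modelVolume hψ]
  · obtain ⟨f, α, hf, huf⟩ := hu.exists_isPositiveProfile hn hψ hp hq0
    refine ⟨f, ?_, (hf 0).continuous.continuousOn,
      strictAntiOn_of_isPositiveProfile w hp hq0 hf,
      exists_pos_tendsto_of_integrableOn w hp hpq hpq' hf (hΘ.1 hint)⟩
    rwa [HasRadialProfile, ae_modelVolume hψ]
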